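/- Let $E\subset\mathbb{R}$ be either open, or countable and without accumulation points in $\mathbb{R}$, and let $\mu$ be a Radon measure on $E$. Let $\mathrm{Conf}(E)$ be the set of subsets $X\subset E$ without accumulation points (finitely many points in each bounded set), with the $\sigma$-algebra generated by the counting maps $X\mapsto\#(X\cap B)$, $B\subset E$ bounded Borel. Let $\mathbb{P}$ be a determinantal point process on $(E,\mu)$ with correlation kernel $K$, that is, a probability measure on $\mathrm{Conf}(E)$ such that for every $n$ and every bounded Borel compactly supported $f:E^n\to\mathbb{C}$, $$\mathbb{E}_{\mathbb{P}}\sum_{x_1,\dots,x_n\in X\text{ pairwise distinct}} f(x_1,\dots,x_n)=\int_{E^n} f(x_1,\dots,x_n)\,\det\big(K(x_i,x_j)\big)_{i,j=1}^n\,d\mu(x_1)\cdots d\mu(x_n).$$ Assume that $K$ is a Borel kernel that induces on $L^2(E,\mu)$ an orthogonal projection which is locally of trace class, with $\operatorname{Tr}(\chi_BK\chi_B)=\int_B K(x,x)\,d\mu(x)$ for all bounded Borel $B\subset E$, and that $\int_E \frac{K(x,x)}{1+x^2}\,d\mu(x)<\infty$. Fix $R>0$. For $u\in\mathbb{C}\setminus\mathbb{R}$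 and $x\in\mathbb{R}$ put $g_{u+iR}(x)=1-\frac{u+iR}{x+iR}=\frac{x-u}{x+iR}$. With $\operatorname{Log}$ the principal value of the logarithm (and $\operatorname{Log}(-t)=\log t+i\pi$ for $t>0$), consider two determinations of $\log g_{u+iR}(x)$: the principal one, $\operatorname{Log} g_{u+iR}(x)$, and the one that is holomorphic in $u\in\mathbb{C}\setminus\mathbb{R}$, $$\ell_u(x)=\operatorname{Log} g_{u+iR}(x)\ \ (\operatorname{Im}u<0),\qquad \ell_u(x)=\operatorname{Log}\frac{x-u}{x-iR}+\operatorname{Log}\frac{x-iR}{x+iR}\ \ (\operatorname{Im}u>0).$$ Then there are random functions $\Psi_X(u)$, $\Psi^{h}_X(u)$, $\tilde\Psi_X(u)$ of $u \in \mathbb{C}\setminus\mathbb{R}$ with the following properties. (i) For every $u\in\mathbb{C}\setminus\mathbb{R}$, all the variables below are integrable and, in $L^1(\mathrm{Conf}(E),\mathbb{P})$, $$\Psi_X(u)=\lim_{T\to+\infty}\exp\Big(-\int_{E\cap[-T,T]}\operatorname{Log}g_{u+iR}(x)\,K(x,x)\,d\mu(x)\Big)\prod_{x\in X,\,|x|\le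 T}g_{u+iR}(x),$$ $$\Psi^{h}_X(u)=\lim_{T\to+\infty}\exp\Big(-\int_{E\cap[-T,T]}\ell_u(x)\,K(x,x)\,d\mu(x)\Big)\prod_{x\in X,\,|x|\le T}g_{u+iR}(x),$$ $$\tilde\Psi_X(u)=\lim_{T\to+\infty}\exp\Big((u+iR)\int_{E\cap[-T,T]}\frac{K(x,x)}{x+iR}\,d\mu(x)\Big)\prod_{x\in X,\,|x|\le T}g_{u+iR}(x).$$ (ii) For each non-real $u$ the variables $\Psi_X(u)$, $\Psi^h_X(u)$, $\tilde\Psi_X(u)$ are almost surely non-zero. For any $n\in\mathbb{N}$ and $z_1,\dots,z_n,w_1,\dots,w_n\in\mathbb{C}\setminus\mathbb{R}$, the algebra generated by the variables $\Psi_X(z_j)^{\pm1},\Psi_X(w_j)^{\pm1}$ is contained in $L^1(\mathrm{Conf}(E),\mathbb{P})$, and so are the corresponding algebras for $\Psi^h$ and for $\tilde\Psi$. (iii) There is a measurable set $\mathcal{W}\subset\mathrm{Conf}(E)$ with $\mathbb{P}(\mathcal{W})=1$ such that for every compact $\mathcal{K}\subset\mathbb{C}\setminus\mathbb{R}$ there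 is an increasing sequence $T_N\to+\infty$ along which, for every $X\in\mathcal{W}$, the three convergences in (i) hold uniformly for $u\in\mathcal{K}$. For every $X\in\mathcal{W}$ the functions $u\mapsto\Psi^h_X(u)$ and $u\mapsto\tilde\Psi_X(u)$ are analytic on $\mathbb{C}\setminus\mathbb{R}$. Moreover there is a deterministic function $c$ on $\mathbb{C}\setminus\mathbb{R}$ with $|c|=1$, and $c(u)=1$ for $\operatorname{Im}u<0$, such that $\Psi_X(u)=c(u)\Psi^h_X(u)$ for all $X\in\mathcal{W}$ and all $u \in \mathbb{C}\setminus\mathbb{R}$; in particular $\Psi_X$ is analytic on the lower half-plane. -/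

import Mathlib

open MeasureTheory Filter Topology

noncomputable section

namespace RegProd

/-- Configurations on `E ⊆ ℝ`: subsets of `E` without accumulation points in `ℝ`, that is,
subsets of `E` that have finitely many points in every bounded window `[-T, T]`. -/
@[ext]
structure Conf (E : Set ℝ) where
  /-- the set of points of the configuration -/
  carrier : Set E
  finite : ∀ T : ℝ, {x : E | x ∈ carrier ∧ |(x : ℝ)| ≤ T}.Finite

variable {E : Set ℝ}

/-- The sigma-algebra on `Conf E` generated by the counting maps `X ↦ #(X ∩ B)`,
where `B ⊆ E` is a bounded Borel set. -/
instance : MeasurableSpace (Conf E) :=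
  ⨆ (B : Set E) (_ : MeasurableSet B ∧ Bornology.IsBounded B),
    MeasurableSpace.comap (fun X : Conf E => (X.carrier ∩ B).ncard) ⊤

/-- The sum of `f (x₁, …, xₙ)` over all `n`-tuples of pairwise distinct points of `X`. -/
def distinctSum (n : ℕ) (f : (Fin n → E) → ℂ) (X : Conf E) : ℂ :=
  ∑' t : {t : Fin n → E // Function.Injective t ∧ ∀ i, t i ∈ X.carrier}, f t.1

/-- `P` is a determinantal point process on `(E, μ)` with correlation kernel `K`. -/
def IsDeterminantal (μ : Measure E) (K : E → E → ℂ) (P : Measure (Conf E)) : Prop :=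
  ∀ (n : ℕ) (f : (Fin n → E) → ℂ), Measurable f → (∃ C : ℝ, ∀ x, ‖f x‖ ≤ C) →
    HasCompactSupport f →
      Integrable (distinctSum n f) P ∧
      Integrable (fun x : Fin n → E => f x * (Matrix.of fun i j => K (x i) (x j)).det)
        (Measure.pi fun _ => μ) ∧
      ∫ X, distinctSum n f X ∂P =
        ∫ x : Fin n → E, f x * (Matrix.of fun i j => K (x i) (x j)).det ∂(Measure.pi fun _ => μ)

/-- Multiplication by the indicator function of `B` on `L²(E, μ)`. -/
def cutoff (μ : Measure E) (B : Set E) (hB : MeasurableSet B) (f : Lp ℂ 2 μ) : Lp ℂ 2 μ :=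
  ((Lp.memLp f).indicator hB).toLp (B.indicator f)

/-- The Borel kernel `K` induces an orthogonal projection `Q` on `L²(E, μ)` which is locally of
trace class, with `Tr (χ_B Q χ_B) = ∫_B K(x,x) dμ(x)` for every bounded Borel set `B`.
As `χ_B Q χ_B` is a positive operator, it is of trace class iff the sum of its diagonal matrix
elements converges in an orthonormal basis. -/
structure IsProjectionKernel (μ : Measure E) (K : E → E → ℂ) : Prop where
  measurable : Measurable (Function.uncurry K)
  exists_projection : ∃ Q : Lp ℂ 2 μ →L[ℂ] Lp ℂ 2 μ, IsStarProjection Q ∧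
    (∀ f : Lp ℂ 2 μ, ∀ᵐ x ∂μ,
      Integrable (fun y => K x y * f y) μ ∧ Q f x = ∫ y, K x y * f y ∂μ) ∧
    ∀ (B : Set E) (hB : MeasurableSet B), Bornology.IsBounded B →
      IntegrableOn (fun x => K x x) B μ ∧
      ∀ (ι : Type) (b : HilbertBasis ι ℂ (Lp ℂ 2 μ)),
        HasSum (fun i => inner ℂ (b i) (cutoff μ B hB (Q (cutoff μ B hB (b i)))))
          (∫ x in B, K x x ∂μ)

/-- `g_u(x) = 1 - u / (x + iR)`. -/
def g (R : ℝ) (u : ℂ) (x : ℝ) : ℂ := 1 - u / (x + Complex.I * R)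

/-- The principal value of `log g_{u+iR}(x)`. -/
def principalLog (R : ℝ) (u : ℂ) (x : ℝ) : ℂ := Complex.log (g R (u + Complex.I * R) x)

/-- The determination of `log g_{u+iR}(x)`, where `g_{u+iR}(x) = (x - u)/(x + iR)`, that is
holomorphic in `u ∈ ℂ \ ℝ`: the principal value if `Im u < 0`; if `Im u > 0`, the continuation in
`u` of the principal value at `u = iR` (the quotient `(x - u)/(x - iR)` avoids `(-∞, 0]`). -/
def holomorphicLog (R : ℝ) (u : ℂ) (x : ℝ) : ℂ :=
  if u.im < 0 then Complex.log (g R (u + Complex.I * R) x)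
  else Complex.log ((x - u) / (x - Complex.I * R)) +
    Complex.log ((x - Complex.I * R) / (x + Complex.I * R))

/-- `∏_{x ∈ X, |x| ≤ T} g_{u+iR}(x)`. -/
def windowProd (R T : ℝ) (X : Conf E) (u : ℂ) : ℂ :=
  ∏ x ∈ (X.finite T).toFinset, g R (u + Complex.I * R) x

/-- `exp (-∫_{[-T,T]} L_u(x) K(x,x) dμ(x)) ∏_{x ∈ X, |x| ≤ T} g_{u+iR}(x)`, for a determination
`L_u(x)` of `log g_{u+iR}(x)`. -/
def truncPsi (μ : Measure E) (K : E → E → ℂ) (R : ℝ) (L : ℂ → ℝ → ℂ) (T : ℝ)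
    (X : Conf E) (u : ℂ) : ℂ :=
  Complex.exp (-∫ x in {x : E | |(x : ℝ)| ≤ T}, L u x * K x x ∂μ) * windowProd R T X u

/-- `exp ((u+iR) ∫_{[-T,T]} K(x,x)/(x+iR) dμ(x)) ∏_{x ∈ X, |x| ≤ T} g_{u+iR}(x)`. -/
def truncPsiTilde (μ : Measure E) (K : E → E → ℂ) (R T : ℝ) (X : Conf E) (u : ℂ) : ℂ :=
  Complex.exp ((u + Complex.I * R) *
    ∫ x in {x : E | |(x : ℝ)| ≤ T}, K x x / ((x : ℝ) + Complex.I * R) ∂μ) * windowProd R T X u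

/-- `ℂ \ ℝ`. -/
def nonreal : Set ℂ := {u | u.im ≠ 0}

/-- For every non-real `u`, `F T · u → Φ · u` in `L¹(P)` as `T → +∞`. -/
def ConvergesInL1 (P : Measure (Conf E)) (F : ℝ → Conf E → ℂ → ℂ) (Φ : Conf E → ℂ → ℂ) : Prop :=
  ∀ u ∈ nonreal,
    (∀ T, Integrable (fun X => F T X u) P) ∧ Integrable (fun X => Φ X u) P ∧
      Tendsto (fun T => eLpNorm (fun X => F T X u - Φ X u) 1 P) atTop (𝓝 0)

/-- The variables `Φ_X(u)`, `u` non-real, are almost surely non-zero, and all the algebras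
generated by `Φ_X(z_j)^{±1}`, `Φ_X(w_j)^{±1}`, `j = 1, …, n`, are contained in `L¹(P)`. -/
def AlgebrasInL1 (P : Measure (Conf E)) (Φ : Conf E → ℂ → ℂ) : Prop :=
  (∀ u ∈ nonreal, ∀ᵐ X ∂P, Φ X u ≠ 0) ∧
  ∀ (n : ℕ) (z w : Fin n → ℂ), (∀ j, z j ∈ nonreal) → (∀ j, w j ∈ nonreal) →
    ∀ G ∈ Algebra.adjoin ℂ
      ((Set.range fun j => fun X => Φ X (z j)) ∪ (Set.range fun j => fun X => (Φ X (z j))⁻¹) ∪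
        (Set.range fun j => fun X => Φ X (w j)) ∪ (Set.range fun j => fun X => (Φ X (w j))⁻¹)),
      Integrable G P

end RegProd

end

/-! The product over a window is the exponential of the sum of `principalLog R u x` over its points,
whatever the branch. Subtracting the first-order term at infinity, `Log g + (u+iR)/(x+iR)` is
`O(1/(1+x²))` locally uniformly in `u`. The truncated product with linear compensator is therefore
`exp (logTrunc ...)`, where `logTrunc` is `-(u+iR)` times the centered sum of `1/(x+iR)`, plus an
absolutely convergent sum. The only conditionally convergent object is one scalar random variable
independent of `u`. Hence a single subsequence and a single set of full measure serve all compacts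
(`tendstoUniformlyOn_logTrunc`). Choosing a determination of the logarithm changes only a
deterministic factor, the exponential of `compensator`, which converges by the hypothesis on
`K(x,x)/(1+x²)`.

The probabilistic input is one inequality: exponential moments of window sums are at most those of a
Poisson process with intensity `K(x,x)` (`IsDeterminantal.lintegral_exp_sum_le`, recorded in
`IsSubPoisson`). It comes from `E ∏(1+h) = det(1+hK) ≤ exp(Tr hK)` for `h ≥ -1`. For kernels of
finite rank this is the matrix inequality `det(1+M) ≤ exp(tr M)` when `1+M ≥ 0`. The general case
follows by expanding the projection in a Bessel family `Q b_i`
(`IsProjectionKernel.exists_isBesselExpansion`) and passing to the limit in the Fredholm series,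
whose terms obey a geometric bound uniform in the rank (`fredholmTerm_bound`).

Three consequences suffice. Since `y² + 2 ≤ e^y + e^{-y}`, exponential moments bound the second
moments of centered sums beyond `S` by the tail of the intensity, so the centered sums of `1/(x+iR)`
are Cauchy in `L²` (`exists_limit_centeredSum`). The exponential moments of the sum of `1/(1+x²)`
are bounded, so that sum is almost surely finite (`ae_isSummable`). Finally the exponential moments
of `logTrunc` of every order are bounded in the window (`exists_lintegral_exp_logTrunc_le`). The
last fact gives uniform integrability, hence `L¹` convergence, and by Fatou all moments of the
limits and of their inverses, hence the algebras.

Analyticity: the truncations with linear compensator are holomorphic off the real line, so their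
locally uniform limit is analytic. The holomorphic version differs from it by the exponential of an
analytic compensator. The two determinations of the logarithm have the same real part, so their
compensators differ by an imaginary number. -/

namespace RegProd

/-! ### Sums over subsets as sums over injective tuples. -/

section Combinatorics

open Finset

theorem card_filter_embedding_map_eq {ι : Type*} [Fintype ι] [DecidableEq ι] (n : ℕ)
    (S : Finset ι) (hS : S.card = n) :
    (univ.filter fun t : Fin n ↪ ι => univ.map t = S).card = n.factorial := by
  have e : {t : Fin n ↪ ι // univ.map t = S} ≃ (Fin n ≃ S) :=
    { toFun := fun t => Equiv.ofBijective
        (fun i => ⟨t.1 i, (Finset.ext_iff.1 t.2 _).1 (mem_map_of_mem _ (mem_univ i))⟩)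
        ⟨fun i j h => t.1.injective (congrArg Subtype.val h), fun s => by
          have hs : s.1 ∈ univ.map t.1 := by rw [t.2]; exact s.2
          obtain ⟨i, -, hi⟩ := Finset.mem_map.1 hs
          exact ⟨i, Subtype.ext hi⟩⟩
      invFun := fun e => ⟨⟨fun i => (e i : ι), fun i j h => e.injective (Subtype.ext h)⟩, by
        ext x
        rw [Finset.mem_map]
        exact ⟨fun ⟨i, _, hi⟩ => hi ▸ (e i).2, fun hx => ⟨e.symm ⟨x, hx⟩, mem_univ _,
          congrArg Subtype.val (e.apply_symm_apply ⟨x, hx⟩)⟩⟩⟩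
      left_inv := fun t => by ext; rfl
      right_inv := fun e => by ext; rfl }
  rw [← Fintype.card_subtype, Fintype.card_congr e, Fintype.card_equiv (S.equivFinOfCardEq hS).symm,
    Fintype.card_fin]

theorem sum_embedding_map {ι : Type*} [Fintype ι] [DecidableEq ι] {A : Type*} [AddCommMonoid A]
    (n : ℕ) (F : Finset ι → A) :
    ∑ t : Fin n ↪ ι, F (univ.map t) = n.factorial • ∑ S ∈ powersetCard n univ, F S := by
  rw [← sum_fiberwise_of_maps_to (s := univ) (t := powersetCard n (univ : Finset ι))
    (g := fun t : Fin n ↪ ι => univ.map t) (fun t _ => by simp [mem_powersetCard]), smul_sum]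
  refine sum_congr rfl fun S hS => ?_
  rw [sum_congr rfl (g := fun _ => F S) (fun t ht => by rw [(mem_filter.1 ht).2]), sum_const,
    card_filter_embedding_map_eq n S (mem_powersetCard.1 hS).2]

/-- Group the subsets by cardinality: each `n`-subset is the image of `n!` embeddings, and the terms
vanish for `n` beyond the size of the type. This serves twice, for principal minors and for products
over the points of a configuration. -/
theorem hasSum_inv_factorial_sum_embedding {ι : Type*} [Fintype ι] [DecidableEq ι]
    (F : Finset ι → ℂ) :
    HasSum (fun n : ℕ => (n.factorial : ℂ)⁻¹ * ∑ t : Fin n ↪ ι, F (univ.map t)) (∑ S, F S) := by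
  have h : ∀ n : ℕ, (n.factorial : ℂ)⁻¹ * ∑ t : Fin n ↪ ι, F (univ.map t)
      = ∑ S ∈ powersetCard n univ, F S := fun n => by
    rw [sum_embedding_map, nsmul_eq_mul, ← mul_assoc,
      inv_mul_cancel₀ (Nat.cast_ne_zero.2 n.factorial_ne_zero), one_mul]
  simp_rw [h]
  rw [← powerset_univ, sum_powerset]
  refine hasSum_sum_of_ne_finset_zero fun n hn => ?_
  rw [powersetCard_eq_empty.2 (by simpa [Nat.lt_succ_iff] using hn), sum_empty]

theorem sum_fun_eq_sum_embedding {ι : Type*} [Fintype ι] {A : Type*} [AddCommMonoid A]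
    (n : ℕ) (G : (Fin n → ι) → A) (hG : ∀ a, ¬ Function.Injective a → G a = 0) :
    ∑ a, G a = ∑ t : Fin n ↪ ι, G t := by
  classical
  rw [← sum_filter_of_ne (p := Function.Injective) (fun a _ h => by
    by_contra h'; exact h (hG a h'))]
  rw [← sum_subtype_eq_sum_filter]
  simp only [subtype_univ]
  exact Fintype.sum_equiv (Equiv.subtypeInjectiveEquivEmbedding (Fin n) ι) _ _ fun _ => rfl

end Combinatorics

/-! ### Finite determinants `det(1+M)`. -/

section Matrices

open scoped ComplexOrder

open Finset Matrix

variable {ι : Type*} [Fintype ι] [DecidableEq ι]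

/-- Multilinearity in the rows: for each row one chooses `M` or the identity. -/
theorem det_one_add_eq_sum_minors (M : Matrix ι ι ℂ) :
    (1 + M).det = ∑ S : Finset ι, (M.submatrix (Subtype.val : S → ι) Subtype.val).det := by
  rw [add_comm]
  change (detRowAlternating : (ι → ℂ) [⋀^ι]→ₗ[ℂ] ℂ)
    ((fun i => M i) + fun i => (1 : Matrix ι ι ℂ) i) = _
  rw [AlternatingMap.map_add_univ]
  exact sum_congr rfl fun S _ => det_piecewise_one_eq_submatrix_det M S

/-- Tuples with a repeated index give a zero determinant, so the sum may run over all tuples. This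
is the form that integration of the correlation functions produces. -/
theorem hasSum_det_submatrix (M : Matrix ι ι ℂ) :
    HasSum (fun n : ℕ => (n.factorial : ℂ)⁻¹ * ∑ a : Fin n → ι, (M.submatrix a a).det)
      (1 + M).det := by
  rw [det_one_add_eq_sum_minors]
  convert hasSum_inv_factorial_sum_embedding
    (fun S : Finset ι => (M.submatrix (Subtype.val : S → ι) Subtype.val).det) using 3 with n
  rw [sum_fun_eq_sum_embedding]
  · refine sum_congr rfl fun t _ => ?_
    let e : Fin n ≃ (univ.map t : Finset ι) :=
      Equiv.ofBijective (fun i => ⟨t i, mem_map_of_mem _ (mem_univ i)⟩)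
        ⟨fun i j h => t.injective (congrArg Subtype.val h), fun s => by
          obtain ⟨i, -, hi⟩ := Finset.mem_map.1 s.2
          exact ⟨i, Subtype.ext hi⟩⟩
    exact det_submatrix_equiv_self e 
      (M.submatrix (Subtype.val : ↥(univ.map t) → ι) Subtype.val)
  · intro a ha
    simp only [Function.Injective, not_forall] at ha
    obtain ⟨i, j, hij, hne⟩ := ha
    exact det_zero_of_row_eq hne (by ext k; simp [hij])

/-- The eigenvalues `λ` of `1+M` are nonnegative and satisfy `λ ≤ exp(λ-1)`; multiply over the
spectrum. -/
theorem det_one_add_le_exp_trace {M : Matrix ι ι ℂ} (h : (1 + M).PosSemidef) :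
    ∃ d : ℝ, (1 + M).det = d ∧ 0 ≤ d ∧ d ≤ Real.exp M.trace.re := by
  refine ⟨∏ i, h.isHermitian.eigenvalues i, ?_, prod_nonneg fun i _ => h.eigenvalues_nonneg i, ?_⟩
  · rw [h.isHermitian.det_eq_prod_eigenvalues]; push_cast; rfl
  · have ht : M.trace.re = ∑ i, (h.isHermitian.eigenvalues i - 1) := by
      have := h.isHermitian.trace_eq_sum_eigenvalues
      rw [trace_add, trace_one] at this
      have := congrArg Complex.re this
      simp at this
      rw [sum_sub_distrib]; simp; linarith
    rw [ht, Real.exp_sum]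
    exact prod_le_prod (fun i _ => h.eigenvalues_nonneg i) fun i _ => by
      linarith [Real.add_one_le_exp (h.isHermitian.eigenvalues i - 1)]

end Matrices
end RegProd

namespace RegProd

/-! ### Fredholm series of kernels of finite rank. -/

section FiniteRank

open Finset Matrix ComplexConjugate
open scoped ComplexOrder

variable {α ι : Type*}

/-- The kernel `∑_{i ∈ s} φ_i(x) conj φ_i(y)`. -/
def sumKernel (φ : ι → α → ℂ) (s : Finset ι) (x y : α) : ℂ := ∑ i ∈ s, φ i x * conj (φ i y)

/-- The determinant `det (k(x_i, x_j))`. -/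
def kernelDet (k : α → α → ℂ) {n : ℕ} (x : Fin n → α) : ℂ := (Matrix.of fun i j => k (x i) (x j)).det

theorem posSemidef_sumKernel (φ : ι → α → ℂ) (s : Finset ι) {n : ℕ} (x : Fin n → α) :
    (Matrix.of fun i j => sumKernel φ s (x i) (x j)).PosSemidef := by
  let A : Matrix (Fin n) s ℂ := Matrix.of fun i c => φ c (x i)
  have : (Matrix.of fun i j => sumKernel φ s (x i) (x j)) = A * Aᴴ := by
    ext i j
    simp only [A, Matrix.mul_apply, Matrix.of_apply, Matrix.conjTranspose_apply, sumKernel]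
    rw [← Finset.sum_coe_sort]
    rfl
  rw [this]
  exact posSemidef_self_mul_conjTranspose A

theorem kernelDet_sumKernel_nonneg (φ : ι → α → ℂ) (s : Finset ι) {n : ℕ} (x : Fin n → α) :
    0 ≤ kernelDet (sumKernel φ s) x := (posSemidef_sumKernel φ s x).det_nonneg

/-- Each summand is a product of functions of one variable, so Fubini applies to it. Moving the
permutation from the points to the indices `a` achieves this. -/
theorem prod_mul_kernelDet_sumKernel [Fintype ι] (φ : ι → α → ℂ) (h : α → ℝ) {n : ℕ} (x : Fin n → α) :
    (∏ i, (h (x i) : ℂ)) * kernelDet (sumKernel φ univ) x =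
      ∑ σ : Equiv.Perm (Fin n), ∑ a : Fin n → ι, ((Equiv.Perm.sign σ : ℤ) : ℂ) *
        ∏ i, ((h (x i) : ℂ) * (φ (a (σ.symm i)) (x i) * conj (φ (a i) (x i)))) := by
  rw [kernelDet, det_apply', mul_sum]
  refine sum_congr rfl fun σ _ => ?_
  simp only [Matrix.of_apply, sumKernel]
  rw [Fintype.prod_sum, mul_sum, mul_sum]
  refine sum_congr rfl fun a _ => ?_
  have h1 : ∏ i, φ (a i) (x (σ i)) = ∏ i, φ (a (σ.symm i)) (x i) := by
    rw [← Equiv.prod_comp σ (fun i => φ (a (σ.symm i)) (x i))]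
    simp
  simp only [prod_mul_distrib, h1]
  ring

variable [MeasurableSpace α] {μ : Measure α}

/-- The `n`-th coefficient of the Fredholm series of `h k`, without the factor `1 / n!`. -/
noncomputable def fredholmTerm (μ : Measure α) (h : α → ℝ) (k : α → α → ℂ) (n : ℕ) : ℂ :=
  ∫ x : Fin n → α, (∏ i, (h (x i) : ℂ)) * kernelDet k x ∂(Measure.pi fun _ => μ)

/-- The matrix of multiplication by `h` in the family `φ`. -/
noncomputable def weightMatrix (μ : Measure α) (h : α → ℝ) (φ : ι → α → ℂ) : Matrix ι ι ℂ :=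
  Matrix.of fun i j => ∫ x, (h x : ℂ) * (φ i x * conj (φ j x)) ∂μ

theorem integrable_weight {φ : ι → α → ℂ} (hφ : ∀ i, MemLp (φ i) 2 μ) {h : α → ℝ}
    (hm : Measurable h) {C : ℝ} (hC : ∀ x, |h x| ≤ C) (i j : ι) :
    Integrable (fun x => (h x : ℂ) * (φ i x * conj (φ j x))) μ := by
  have h1 : Integrable (fun x => φ i x * conj (φ j x)) μ :=
    (hφ i).integrable_mul (hφ j).star
  exact h1.bdd_mul (c := C) (Complex.measurable_ofReal.comp hm).aestronglyMeasurable
    (Eventually.of_forall fun x => by simpa using hC x)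

theorem isHermitian_weightMatrix (φ : ι → α → ℂ) (h : α → ℝ) :
    (weightMatrix μ h φ).IsHermitian := by
  ext i j
  simp only [weightMatrix, conjTranspose_apply, of_apply, Complex.star_def]
  rw [← integral_conj]
  congr 1
  ext x
  simp only [map_mul, Complex.conj_ofReal, Complex.conj_conj]
  ring

variable [Fintype ι]

/-- Integrating the expansion factor by factor replaces each factor by an entry of the weight
matrix, and the signed sum over permutations reassembles into a minor. The infinite-dimensional term
thus becomes a term of `hasSum_det_submatrix`. -/
theorem integrable_and_fredholmTerm_sumKernel [SigmaFinite μ] {φ : ι → α → ℂ} (hφ : ∀ i, MemLp (φ i) 2 μ)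
    {h : α → ℝ} (hm : Measurable h) {C : ℝ} (hC : ∀ x, |h x| ≤ C) (n : ℕ) :
    Integrable (fun x : Fin n → α => (∏ i, (h (x i) : ℂ)) * kernelDet (sumKernel φ univ) x)
      (Measure.pi fun _ => μ) ∧
    fredholmTerm μ h (sumKernel φ univ) n =
      ∑ a : Fin n → ι, ((weightMatrix μ h φ).submatrix a a).det := by
  have hint : ∀ (σ : Equiv.Perm (Fin n)) (a : Fin n → ι),
      Integrable (fun x : Fin n → α => ((Equiv.Perm.sign σ : ℤ) : ℂ) *
        ∏ i, ((h (x i) : ℂ) * (φ (a (σ.symm i)) (x i) * conj (φ (a i) (x i)))))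
        (Measure.pi fun _ => μ) := fun σ a =>
    (Integrable.fintype_prod (f := fun i y => (h y : ℂ) * (φ (a (σ.symm i)) y * conj (φ (a i) y)))
      fun i => integrable_weight hφ hm hC _ _).const_mul _
  simp only [fredholmTerm, prod_mul_kernelDet_sumKernel]
  refine ⟨integrable_finsetSum _ fun σ _ => integrable_finsetSum _ fun a _ => hint σ a, ?_⟩
  rw [integral_finsetSum _ fun σ _ => integrable_finsetSum _ fun a _ => hint σ a]
  simp_rw [integral_finsetSum _ fun a _ => hint _ a]
  rw [sum_comm]
  refine sum_congr rfl fun a _ => ?_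
  rw [← det_transpose, det_apply']
  refine sum_congr rfl fun σ _ => ?_
  rw [integral_const_mul, integral_fintype_prod_eq_prod
    (fun i y => (h y : ℂ) * (φ (a (σ.symm i)) y * conj (φ (a i) y)))]
  congr 1
  rw [← Equiv.prod_comp σ]
  simp [weightMatrix]

theorem dotProduct_weightMatrix {φ : ι → α → ℂ} (hφ : ∀ i, MemLp (φ i) 2 μ)
    {h : α → ℝ} (hm : Measurable h) {C : ℝ} (hC : ∀ x, |h x| ≤ C) (c : ι → ℂ) :
    star c ⬝ᵥ (weightMatrix μ h φ *ᵥ c) =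
      ((∫ x, h x * ‖∑ i, conj (c i) * φ i x‖ ^ 2 ∂μ : ℝ) : ℂ) := by
  have h0 : ∀ i j, Integrable (fun x =>
      conj (c i) * (((h x : ℂ) * (φ i x * conj (φ j x))) * c j)) μ :=
    fun i j => ((integrable_weight hφ hm hC i j).mul_const _).const_mul _
  rw [← integral_complex_ofReal]
  simp only [dotProduct, mulVec, weightMatrix, of_apply, Pi.star_apply, Complex.star_def]
  simp_rw [← integral_mul_const, mul_sum, ← integral_const_mul]
  simp_rw [← integral_finsetSum univ fun j _ => h0 _ j]
  rw [← integral_finsetSum univ fun i _ => integrable_finsetSum _ fun j _ => h0 i j]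
  congr 1
  ext x
  push_cast
  rw [← Complex.mul_conj', map_sum, sum_mul_sum, mul_sum]
  refine sum_congr rfl fun i _ => ?_
  rw [mul_sum]
  refine sum_congr rfl fun j _ => ?_
  simp; ring

theorem posSemidef_weightMatrix {φ : ι → α → ℂ} (hφ : ∀ i, MemLp (φ i) 2 μ)
    {h : α → ℝ} (hm : Measurable h) {C : ℝ} (hC : ∀ x, |h x| ≤ C) (h0 : ∀ x, 0 ≤ h x) :
    (weightMatrix μ h φ).PosSemidef := by
  refine .of_dotProduct_mulVec_nonneg (isHermitian_weightMatrix φ h) fun c => ?_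
  rw [dotProduct_weightMatrix hφ hm hC]
  exact_mod_cast integral_nonneg fun x => mul_nonneg (h0 x) (sq_nonneg _)

/-- The quadratic form at `c` is `|c|² + ∫ h|f|²`, with `f` the combination of the family with
conjugated coefficients. As `h ≥ -1`, it is at least `|c|² - ∫|f|²`, which Bessel's inequality makes
nonnegative. -/
theorem posSemidef_one_add_weightMatrix [DecidableEq ι] {φ : ι → α → ℂ} (hφ : ∀ i, MemLp (φ i) 2 μ)
    (hB : ∀ c : ι → ℂ, ∫ x, ‖∑ i, c i * φ i x‖ ^ 2 ∂μ ≤ ∑ i, ‖c i‖ ^ 2)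
    {h : α → ℝ} (hm : Measurable h) {C : ℝ} (hC : ∀ x, |h x| ≤ C) (h0 : ∀ x, -1 ≤ h x) :
    (1 + weightMatrix μ h φ).PosSemidef := by
  refine .of_dotProduct_mulVec_nonneg (isHermitian_one.add (isHermitian_weightMatrix φ h))
    fun c => ?_
  rw [add_mulVec, one_mulVec, dotProduct_add, dotProduct_weightMatrix hφ hm hC]
  have h1 : star c ⬝ᵥ c = ((∑ i, ‖c i‖ ^ 2 : ℝ) : ℂ) := by
    simp only [dotProduct, Pi.star_apply, Complex.star_def, Complex.conj_mul']
    push_cast; rfl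
  rw [h1]
  have h2 := hB fun i => conj (c i)
  simp only [RCLike.norm_conj] at h2
  have hL : Integrable (fun x => ‖∑ i, conj (c i) * φ i x‖ ^ 2) μ :=
    (memLp_two_iff_integrable_sq_norm
      (memLp_finsetSum _ fun i _ => (hφ i).const_mul _).aestronglyMeasurable).1
      (memLp_finsetSum _ fun i _ => (hφ i).const_mul _)
  have h3 : -∫ x, ‖∑ i, conj (c i) * φ i x‖ ^ 2 ∂μ ≤
      ∫ x, h x * ‖∑ i, conj (c i) * φ i x‖ ^ 2 ∂μ := by
    rw [← integral_neg]
    refine integral_mono hL.neg (hL.bdd_mul (c := C) hm.aestronglyMeasurable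
      (Eventually.of_forall fun x => hC x)) fun x => ?_
    have := mul_nonneg (by linarith [h0 x] : 0 ≤ h x + 1) (sq_nonneg ‖∑ i, conj (c i) * φ i x‖)
    simp only
    linarith
  exact_mod_cast by linarith

theorem trace_weightMatrix {φ : ι → α → ℂ} (hφ : ∀ i, MemLp (φ i) 2 μ)
    {h : α → ℝ} (hm : Measurable h) {C : ℝ} (hC : ∀ x, |h x| ≤ C) :
    (weightMatrix μ h φ).trace.re = ∫ x, h x * ∑ i, ‖φ i x‖ ^ 2 ∂μ := by
  simp only [trace, diag_apply, weightMatrix, of_apply]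
  rw [← integral_finsetSum univ fun i _ => integrable_weight hφ hm hC i i]
  rw [← Complex.ofReal_re (∫ x, h x * ∑ i, ‖φ i x‖ ^ 2 ∂μ), ← integral_complex_ofReal]
  congr 2
  ext x
  push_cast
  rw [mul_sum]
  exact sum_congr rfl fun i _ => by rw [Complex.mul_conj']

theorem fredholmSeries_sumKernel_le [SigmaFinite μ] {φ : ι → α → ℂ} (hφ : ∀ i, MemLp (φ i) 2 μ)
    (hB : ∀ c : ι → ℂ, ∫ x, ‖∑ i, c i * φ i x‖ ^ 2 ∂μ ≤ ∑ i, ‖c i‖ ^ 2)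
    {h : α → ℝ} (hm : Measurable h) {C : ℝ} (hC : ∀ x, |h x| ≤ C) (h0 : ∀ x, -1 ≤ h x) :
    ∃ d : ℝ, HasSum (fun n : ℕ => (n.factorial : ℂ)⁻¹ * fredholmTerm μ h (sumKernel φ univ) n) d ∧
      d ≤ Real.exp (∫ x, h x * ∑ i, ‖φ i x‖ ^ 2 ∂μ) := by
  classical
  obtain ⟨d, hd, -, hd'⟩ := det_one_add_le_exp_trace
    (posSemidef_one_add_weightMatrix hφ hB hm hC h0)
  refine ⟨d, ?_, by rwa [← trace_weightMatrix hφ hm hC]⟩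
  have := hasSum_det_submatrix (weightMatrix μ h φ)
  rw [hd] at this
  simpa only [(integrable_and_fredholmTerm_sumKernel hφ hm hC _).2] using this

theorem fredholmTerm_smul (h : α → ℝ) (k : α → α → ℂ) (n : ℕ) (t : ℝ) :
    fredholmTerm μ (fun x => t * h x) k n = t ^ n * fredholmTerm μ h k n := by
  simp only [fredholmTerm, ← integral_const_mul]
  congr 1
  ext x
  push_cast
  rw [prod_mul_distrib, prod_const, card_univ, Fintype.card_fin]
  ring

/-- The determinants are nonnegative, so the absolute integral is the Fredholm term of `|h|`. For
the weight `2|h|` all terms are nonnegative, hence each is at most the whole series, itself at most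
an exponential; homogeneity of degree `n` returns the factor `2^{-n}`. The bound does not depend on
the rank, and it can be summed over `n`. -/
theorem norm_fredholmTerm_sumKernel_le [SigmaFinite μ] {φ : ι → α → ℂ} (hφ : ∀ i, MemLp (φ i) 2 μ)
    (hB : ∀ c : ι → ℂ, ∫ x, ‖∑ i, c i * φ i x‖ ^ 2 ∂μ ≤ ∑ i, ‖c i‖ ^ 2)
    {h : α → ℝ} (hm : Measurable h) {C : ℝ} (hC : ∀ x, |h x| ≤ C) (n : ℕ) :
    (n.factorial : ℝ)⁻¹ * ∫ x : Fin n → α, ‖(∏ i, (h (x i) : ℂ)) * kernelDet (sumKernel φ univ) x‖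
        ∂(Measure.pi fun _ => μ) ≤
      (1 / 2) ^ n * Real.exp (2 * ∫ x, |h x| * ∑ i, ‖φ i x‖ ^ 2 ∂μ) := by
  have hm' : Measurable fun x => 2 * |h x| := hm.norm.const_mul 2
  have hC' : ∀ x, abs (2 * |h x|) ≤ 2 * C := fun x => by
    rw [abs_mul, abs_abs]; simpa using hC x
  have e1 : (((∫ x : Fin n → α, ‖(∏ i, (h (x i) : ℂ)) * kernelDet (sumKernel φ univ) x‖
        ∂(Measure.pi fun _ => μ)) : ℝ) : ℂ)
      = fredholmTerm μ (fun x => |h x|) (sumKernel φ univ) n := by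
    rw [← integral_complex_ofReal, fredholmTerm]
    congr 1
    ext x
    have h1 := kernelDet_sumKernel_nonneg φ univ x
    rw [norm_mul, Complex.ofReal_mul, norm_prod]
    have h2 : ((‖kernelDet (sumKernel φ univ) x‖ : ℝ) : ℂ) = kernelDet (sumKernel φ univ) x := by
      rw [Complex.norm_of_nonneg' h1]
    rw [h2]
    push_cast
    simp
  obtain ⟨d, hd, hd'⟩ := fredholmSeries_sumKernel_le hφ hB hm' hC' fun x => by
    have := abs_nonneg (h x); linarith
  have hnn : ∀ m, 0 ≤ (((m.factorial : ℂ)⁻¹ *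
      fredholmTerm μ (fun x => 2 * |h x|) (sumKernel φ univ) m)).re := fun m => by
    have h1 : 0 ≤ fredholmTerm μ (fun x => 2 * |h x|) (sumKernel φ univ) m := by
      rw [(integrable_and_fredholmTerm_sumKernel hφ hm' hC' m).2]
      exact sum_nonneg fun a _ => ((posSemidef_weightMatrix hφ hm' hC' fun x => by
        positivity).submatrix a).det_nonneg
    have h2 : (0 : ℂ) ≤ (m.factorial : ℂ)⁻¹ := by
      rw [← Complex.ofReal_natCast, ← Complex.ofReal_inv]
      exact_mod_cast (by positivity : (0 : ℝ) ≤ (m.factorial : ℝ)⁻¹)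
    exact (Complex.nonneg_iff.1 (mul_nonneg h2 h1)).1
  have hle : (((n.factorial : ℂ)⁻¹ *
      fredholmTerm μ (fun x => 2 * |h x|) (sumKernel φ univ) n)).re ≤ d :=
    le_hasSum (Complex.hasSum_re hd) n fun m _ => hnn m
  rw [fredholmTerm_smul, ← e1] at hle
  have e2 : ∀ r : ℝ, ((n.factorial : ℂ)⁻¹ * (((2 : ℝ) : ℂ) ^ n * (r : ℂ))).re
      = 2 ^ n * ((n.factorial : ℝ)⁻¹ * r) := fun r => by
    rw [← Complex.ofReal_re (2 ^ n * ((n.factorial : ℝ)⁻¹ * r))]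
    push_cast
    congr 1
    ring
  rw [e2] at hle
  have e3 : ∫ x, 2 * |h x| * ∑ i, ‖φ i x‖ ^ 2 ∂μ = 2 * ∫ x, |h x| * ∑ i, ‖φ i x‖ ^ 2 ∂μ := by
    rw [← integral_const_mul]; simp_rw [mul_assoc]
  rw [e3] at hd'
  have h2 : (0 : ℝ) < 2 ^ n := by positivity
  calc _ = (1 / 2) ^ n * (2 ^ n * ((n.factorial : ℝ)⁻¹ *
        ∫ x : Fin n → α, ‖(∏ i, (h (x i) : ℂ)) * kernelDet (sumKernel φ univ) x‖
          ∂(Measure.pi fun _ => μ))) := by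
        rw [← mul_assoc ((1 / 2 : ℝ) ^ n), ← mul_pow]; norm_num
    _ ≤ _ := mul_le_mul_of_nonneg_left (hle.trans hd') (by positivity)

end FiniteRank
end RegProd

namespace RegProd

/-! ### Passage from finite rank to the full kernel. -/

section FredholmLimit

open Finset ComplexConjugate
open scoped ComplexOrder

variable {α ι : Type*}

theorem norm_sumKernel_le (φ : ι → α → ℂ) (s : Finset ι) {x y : α} (hx : Summable fun i => ‖φ i x‖ ^ 2)
    (hy : Summable fun i => ‖φ i y‖ ^ 2) :
    ‖sumKernel φ s x y‖ ≤ √(∑' i, ‖φ i x‖ ^ 2) * √(∑' i, ‖φ i y‖ ^ 2) := by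
  calc ‖sumKernel φ s x y‖ ≤ ∑ i ∈ s, ‖φ i x‖ * ‖φ i y‖ := by
        refine (norm_sum_le _ _).trans (le_of_eq (sum_congr rfl fun i _ => by simp))
    _ ≤ √(∑ i ∈ s, ‖φ i x‖ ^ 2) * √(∑ i ∈ s, ‖φ i y‖ ^ 2) := Real.sum_mul_le_sqrt_mul_sqrt _ _ _
    _ ≤ _ := by
        gcongr
        · exact hx.sum_le_tsum _ fun i _ => sq_nonneg _
        · exact hy.sum_le_tsum _ fun i _ => sq_nonneg _

/-- Cauchy–Schwarz in every entry; each point occurs once as a row and once as a column. The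
factorial is harmless, as the bound is only used for dominated convergence at fixed `n`. -/
theorem norm_kernelDet_le (φ : ι → α → ℂ) (s : Finset ι) {n : ℕ} {x : Fin n → α}
    (hx : ∀ i, Summable fun j => ‖φ j (x i)‖ ^ 2) :
    ‖kernelDet (sumKernel φ s) x‖ ≤ n.factorial * ∏ i, ∑' j, ‖φ j (x i)‖ ^ 2 := by
  rw [kernelDet, Matrix.det_apply']
  refine (norm_sum_le _ _).trans ?_
  have h : ∀ σ ∈ (univ : Finset (Equiv.Perm (Fin n))), ‖((Equiv.Perm.sign σ : ℤ) : ℂ) *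
      ∏ i, (Matrix.of fun i j => sumKernel φ s (x i) (x j)) (σ i) i‖ ≤
      ∏ i, ∑' j, ‖φ j (x i)‖ ^ 2 := fun σ _ => by
    have hs : ‖((Equiv.Perm.sign σ : ℤ) : ℂ)‖ = 1 := by
      rcases Int.units_eq_one_or (Equiv.Perm.sign σ) with h | h <;> simp [h]
    rw [norm_mul, hs, one_mul, norm_prod]
    calc _ ≤ ∏ i, (√(∑' j, ‖φ j (x (σ i))‖ ^ 2) * √(∑' j, ‖φ j (x i)‖ ^ 2)) :=
          prod_le_prod (fun i _ => norm_nonneg _) fun i _ => norm_sumKernel_le φ s (hx _) (hx _)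
      _ = _ := by
          rw [prod_mul_distrib, Equiv.prod_comp σ fun i => √(∑' j, ‖φ j (x i)‖ ^ 2),
            ← prod_mul_distrib]
          exact prod_congr rfl fun i _ => Real.mul_self_sqrt (tsum_nonneg fun j => sq_nonneg _)
  refine (sum_le_sum h).trans ?_
  simp [Fintype.card_perm]

variable [MeasurableSpace α] {μ : Measure α} [SigmaFinite μ]

theorem ae_pi_forall {n : ℕ} {p : α → Prop} (hp : ∀ᵐ x ∂μ, p x) :
    ∀ᵐ x : Fin n → α ∂(Measure.pi fun _ => μ), ∀ i, p (x i) :=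
  ae_all_iff.2 fun i => (Measure.quasiMeasurePreserving_eval _ i).ae hp

/-- For `i ≠ j`, the projection to two coordinates pulls null sets of `μ ⊗ μ` back to null sets:
split off coordinate `i`, then evaluate at the other one. -/
theorem ae_pi_forall_pair {n : ℕ} {p : α × α → Prop} (hp : ∀ᵐ z ∂(μ.prod μ), p z) :
    ∀ᵐ x : Fin n → α ∂(Measure.pi fun _ => μ), ∀ i j, i ≠ j → p (x i, x j) := by
  refine ae_all_iff.2 fun i => ae_all_iff.2 fun j => ?_
  by_cases hij : i = j
  · simp [hij]
  cases n with
  | zero => exact i.elim0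
  | succ n =>
    obtain ⟨k, rfl⟩ := Fin.exists_succAbove_eq (Ne.symm hij)
    have h1 := (measurePreserving_piFinSuccAbove (fun _ : Fin (n + 1) => μ) i).quasiMeasurePreserving
    have h2 : Measure.QuasiMeasurePreserving
        (fun z : α × (Fin n → α) => (z.1, z.2 k)) (μ.prod (Measure.pi fun _ => μ)) (μ.prod μ) :=
      QuasiMeasurePreserving.prodMap (Measure.QuasiMeasurePreserving.id μ)
        (Measure.quasiMeasurePreserving_eval (fun _ : Fin n => μ) k)
    filter_upwards [(h2.comp h1).ae hp] with x hx _
    exact hx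

/-- The family `φ` satisfies Bessel's inequality, and `k(x, y) = ∑ φ_i(x) conj φ_i(y)` almost
everywhere, also on the diagonal. -/
structure IsBesselExpansion (μ : Measure α) (φ : ι → α → ℂ) (k : α → α → ℂ) : Prop where
  memLp : ∀ i, MemLp (φ i) 2 μ
  bessel : ∀ (s : Finset ι) (c : s → ℂ), ∫ x, ‖∑ i, c i * φ i x‖ ^ 2 ∂μ ≤ ∑ i, ‖c i‖ ^ 2
  diag : ∀ᵐ x ∂μ, Summable (fun i => ‖φ i x‖ ^ 2) ∧ k x x = ((∑' i, ‖φ i x‖ ^ 2 : ℝ) : ℂ)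
  offDiag : ∀ᵐ z ∂(μ.prod μ), HasSum (fun i => φ i z.1 * conj (φ i z.2)) (k z.1 z.2)

namespace IsBesselExpansion

variable {φ : ι → α → ℂ} {k : α → α → ℂ} (H : IsBesselExpansion μ φ k)
include H

/-- The diagonal may be null for `μ ⊗ μ`, so an expansion valid almost everywhere on the product
says nothing about `k x x`. Diagonal entries rely on `diag`, the others on `offDiag`. -/
theorem ae_tendsto_kernelDet (n : ℕ) : ∀ᵐ x : Fin n → α ∂(Measure.pi fun _ => μ),
    Tendsto (fun s => kernelDet (sumKernel φ s) x) atTop (𝓝 (kernelDet k x)) := by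
  filter_upwards [ae_pi_forall H.diag, ae_pi_forall_pair H.offDiag] with x h1 h2
  have hc : Continuous fun A : Matrix (Fin n) (Fin n) ℂ => A.det := continuous_id.matrix_det
  refine (hc.tendsto _).comp (tendsto_pi_nhds.2 fun i => tendsto_pi_nhds.2 fun j => ?_)
  by_cases hij : i = j
  · subst hij
    simp only [Matrix.of_apply, sumKernel, Complex.mul_conj']
    rw [(h1 i).2]
    have := Complex.hasSum_ofReal.2 (h1 i).1.hasSum
    push_cast at this ⊢
    exact this
  · exact h2 i j hij

variable {h : α → ℝ} (hm : Measurable h) {C : ℝ} (hC : ∀ x, |h x| ≤ C)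

include hm hC in
theorem aestronglyMeasurable_mul_kernelDet (s : Finset ι) (n : ℕ) :
    AEStronglyMeasurable (fun x : Fin n → α => (∏ i, (h (x i) : ℂ)) * kernelDet (sumKernel φ s) x)
      (Measure.pi fun _ => μ) := by
  have := (integrable_and_fredholmTerm_sumKernel (φ := fun i : s => φ i) (fun i => H.memLp i)
    hm hC n).1.aestronglyMeasurable
  have e : sumKernel (fun i : s => φ i) univ = sumKernel φ s := by
    funext x y; exact Finset.sum_coe_sort s fun i => φ i x * conj (φ i y)
  rwa [e] at this

variable (hint : Integrable (fun x => |h x| * ∑' i, ‖φ i x‖ ^ 2) μ)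
include hm hC hint

theorem fredholmSeries_finite (s : Finset ι) :
    (∀ n : ℕ, (n.factorial : ℝ)⁻¹ *
      ∫ x : Fin n → α, ‖(∏ i, (h (x i) : ℂ)) * kernelDet (sumKernel φ s) x‖
        ∂(Measure.pi fun _ => μ) ≤
      (1 / 2) ^ n * Real.exp (2 * ∫ x, |h x| * ∑' i, ‖φ i x‖ ^ 2 ∂μ)) ∧
    ((∀ x, -1 ≤ h x) → ∃ d : ℝ,
      HasSum (fun n : ℕ => (n.factorial : ℂ)⁻¹ * fredholmTerm μ h (sumKernel φ s) n) d ∧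
      d ≤ Real.exp (∫ x, h x * ∑ i ∈ s, ‖φ i x‖ ^ 2 ∂μ)) := by
  have e : sumKernel (fun i : s => φ i) univ = sumKernel φ s := by
    funext x y; exact Finset.sum_coe_sort s fun i => φ i x * conj (φ i y)
  have e2 : ∀ x, ∑ i : s, ‖φ i x‖ ^ 2 = ∑ i ∈ s, ‖φ i x‖ ^ 2 := fun x =>
    Finset.sum_coe_sort s fun i => ‖φ i x‖ ^ 2
  refine ⟨fun n => ?_, fun h0 => ?_⟩
  · have := norm_fredholmTerm_sumKernel_le (φ := fun i : s => φ i) (fun i => H.memLp i)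
      (H.bessel s) hm hC n
    rw [e] at this
    simp only [e2] at this
    refine this.trans (mul_le_mul_of_nonneg_left (Real.exp_le_exp.2
      (mul_le_mul_of_nonneg_left ?_ zero_le_two)) (by positivity))
    refine integral_mono_of_nonneg (Eventually.of_forall fun x => by positivity) hint ?_
    filter_upwards [H.diag] with x hx
    exact mul_le_mul_of_nonneg_left (hx.1.sum_le_tsum _ fun i _ => sq_nonneg _) (abs_nonneg _)
  · have := fredholmSeries_sumKernel_le (φ := fun i : s => φ i) (fun i => H.memLp i)
      (H.bessel s) hm hC h0
    rw [e] at this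
    simpa only [e2] using this

variable [Countable ι]

/-- Dominated convergence along finite subsets of the family. Countability of `ι` makes that filter
countably generated. -/
theorem tendsto_and_integrable (n : ℕ) :
    Integrable (fun x : Fin n → α => (∏ i, (h (x i) : ℂ)) * kernelDet k x)
      (Measure.pi fun _ => μ) ∧
    Tendsto (fun s => fredholmTerm μ h (sumKernel φ s) n) atTop (𝓝 (fredholmTerm μ h k n)) ∧
    Tendsto (fun s => ∫ x : Fin n → α, ‖(∏ i, (h (x i) : ℂ)) * kernelDet (sumKernel φ s) x‖
        ∂(Measure.pi fun _ => μ)) atTop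
      (𝓝 (∫ x : Fin n → α, ‖(∏ i, (h (x i) : ℂ)) * kernelDet k x‖ ∂(Measure.pi fun _ => μ))) := by
  have hb : Integrable (fun x : Fin n → α =>
      (n.factorial : ℝ) * ∏ i, |h (x i)| * ∑' j, ‖φ j (x i)‖ ^ 2) (Measure.pi fun _ => μ) :=
    (Integrable.fintype_prod (f := fun _ y => |h y| * ∑' j, ‖φ j y‖ ^ 2) fun _ => hint).const_mul _
  have hle : ∀ s : Finset ι, ∀ᵐ x : Fin n → α ∂(Measure.pi fun _ => μ),
      ‖(∏ i, (h (x i) : ℂ)) * kernelDet (sumKernel φ s) x‖ ≤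
        (n.factorial : ℝ) * ∏ i, |h (x i)| * ∑' j, ‖φ j (x i)‖ ^ 2 := fun s => by
    filter_upwards [ae_pi_forall H.diag] with x hx
    rw [norm_mul, norm_prod, prod_mul_distrib, mul_left_comm]
    simp only [Complex.norm_real, Real.norm_eq_abs]
    exact mul_le_mul_of_nonneg_left (norm_kernelDet_le φ s fun i => (hx i).1)
      (prod_nonneg fun i _ => abs_nonneg _)
  have hlim : ∀ᵐ x : Fin n → α ∂(Measure.pi fun _ => μ),
      Tendsto (fun s => (∏ i, (h (x i) : ℂ)) * kernelDet (sumKernel φ s) x) atTop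
        (𝓝 ((∏ i, (h (x i) : ℂ)) * kernelDet k x)) := by
    filter_upwards [H.ae_tendsto_kernelDet n] with x hx using hx.const_mul _
  have hmeas := fun s : Finset ι => H.aestronglyMeasurable_mul_kernelDet hm hC s n
  refine ⟨?_, ?_, ?_⟩
  · refine hb.mono' (aestronglyMeasurable_of_tendsto_ae atTop hmeas hlim) ?_
    filter_upwards [hlim, ae_all_iff.2 hle] with x h1 h2
    exact le_of_tendsto h1.norm (Eventually.of_forall h2)
  · exact tendsto_integral_filter_of_dominated_convergence _ (Eventually.of_forall hmeas)
      (Eventually.of_forall hle) hb hlim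
  · exact tendsto_integral_filter_of_dominated_convergence _
      (Eventually.of_forall fun s => (hmeas s).norm)
      (Eventually.of_forall fun s => by simpa only [norm_norm] using hle s) hb
      (hlim.mono fun x hx => hx.norm)

theorem fredholmTerm_bound (n : ℕ) :
    (n.factorial : ℝ)⁻¹ * ∫ x : Fin n → α, ‖(∏ i, (h (x i) : ℂ)) * kernelDet k x‖
        ∂(Measure.pi fun _ => μ) ≤
      (1 / 2) ^ n * Real.exp (2 * ∫ x, |h x| * ∑' i, ‖φ i x‖ ^ 2 ∂μ) :=
  le_of_tendsto ((H.tendsto_and_integrable hm hC hint n).2.2.const_mul _)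
    (Eventually.of_forall fun s => (H.fredholmSeries_finite hm hC hint s).1 n)

/-- The geometric bound, uniform in the finite subset `s`, allows the limit to be taken inside the
series over `n`; the inequality for finite rank then passes to the limit. -/
theorem fredholmSeries_le (h0 : ∀ x, -1 ≤ h x) :
    (∑' n : ℕ, (n.factorial : ℂ)⁻¹ * fredholmTerm μ h k n).re ≤
      Real.exp (∫ x, h x * ∑' i, ‖φ i x‖ ^ 2 ∂μ) := by
  have hsum : Summable fun n : ℕ =>
      (1 / 2 : ℝ) ^ n * Real.exp (2 * ∫ x, |h x| * ∑' i, ‖φ i x‖ ^ 2 ∂μ) :=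
    (summable_geometric_of_lt_one (by norm_num) (by norm_num)).mul_right _
  have h1 : Tendsto (fun s => ∑' n : ℕ, (n.factorial : ℂ)⁻¹ * fredholmTerm μ h (sumKernel φ s) n)
      atTop (𝓝 (∑' n : ℕ, (n.factorial : ℂ)⁻¹ * fredholmTerm μ h k n)) := by
    refine tendsto_tsum_of_dominated_convergence hsum
      (fun n => (H.tendsto_and_integrable hm hC hint n).2.1.const_mul _)
      (Eventually.of_forall fun s n => ?_)
    refine le_trans ?_ ((H.fredholmSeries_finite hm hC hint s).1 n)
    rw [norm_mul, norm_inv, Complex.norm_natCast]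
    exact mul_le_mul_of_nonneg_left (norm_integral_le_integral_norm _) (by positivity)
  have h2 : Tendsto (fun s : Finset ι => ∫ x, h x * ∑ i ∈ s, ‖φ i x‖ ^ 2 ∂μ) atTop
      (𝓝 (∫ x, h x * ∑' i, ‖φ i x‖ ^ 2 ∂μ)) := by
    refine tendsto_integral_filter_of_dominated_convergence _ (Eventually.of_forall fun s => ?_)
      (Eventually.of_forall fun s => ?_) hint ?_
    · exact hm.aestronglyMeasurable.mul (Finset.aestronglyMeasurable_fun_sum s fun i _ =>
        (H.memLp i).aestronglyMeasurable.norm.pow 2)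
    · filter_upwards [H.diag] with x hx
      rw [norm_mul, Real.norm_eq_abs, Real.norm_of_nonneg (sum_nonneg fun i _ => sq_nonneg _)]
      exact mul_le_mul_of_nonneg_left (hx.1.sum_le_tsum _ fun i _ => sq_nonneg _) (abs_nonneg _)
    · filter_upwards [H.diag] with x hx using hx.1.hasSum.const_mul _
  refine le_of_tendsto_of_tendsto ((Complex.continuous_re.tendsto _).comp h1)
    ((Real.continuous_exp.tendsto _).comp h2) (Eventually.of_forall fun s => ?_)
  obtain ⟨d, hd, hd'⟩ := (H.fredholmSeries_finite hm hC hint s).2 h0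
  simpa [hd.tsum_eq] using hd'

end IsBesselExpansion

end FredholmLimit
end RegProd

namespace RegProd

/-! ### Hilbert–Schmidt sums and almost everywhere identities in `L²`. -/

section HilbertBasis

open scoped ENNReal

variable {H ι : Type*} [NormedAddCommGroup H] [InnerProductSpace ℂ H]

theorem hasSum_norm_inner_sq (b : HilbertBasis ι ℂ H) (v : H) :
    HasSum (fun i => ‖inner ℂ (b i) v‖ ^ 2) (‖v‖ ^ 2) := by
  have h := Complex.hasSum_re (b.hasSum_inner_mul_inner v v)
  rw [inner_self_eq_norm_sq_to_K] at h
  convert h using 1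
  · ext i
    rw [← inner_conj_symm v (b i), Complex.conj_mul', ← Complex.ofReal_pow, Complex.ofReal_re]
  · norm_cast

theorem tsum_enorm_inner_sq (b : HilbertBasis ι ℂ H) (v : H) :
    ∑' i, ‖inner ℂ (b i) v‖ₑ ^ 2 = ‖v‖ₑ ^ 2 := by
  have h := hasSum_norm_inner_sq b v
  have e : ‖v‖ₑ ^ 2 = ENNReal.ofReal (‖v‖ ^ 2) := by
    rw [ENNReal.ofReal_pow (norm_nonneg v), ofReal_norm]
  have e' : ∀ i, ‖inner ℂ (b i) v‖ₑ ^ 2 = ENNReal.ofReal (‖inner ℂ (b i) v‖ ^ 2) := fun i => by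
    rw [ENNReal.ofReal_pow (norm_nonneg _), ofReal_norm]
  simp_rw [e', e]
  rw [← ENNReal.ofReal_tsum_of_nonneg (fun i => sq_nonneg _) h.summable, h.tsum_eq]

/-- An operator and its adjoint have the same Hilbert–Schmidt norm: apply Parseval on both sides and
exchange the sums. Values in `[0,∞]` dispense with summability. -/
theorem tsum_enorm_sq_eq_of_adjoint (b : HilbertBasis ι ℂ H) {A B : H → H}
    (h : ∀ f g, inner ℂ (A f) g = inner ℂ f (B g)) :
    ∑' i, ‖A (b i)‖ₑ ^ 2 = ∑' i, ‖B (b i)‖ₑ ^ 2 := by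
  simp_rw [← tsum_enorm_inner_sq b (A _), ← tsum_enorm_inner_sq b (B _)]
  rw [ENNReal.tsum_comm]
  refine tsum_congr fun i => tsum_congr fun j => ?_
  rw [← inner_conj_symm, h, RCLike.enorm_conj]

/-- Distinct orthonormal vectors are at distance `√2`, so their range is discrete in a second
countable space. -/
theorem countable_of_orthonormal [SecondCountableTopology H] {v : ι → H} (hv : Orthonormal ℂ v) :
    Countable ι := by
  have hd : DiscreteTopology (Set.range v) := by
    refine DiscreteTopology.of_forall_le_dist (r := 1) one_pos ?_
    rintro ⟨_, i, rfl⟩ ⟨_, j, rfl⟩ hij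
    have hne : i ≠ j := fun h => hij (by simp [h])
    have h0 : inner ℂ (v i) (v j) = 0 := hv.2 hne
    have : ‖v i - v j‖ ^ 2 = 2 := by
      rw [@norm_sub_sq ℂ, h0, hv.1, hv.1]; norm_num
    rw [Subtype.dist_eq, dist_eq_norm]
    nlinarith [norm_nonneg (v i - v j)]
  have : Countable (Set.range v) := TopologicalSpace.separableSpace_iff_countable.1 inferInstance
  exact (Equiv.ofInjective v hv.linearIndependent.injective).countable_iff.2 this

end HilbertBasis

section L2

open scoped ENNReal ComplexConjugate

theorem enorm_sq_eq_lintegral {α : Type*} [MeasurableSpace α] {μ : Measure α} (f : Lp ℂ 2 μ) :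
    ‖f‖ₑ ^ 2 = ∫⁻ x, ‖f x‖ₑ ^ 2 ∂μ := by
  rw [Lp.enorm_def]
  have := eLpNorm_nnreal_pow_eq_lintegral (μ := μ) (f := f) (p := 2) two_ne_zero
  simpa using this

theorem norm_sq_eq_integral {α : Type*} [MeasurableSpace α] {μ : Measure α} (f : Lp ℂ 2 μ) :
    ‖f‖ ^ 2 = ∫ x, ‖f x‖ ^ 2 ∂μ := by
  have h := L2.inner_def (𝕜 := ℂ) f f
  rw [inner_self_eq_norm_sq_to_K] at h
  have h2 : ∀ x, inner ℂ (f x) (f x) = ((‖f x‖ ^ 2 : ℝ) : ℂ) := fun x => by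
    rw [inner_self_eq_norm_sq_to_K]; norm_cast
  simp_rw [h2] at h
  rw [integral_complex_ofReal] at h
  exact Complex.ofReal_injective (by rw [← h]; push_cast; rfl)

/-- An `L²`-convergent series which converges pointwise has its pointwise sum as its sum. -/
theorem ae_eq_of_hasSum_L2 {α ι : Type*} [MeasurableSpace α] {μ : Measure α}
    [Countable ι] {f : ι → Lp ℂ 2 μ} {F : Lp ℂ 2 μ} (hF : HasSum f F) {G : α → ℂ}
    (hG : ∀ᵐ x ∂μ, HasSum (fun i => f i x) (G x)) : F =ᵐ[μ] G := by
  obtain ⟨s, hs⟩ := exists_seq_tendsto (atTop : Filter (Finset ι))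
  have h1 : Tendsto (fun n => ∑ i ∈ s n, f i) atTop (𝓝 F) := hF.comp hs
  have h2 : TendstoInMeasure μ (fun n => ((∑ i ∈ s n, f i : Lp ℂ 2 μ) : α → ℂ)) atTop F :=
    tendstoInMeasure_of_tendsto_Lp h1
  obtain ⟨ns, hns, h3⟩ := h2.exists_seq_tendsto_ae
  have h4 : ∀ n, ((∑ i ∈ s n, f i : Lp ℂ 2 μ) : α → ℂ) =ᵐ[μ] fun x => ∑ i ∈ s n, f i x := fun n =>
    (Lp.coeFn_finsetSum _ _).trans (Eventually.of_forall fun x => Finset.sum_apply _ _ _)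
  filter_upwards [h3, hG, ae_all_iff.2 h4] with x h5 h6 h7
  refine tendsto_nhds_unique (h5.congr fun n => h7 _) ?_
  exact h6.comp (hs.comp hns.tendsto_atTop)

end L2

section Cutoff

open scoped ENNReal

variable {E : Set ℝ} {μ : Measure E}

theorem inner_cutoff (B : Set E) (hB : MeasurableSet B) (f g : Lp ℂ 2 μ) :
    inner ℂ (cutoff μ B hB f) g = inner ℂ f (cutoff μ B hB g) := by
  rw [L2.inner_def, L2.inner_def]
  refine integral_congr_ae ?_
  filter_upwards [((Lp.memLp f).indicator hB).coeFn_toLp, ((Lp.memLp g).indicator hB).coeFn_toLp]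
    with x h1 h2
  simp only [cutoff] at *
  rw [h1, h2]
  by_cases hx : x ∈ B <;> simp [hx]

theorem enorm_cutoff_sq (B : Set E) (hB : MeasurableSet B) (f : Lp ℂ 2 μ) :
    ‖cutoff μ B hB f‖ₑ ^ 2 = ∫⁻ x in B, ‖f x‖ₑ ^ 2 ∂μ := by
  rw [enorm_sq_eq_lintegral, ← lintegral_indicator hB]
  refine lintegral_congr_ae ?_
  filter_upwards [((Lp.memLp f).indicator hB).coeFn_toLp] with x h1
  simp only [cutoff] at *
  rw [h1]
  by_cases hx : x ∈ B <;> simp [hx]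

end Cutoff

section PiSystem

theorem ae_eq_of_setIntegral_eq_piSystem {α : Type*} {m : MeasurableSpace α} {μ : Measure α}
    {f g : α → ℂ} (hf : Integrable f μ) (hg : Integrable g μ) {C : Set (Set α)}
    (hgen : m = MeasurableSpace.generateFrom C) (hpi : IsPiSystem C)
    (hC : ∀ s ∈ C, ∫ x in s, f x ∂μ = ∫ x in s, g x ∂μ) (huniv : ∫ x, f x ∂μ = ∫ x, g x ∂μ) :
    f =ᵐ[μ] g := by
  refine hf.ae_eq_of_forall_setIntegral_eq _ _ hg fun s hs hfin => ?_
  clear hfin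
  induction s, hs using MeasurableSpace.induction_on_inter hgen hpi with
  | empty => simp
  | basic s hs => exact hC s hs
  | compl s hs ih => rw [setIntegral_compl hs hf, setIntegral_compl hs hg, ih, huniv]
  | iUnion s hd hs ih =>
    rw [integral_iUnion hs hd hf.integrableOn, integral_iUnion hs hd hg.integrableOn]
    exact tsum_congr ih

end PiSystem
end RegProd

namespace RegProd

/-! ### Expansion of the projection kernel in the family `Q b_i`. -/

section ProjectionKernel

open scoped ENNReal ComplexConjugate

theorem summable_mul_of_summable_sq {ι : Type*} {f g : ι → ℂ} (hf : Summable fun i => ‖f i‖ ^ 2)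
    (hg : Summable fun i => ‖g i‖ ^ 2) : Summable fun i => f i * g i := by
  refine Summable.of_norm_bounded (hf.add hg) fun i => ?_
  rw [norm_mul]
  nlinarith [sq_nonneg (‖f i‖ - ‖g i‖), sq_nonneg ‖f i‖, sq_nonneg ‖g i‖]

variable {E : Set ℝ} {μ : Measure E} {K : E → E → ℂ} {Q : Lp ℂ 2 μ →L[ℂ] Lp ℂ 2 μ} {ι : Type}
  {b : HilbertBasis ι ℂ (Lp ℂ 2 μ)}

/-- As `Q` is a self-adjoint idempotent, the diagonal elements of `χQχ` are `‖Qχ b_i‖²`. Their sum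
is the squared Hilbert–Schmidt norm of `Qχ`, hence of its adjoint `χQ`, which is the integral on the
left. -/
theorem lintegral_tsum_enorm_sq (hself : ∀ f g, inner ℂ (Q f) g = inner ℂ f (Q g))
    (hidem : ∀ f, Q (Q f) = Q f) [Countable ι] {B : Set E} (hB : MeasurableSet B) {r : ℂ}
    (h : HasSum (fun i => inner ℂ (b i) (cutoff μ B hB (Q (cutoff μ B hB (b i))))) r) :
    0 ≤ r.re ∧ r = r.re ∧ ∫⁻ x in B, ∑' i, ‖Q (b i) x‖ₑ ^ 2 ∂μ = ENNReal.ofReal r.re := by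
  have h1 : ∀ i, inner ℂ (b i) (cutoff μ B hB (Q (cutoff μ B hB (b i)))) =
      ((‖Q (cutoff μ B hB (b i))‖ ^ 2 : ℝ) : ℂ) := fun i => by
    rw [← inner_cutoff, ← hidem, ← hself, hidem, inner_self_eq_norm_sq_to_K]
    norm_cast
  simp_rw [h1] at h
  have h2 : HasSum (fun i => ‖Q (cutoff μ B hB (b i))‖ ^ 2) r.re := by
    simpa only [Complex.ofReal_re] using Complex.hasSum_re h
  have hr : 0 ≤ r.re := h2.nonneg fun i => sq_nonneg _
  refine ⟨hr, h.unique (Complex.hasSum_ofReal.2 h2), ?_⟩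
  rw [lintegral_tsum fun i => ((Lp.stronglyMeasurable _).measurable.enorm.pow_const 2).aemeasurable]
  simp_rw [← enorm_cutoff_sq B hB]
  rw [← tsum_enorm_sq_eq_of_adjoint b (A := fun f => Q (cutoff μ B hB f))
    (B := fun f => cutoff μ B hB (Q f)) fun f g => by rw [hself, inner_cutoff]]
  have h3 : ∀ i, ‖Q (cutoff μ B hB (b i))‖ₑ ^ 2 =
      ENNReal.ofReal (‖Q (cutoff μ B hB (b i))‖ ^ 2) := fun i => by
    rw [ENNReal.ofReal_pow (norm_nonneg _), ofReal_norm]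
  simp_rw [h3]
  rw [← ENNReal.ofReal_tsum_of_nonneg (fun i => sq_nonneg _) h2.summable, h2.tsum_eq]

theorem summable_norm_sq_of_tsum_lt_top {f : ι → ℂ} (h : ∑' i, ‖f i‖ₑ ^ 2 < ∞) :
    Summable (fun i => ‖f i‖ ^ 2) ∧ ∑' i, ‖f i‖ ^ 2 = (∑' i, ‖f i‖ₑ ^ 2).toReal := by
  have h1 := ENNReal.summable_toReal h.ne
  rw [ENNReal.tsum_toReal_eq fun i => by finiteness]
  simpa using h1

theorem ae_of_ae_restrict_cover {α : Type*} [MeasurableSpace α] {μ : Measure α} {D : ℕ → Set α}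
    (hD : ⋃ k, D k = Set.univ) {p : α → Prop} (h : ∀ k, ∀ᵐ x ∂μ.restrict (D k), p x) :
    ∀ᵐ x ∂μ, p x := by
  rw [← Measure.restrict_univ (μ := μ), ← hD, ae_restrict_iUnion_iff]
  exact h

theorem isBounded_window (T : ℝ) : Bornology.IsBounded {x : E | |(x : ℝ)| ≤ T} := by
  rw [← Bornology.isBounded_image_subtype_val]
  refine (Metric.isBounded_closedBall (x := (0 : ℝ)) (r := T)).subset ?_
  rintro _ ⟨x, hx, rfl⟩
  simpa using hx

theorem measurableSet_window (T : ℝ) : MeasurableSet {x : E | |(x : ℝ)| ≤ T} :=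
  measurableSet_le measurable_subtype_coe.norm measurable_const

theorem iUnion_window : ⋃ n : ℕ, {x : E | |(x : ℝ)| ≤ n} = Set.univ := by
  ext x; simpa using exists_nat_ge |(x : ℝ)|

theorem ae_tsum_lt_top_of_bounded [Countable ι] {F : ι → E → ℂ} (hF : ∀ i, Measurable (F i))
    (h : ∀ B : Set E, MeasurableSet B → Bornology.IsBounded B →
      ∫⁻ x in B, ∑' i, ‖F i x‖ₑ ^ 2 ∂μ < ∞) : ∀ᵐ x ∂μ, ∑' i, ‖F i x‖ₑ ^ 2 < ∞ := by
  exact ae_of_ae_restrict_cover iUnion_window fun n => ae_lt_top (Measurable.tsum fun i => (hF i).enorm.pow_const 2)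
    (h _ (measurableSet_window _) (isBounded_window _)).ne

/-- Both sides have equal integrals over all bounded Borel sets, and windows exhaust the space. Only
the trace formula can identify the values of the kernel on the diagonal. -/
theorem ae_diag_eq [Countable ι] {F : ι → E → ℂ} (hF : ∀ i, Measurable (F i)) {f : E → ℂ}
    (hf : ∀ B : Set E, MeasurableSet B → Bornology.IsBounded B → IntegrableOn f B μ ∧
      0 ≤ (∫ x in B, f x ∂μ).re ∧ ∫ x in B, f x ∂μ = (∫ x in B, f x ∂μ).re ∧
      ∫⁻ x in B, ∑' i, ‖F i x‖ₑ ^ 2 ∂μ = ENNReal.ofReal (∫ x in B, f x ∂μ).re) :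
    ∀ᵐ x ∂μ, f x = (((∑' i, ‖F i x‖ₑ ^ 2).toReal : ℝ) : ℂ) := by
  have hm : Measurable fun x => ∑' i, ‖F i x‖ₑ ^ 2 :=
    Measurable.tsum fun i => (hF i).enorm.pow_const 2
  refine ae_of_ae_restrict_cover iUnion_window fun n => ?_
  have hn := hf _ (measurableSet_window (E := E) n) (isBounded_window _)
  refine hn.1.ae_eq_of_forall_setIntegral_eq _ _ ?_ fun s hs _ => ?_
  · exact (integrable_toReal_of_lintegral_ne_top hm.aemeasurable
      (by rw [hn.2.2.2]; finiteness)).ofReal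
  · have hs' := hf _ (hs.inter (measurableSet_window (E := E) n))
      ((isBounded_window _).subset Set.inter_subset_right)
    rw [Measure.restrict_restrict hs, integral_complex_ofReal, integral_toReal hm.aemeasurable,
      hs'.2.2.2, ENNReal.toReal_ofReal hs'.2.1, ← hs'.2.2.1]
    rw [← Measure.restrict_restrict hs]
    exact ae_restrict_of_ae (ae_lt_top hm (by rw [hn.2.2.2]; finiteness))

/-- Expand `Q 1_S` in the basis and apply `Q` once more. The series converges in `L²` to `Q 1_S`,
and almost everywhere by Cauchy–Schwarz; the two sums agree. -/
theorem ae_projection_eq_tsum [Countable ι] (hself : ∀ f g, inner ℂ (Q f) g = inner ℂ f (Q g))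
    (hidem : ∀ f, Q (Q f) = Q f)
    (hfin : ∀ᵐ x ∂μ, ∑' i, ‖Q (b i) x‖ₑ ^ 2 < ∞) {S : Set E} (hS : MeasurableSet S)
    (hμS : μ S ≠ ∞) :
    ∀ᵐ x ∂μ, HasSum (fun i => Q (b i) x * ∫ y in S, conj (Q (b i) y) ∂μ)
      (Q (indicatorConstLp 2 hS hμS 1) x) := by
  set v : Lp ℂ 2 μ := indicatorConstLp 2 hS hμS 1
  have hin : ∀ i, inner ℂ (b i) (Q v) = ∫ y in S, conj (Q (b i) y) ∂μ := fun i => by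
    rw [← hself, ← inner_conj_symm, L2.inner_indicatorConstLp_one, ← integral_conj]
  have h1 : HasSum (fun i => inner ℂ (b i) (Q v) • Q (b i)) (Q v) := by
    have := (b.hasSum_repr (Q v)).mapL Q
    simpa only [map_smul, hidem, b.repr_apply_apply] using this
  have h2 : ∀ᵐ x ∂μ, ∀ i, (inner ℂ (b i) (Q v) • Q (b i) : Lp ℂ 2 μ) x =
      Q (b i) x * ∫ y in S, conj (Q (b i) y) ∂μ := ae_all_iff.2 fun i => by
    filter_upwards [Lp.coeFn_smul (inner ℂ (b i) (Q v)) (Q (b i))] with x hx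
    rw [hx, Pi.smul_apply, smul_eq_mul, mul_comm, hin]
  have h3 : ∀ᵐ x ∂μ, Summable fun i => Q (b i) x * ∫ y in S, conj (Q (b i) y) ∂μ := by
    filter_upwards [hfin] with x hx
    refine summable_mul_of_summable_sq (summable_norm_sq_of_tsum_lt_top hx).1 ?_
    simpa only [hin] using (hasSum_norm_inner_sq b (Q v)).summable
  have h4 := ae_eq_of_hasSum_L2 h1
    (G := fun x => ∑' i, Q (b i) x * ∫ y in S, conj (Q (b i) y) ∂μ) (by
      filter_upwards [h2, h3] with x hx hx'
      simp_rw [hx]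
      exact hx'.hasSum)
  filter_upwards [h3, h4] with x h5 h6
  rw [h6]
  exact h5.hasSum

/-- The majorant `|c_i|² + |F_i|²` has a finite total integral over `S`, so sum and integral may be
exchanged. -/
theorem setIntegral_tsum_kernel {α : Type*} [MeasurableSpace α] {μ : Measure α} [Countable ι]
    {F : ι → α → ℂ} (hF : ∀ i, Measurable (F i))
    {S : Set α} (hμS : μ S ≠ ∞) (hSfin : ∫⁻ y in S, ∑' i, ‖F i y‖ₑ ^ 2 ∂μ ≠ ∞) {c : ι → ℂ}
    (hc : Summable fun i => ‖c i‖ ^ 2) :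
    IntegrableOn (fun y => ∑' i, c i * conj (F i y)) S μ ∧
    HasSum (fun i => c i * ∫ y in S, conj (F i y) ∂μ) (∫ y in S, ∑' i, c i * conj (F i y) ∂μ) := by
  have : IsFiniteMeasure (μ.restrict S) := ⟨by simpa using hμS.lt_top⟩
  have hm : ∀ i, Measurable fun y => ‖F i y‖ₑ ^ 2 := fun i => (hF i).enorm.pow_const 2
  have hfin := hSfin
  rw [lintegral_tsum fun i => (hm i).aemeasurable] at hfin
  have hfi : ∀ i, ∫⁻ y in S, ‖F i y‖ₑ ^ 2 ∂μ ≠ ∞ := fun i => ne_top_of_le_ne_top hfin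
    (ENNReal.le_tsum i)
  have hsq : ∀ i, Integrable (fun y => ‖F i y‖ ^ 2) (μ.restrict S) := fun i => by
    have := integrable_toReal_of_lintegral_ne_top (hm i).aemeasurable (hfi i)
    simpa using this
  have hsum : Summable fun i => ∫ y in S, ‖F i y‖ ^ 2 ∂μ := by
    have := ENNReal.summable_toReal hfin
    convert this using 2 with i
    rw [← integral_toReal (hm i).aemeasurable (ae_lt_top (hm i) (hfi i))]
    simp
  have hbd : ∀ i y, ‖c i * conj (F i y)‖ ≤ ‖c i‖ ^ 2 + ‖F i y‖ ^ 2 := fun i y => by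
    rw [norm_mul, RCLike.norm_conj]
    nlinarith [sq_nonneg (‖c i‖ - ‖F i y‖), sq_nonneg ‖c i‖, sq_nonneg ‖F i y‖]
  have hbi : ∀ i, Integrable (fun y => ‖c i‖ ^ 2 + ‖F i y‖ ^ 2) (μ.restrict S) := fun i =>
    (integrable_const _).add (hsq i)
  have hcm : ∀ i, Measurable fun y => c i * conj (F i y) := fun i =>
    (Complex.continuous_conj.measurable.comp (hF i)).const_mul _
  have hint : ∀ i, Integrable (fun y => c i * conj (F i y)) (μ.restrict S) := fun i =>
    (hbi i).mono' (hcm i).aestronglyMeasurable (Eventually.of_forall (hbd i))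
  have hns : Summable fun i => ∫ y in S, ‖c i * conj (F i y)‖ ∂μ := by
    refine Summable.of_nonneg_of_le (fun i => integral_nonneg fun y => norm_nonneg _)
      (fun i => integral_mono (hint i).norm (hbi i) (hbd i)) ?_
    simp_rw [fun i => integral_add (integrable_const (‖c i‖ ^ 2)) (hsq i), integral_const]
    exact (hc.const_smul _).add hsum
  refine ⟨?_, ?_⟩
  · have hκ := integrable_toReal_of_lintegral_ne_top
      (Measurable.tsum hm).aemeasurable hSfin
    refine ((integrable_const (∑' i, ‖c i‖ ^ 2)).add hκ).mono'
      (Measurable.tsum hcm).aestronglyMeasurable ?_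
    filter_upwards [ae_lt_top (Measurable.tsum hm) hSfin] with y hy
    obtain ⟨h1, h2⟩ := summable_norm_sq_of_tsum_lt_top hy
    simp only [Pi.add_apply]
    rw [← h2, ← hc.tsum_add h1]
    exact tsum_of_norm_bounded (hc.add h1).hasSum fun i => hbd i y
  · have := hasSum_integral_of_summable_integral_norm hint hns
    simpa only [integral_const_mul] using this

end ProjectionKernel
end RegProd

namespace RegProd

section ProjectionKernel

open scoped ENNReal ComplexConjugate

variable {E : Set ℝ} {μ : Measure E} {K : E → E → ℂ} {Q : Lp ℂ 2 μ →L[ℂ] Lp ℂ 2 μ} {ι : Type}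
  {b : HilbertBasis ι ℂ (Lp ℂ 2 μ)}

theorem IsProjectionKernel.of_starProjection (hQ : IsStarProjection Q) :
    (∀ f g, inner ℂ (Q f) g = inner ℂ f (Q g)) ∧ (∀ f, Q (Q f) = Q f) ∧ ∀ f, ‖Q f‖ ≤ ‖f‖ := by
  have h1 : ∀ f g, inner ℂ (Q f) g = inner ℂ f (Q g) :=
    ContinuousLinearMap.isSelfAdjoint_iff_isSymmetric.1 hQ.isSelfAdjoint
  have h2 : ∀ f, Q (Q f) = Q f := fun f => DFunLike.congr_fun hQ.isIdempotentElem f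
  refine ⟨h1, h2, fun f => ?_⟩
  have h3 : ‖Q f‖ * ‖Q f‖ ≤ ‖f‖ * ‖Q f‖ := by
    rw [← @inner_self_eq_norm_mul_norm ℂ, h1, h2]
    exact (RCLike.re_le_norm _).trans (norm_inner_le_norm _ _)
  by_contra! hlt
  nlinarith [norm_nonneg f]

theorem bessel_of_contraction (hcontr : ∀ f, ‖Q f‖ ≤ ‖f‖) (s : Finset ι) (c : s → ℂ) :
    ∫ x, ‖∑ i, c i * Q (b i) x‖ ^ 2 ∂μ ≤ ∑ i, ‖c i‖ ^ 2 := by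
  have h1 : ∫ x, ‖∑ i, c i * Q (b i) x‖ ^ 2 ∂μ = ‖Q (∑ i, c i • b i)‖ ^ 2 := by
    rw [norm_sq_eq_integral, map_sum]
    refine integral_congr_ae ?_
    have h2 : ∀ᵐ x ∂μ, ∀ i : s, (Q (c i • b i)) x = c i * Q (b i) x := ae_all_iff.2 fun i => by
      rw [map_smul]
      filter_upwards [Lp.coeFn_smul (c i) (Q (b i))] with x hx
      rw [hx, Pi.smul_apply, smul_eq_mul]
    filter_upwards [h2, Lp.coeFn_finsetSum Finset.univ fun i : s => Q (c i • b i)] with x hx hx'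
    rw [hx', Finset.sum_apply]
    simp_rw [hx]
  have h2 : ‖∑ i, c i • b i‖ ^ 2 = ∑ i, ‖c i‖ ^ 2 := by
    have ho : Orthonormal ℂ fun i : s => b i := b.orthonormal.comp _ Subtype.val_injective
    have := ho.inner_sum c c Finset.univ
    rw [inner_self_eq_norm_sq_to_K] at this
    simp_rw [RCLike.conj_mul] at this
    exact_mod_cast this
  rw [h1, ← h2]
  exact pow_le_pow_left₀ (norm_nonneg _) (hcontr _) 2

/-- A countable generating π-system lets one exceptional null set of `x` work for all test sets in
`y`. -/
theorem subtype_generateFrom_Iic_rat (E : Set ℝ) : (inferInstance : MeasurableSpace E) =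
    MeasurableSpace.generateFrom (Set.range fun q : ℚ => {x : E | (x : ℝ) ≤ q}) := by
  have h : (inferInstance : MeasurableSpace E) =
    MeasurableSpace.comap Subtype.val (inferInstance : MeasurableSpace ℝ) := rfl
  rw [h, BorelSpace.measurable_eq (α := ℝ), Real.borel_eq_generateFrom_Iic_rat,
    MeasurableSpace.comap_generateFrom]
  congr 1
  ext s
  simp only [Set.mem_image, Set.mem_iUnion, Set.mem_singleton_iff, Set.mem_range]
  constructor
  · rintro ⟨_, ⟨q, rfl⟩, rfl⟩
    exact ⟨q, rfl⟩
  · rintro ⟨q, rfl⟩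
    exact ⟨_, ⟨q, rfl⟩, rfl⟩

theorem isPiSystem_range_Iic_rat (E : Set ℝ) :
    IsPiSystem (Set.range fun q : ℚ => {x : E | (x : ℝ) ≤ q}) := by
  rintro _ ⟨p, rfl⟩ _ ⟨q, rfl⟩ _
  exact ⟨min p q, by ext x; simp⟩

/-- A projection kernel which is locally of trace class is the sum of a Bessel family. -/
theorem IsProjectionKernel.exists_isBesselExpansion [SigmaFinite μ] (hK : IsProjectionKernel μ K) :
    ∃ (ι : Type) (_ : Countable ι) (φ : ι → E → ℂ), IsBesselExpansion μ φ K := by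
  obtain ⟨Q, hQ, hint, htr⟩ := hK.exists_projection
  obtain ⟨hself, hidem, hcontr⟩ := IsProjectionKernel.of_starProjection hQ
  obtain ⟨w, b, -⟩ := exists_hilbertBasis ℂ (Lp ℂ 2 μ)
  have : Countable w := by
    have : Fact ((2 : ℝ≥0∞) ≠ ∞) := ⟨by simp⟩
    exact countable_of_orthonormal b.orthonormal
  have hφ : ∀ i, Measurable fun x => Q (b i) x := fun i => (Lp.stronglyMeasurable _).measurable
  have hB := fun (B : Set E) (hB : MeasurableSet B) (hb : Bornology.IsBounded B) =>
    lintegral_tsum_enorm_sq hself hidem hB ((htr B hB hb).2 w b)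
  have hfin : ∀ᵐ x ∂μ, ∑' i, ‖Q (b i) x‖ₑ ^ 2 < ∞ := ae_tsum_lt_top_of_bounded hφ
    fun B hB1 hB2 => by rw [(hB B hB1 hB2).2.2]; finiteness
  have hdiag := ae_diag_eq (f := fun x => K x x) hφ
    fun B hB1 hB2 => ⟨(htr B hB1 hB2).1, hB B hB1 hB2⟩
  refine ⟨w, this, fun i => Q (b i), fun i => Lp.memLp _, bessel_of_contraction hcontr, ?_, ?_⟩
  · filter_upwards [hfin, hdiag] with x h1 h2
    obtain ⟨h3, h4⟩ := summable_norm_sq_of_tsum_lt_top h1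
    exact ⟨h3, by rw [h2, h4]⟩
  have hm : Measurable fun x => ∑' i, ‖Q (b i) x‖ₑ ^ 2 :=
    Measurable.tsum fun i => (hφ i).enorm.pow_const 2
  have hKt : Measurable fun z : E × E => ∑' i, Q (b i) z.1 * conj (Q (b i) z.2) :=
    Measurable.tsum fun i => ((hφ i).comp measurable_fst).mul
      (Complex.continuous_conj.measurable.comp ((hφ i).comp measurable_snd))
  -- The sets `D k` are bounded and of finite measure, so that the trace formula and the indicators
  -- in `L²` are both available. The sets `S k q` form a countable family testing functions on `D
  -- k`.
  let D : ℕ → Set E := fun k => spanningSets μ k ∩ {x : E | |(x : ℝ)| ≤ k}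
  let S : ℕ → ℚ → Set E := fun k q => D k ∩ {x : E | (x : ℝ) ≤ q}
  have hDm : ∀ k, MeasurableSet (D k) := fun k =>
    (measurableSet_spanningSets μ k).inter (measurableSet_window _)
  have hDU : ⋃ k, D k = Set.univ := by
    refine Set.eq_univ_of_forall fun x => ?_
    obtain ⟨n, hn⟩ := exists_nat_ge |(x : ℝ)|
    have h1 := mem_spanningSetsIndex μ x
    refine Set.mem_iUnion.2 ⟨max n (spanningSetsIndex μ x), ?_, ?_⟩
    · exact monotone_spanningSets μ (le_max_right _ _) h1
    · exact hn.trans (by exact_mod_cast le_max_left _ _)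
  have hSm : ∀ k q, MeasurableSet (S k q) := fun k q =>
    (hDm k).inter (measurableSet_le measurable_subtype_coe measurable_const)
  have hμS : ∀ k q, μ (S k q) ≠ ∞ := fun k q => ne_top_of_le_ne_top
    (measure_spanningSets_lt_top μ k).ne
    (measure_mono (Set.inter_subset_left.trans Set.inter_subset_left))
  have hSb : ∀ k q, ∫⁻ y in S k q, ∑' i, ‖Q (b i) y‖ₑ ^ 2 ∂μ ≠ ∞ := fun k q => by
    rw [(hB _ (hSm k q) ((isBounded_window k).subset
      (Set.inter_subset_left.trans Set.inter_subset_right))).2.2]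
    finiteness
  -- The cut at `q = k` removes nothing from the window of size `k`, so the total integrals over `D
  -- k` are among the tests.
  have hDS : ∀ k : ℕ, S k k = D k := fun k => Set.inter_eq_left.2 fun x hx => by
    have := (le_abs_self (x : ℝ)).trans hx.2
    simpa using this
  -- For almost every `x`, both functions of `y` have the same integral over every `S k q`: one
  -- integral evaluates `Q 1_S` through the kernel, the other through the basis.
  have hmain : ∀ᵐ x ∂μ, ∀ᵐ y ∂μ, K x y = ∑' i, Q (b i) x * conj (Q (b i) y) := by
    have h1 : ∀ᵐ x ∂μ, ∀ k q, IntegrableOn (fun y => K x y) (S k q) μ ∧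
        Q (indicatorConstLp 2 (hSm k q) (hμS k q) 1) x = ∫ y in S k q, K x y ∂μ := by
      refine ae_all_iff.2 fun k => ae_all_iff.2 fun q => ?_
      filter_upwards [hint (indicatorConstLp 2 (hSm k q) (hμS k q) 1)] with x hx
      have he : (fun y => K x y * (indicatorConstLp 2 (hSm k q) (hμS k q) (1 : ℂ) : Lp ℂ 2 μ) y)
          =ᵐ[μ] (S k q).indicator fun y => K x y := by
        filter_upwards [indicatorConstLp_coeFn (p := 2) (hs := hSm k q) (hμs := hμS k q)
          (c := (1 : ℂ))] with y hy
        rw [hy]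
        by_cases hyS : y ∈ S k q <;> simp [hyS]
      rw [integrable_congr he, integrable_indicator_iff (hSm k q), integral_congr_ae he,
        integral_indicator (hSm k q)] at hx
      exact hx
    have h2 : ∀ᵐ x ∂μ, ∀ k q, HasSum (fun i => Q (b i) x * ∫ y in S k q, conj (Q (b i) y) ∂μ)
        (Q (indicatorConstLp 2 (hSm k q) (hμS k q) 1) x) :=
      ae_all_iff.2 fun k => ae_all_iff.2 fun q =>
        ae_projection_eq_tsum hself hidem hfin (hSm k q) (hμS k q)
    filter_upwards [h1, h2, hfin] with x h1 h2 h3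
    have h4 := fun k q => setIntegral_tsum_kernel hφ (hμS k q) (hSb k q)
      (summable_norm_sq_of_tsum_lt_top h3).1
    have h5 : ∀ k q, ∫ y in S k q, K x y ∂μ =
        ∫ y in S k q, ∑' i, Q (b i) x * conj (Q (b i) y) ∂μ := fun k q => by
      rw [← (h1 k q).2]
      exact (h2 k q).unique (h4 k q).2
    refine ae_of_ae_restrict_cover hDU fun k => ?_
    refine ae_eq_of_setIntegral_eq_piSystem ?_ ?_ (subtype_generateFrom_Iic_rat E)
      (isPiSystem_range_Iic_rat E) ?_ ?_
    · rw [← hDS]; exact (h1 k k).1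
    · rw [← hDS]; exact (h4 k k).1
    · rintro _ ⟨q, rfl⟩
      have hq : MeasurableSet {x : E | (x : ℝ) ≤ q} :=
        measurableSet_le measurable_subtype_coe measurable_const
      rw [Measure.restrict_restrict hq, Set.inter_comm]
      exact h5 k q
    · have := h5 k k
      rwa [hDS] at this
  have hprod : ∀ᵐ z ∂(μ.prod μ), (∑' i, ‖Q (b i) z.1‖ₑ ^ 2 < ∞) ∧ (∑' i, ‖Q (b i) z.2‖ₑ ^ 2 < ∞) ∧
      K z.1 z.2 = ∑' i, Q (b i) z.1 * conj (Q (b i) z.2) := by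
    refine (Measure.ae_prod_iff_ae_ae ?_).2 ?_
    · exact (measurableSet_lt (hm.comp measurable_fst) measurable_const).inter
        ((measurableSet_lt (hm.comp measurable_snd) measurable_const).inter
          (measurableSet_eq_fun hK.measurable hKt))
    · filter_upwards [hfin, hmain] with x h1 h2
      filter_upwards [hfin, h2] with y h3 h4
      exact ⟨h1, h3, h4⟩
  filter_upwards [hprod] with z hz
  rw [hz.2.2]
  refine (summable_mul_of_summable_sq (summable_norm_sq_of_tsum_lt_top hz.1).1 ?_).hasSum
  simpa using (summable_norm_sq_of_tsum_lt_top hz.2.1).1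

end ProjectionKernel
end RegProd

namespace RegProd

/-! ### Sums over distinct points of a configuration. -/

section LinearStatistics

open scoped ENNReal
open Finset

variable {E : Set ℝ}

/-- The points of a configuration in the window `[-T, T]`. -/
noncomputable def Conf.window (X : Conf E) (T : ℝ) : Finset E := (X.finite T).toFinset

theorem Conf.mem_window {X : Conf E} {T : ℝ} {x : E} :
    x ∈ X.window T ↔ x ∈ X.carrier ∧ |(x : ℝ)| ≤ T := by
  simp [Conf.window]

theorem Conf.window_mono (X : Conf E) {S T : ℝ} (h : S ≤ T) : X.window S ⊆ X.window T :=
  fun _ hx => mem_window.2 ⟨(mem_window.1 hx).1, (mem_window.1 hx).2.trans h⟩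

/-- Tuples leaving the window do not contribute, so the unconditional sum over the whole
configuration is a finite one. -/
theorem distinctSum_eq_sum_embedding {n : ℕ} {f : (Fin n → E) → ℂ} {T : ℝ} (X : Conf E)
    (hf : ∀ t, (∃ i, T < |((t i : E) : ℝ)|) → f t = 0) :
    distinctSum n f X = ∑ t : Fin n ↪ X.window T, f fun i => (t i : E) := by
  let e : (Fin n ↪ X.window T) →
      {t : Fin n → E // Function.Injective t ∧ ∀ i, t i ∈ X.carrier} := fun t =>
    ⟨fun i => (t i : E), Subtype.val_injective.comp t.injective, fun i =>
      (Conf.mem_window.1 (t i).2).1⟩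
  have he : Function.Injective e := fun t t' h => by
    ext i
    have := congrFun (congrArg Subtype.val h) i
    exact congrArg Subtype.val this
  rw [distinctSum, ← tsum_fintype (L := .unconditional _)]
  symm
  refine he.tsum_eq (f := fun t : {t : Fin n → E // Function.Injective t ∧ ∀ i, t i ∈ X.carrier} =>
    f t.1) fun t ht => ?_
  have hT : ∀ i, |((t.1 i : E) : ℝ)| ≤ T := by
    by_contra! h
    exact ht (hf _ h)
  exact ⟨⟨fun i => ⟨t.1 i, Conf.mem_window.2 ⟨t.2.2 i, hT i⟩⟩, fun i j h =>
    t.2.1 (congrArg Subtype.val h)⟩, rfl⟩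

theorem prod_eq_zero_of_window {n : ℕ} {h : E → ℂ} {T : ℝ} (hT : ∀ x : E, T < |(x : ℝ)| → h x = 0)
    (t : Fin n → E) (ht : ∃ i, T < |((t i : E) : ℝ)|) : ∏ i, h (t i) = 0 := by
  obtain ⟨i, hi⟩ := ht
  exact prod_eq_zero (mem_univ i) (hT _ hi)

theorem hasSum_distinctSum {h : E → ℂ} {T : ℝ} (hT : ∀ x : E, T < |(x : ℝ)| → h x = 0)
    (X : Conf E) :
    HasSum (fun n : ℕ => (n.factorial : ℂ)⁻¹ * distinctSum n (fun t => ∏ i, h (t i)) X)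
      (∏ x ∈ X.window T, (1 + h x)) := by
  classical
  have h1 := hasSum_inv_factorial_sum_embedding
    (fun S : Finset (X.window T) => ∏ y ∈ S, h y)
  rw [← powerset_univ, ← prod_one_add, prod_coe_sort _ fun x => 1 + h x] at h1
  convert h1 using 3 with n
  rw [distinctSum_eq_sum_embedding X (prod_eq_zero_of_window hT)]
  exact sum_congr rfl fun t _ => by rw [prod_map]

theorem norm_distinctSum_le {h : E → ℝ} {T : ℝ} (hT : ∀ x : E, T < |(x : ℝ)| → h x = 0)
    (X : Conf E) (n : ℕ) :
    ‖distinctSum n (fun t => ∏ i, (h (t i) : ℂ)) X‖ ≤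
      (distinctSum n (fun t => ∏ i, ((|h (t i)| : ℝ) : ℂ)) X).re := by
  rw [distinctSum_eq_sum_embedding (T := T) X
      (prod_eq_zero_of_window (h := fun x => (h x : ℂ)) fun x hx => by simp [hT x hx]),
    distinctSum_eq_sum_embedding (T := T) X
      (prod_eq_zero_of_window (h := fun x => ((|h x| : ℝ) : ℂ)) fun x hx => by simp [hT x hx])]
  refine (norm_sum_le _ _).trans (le_of_eq ?_)
  rw [Complex.re_sum]
  refine sum_congr rfl fun t _ => ?_
  rw [norm_prod, ← Complex.ofReal_prod, Complex.ofReal_re]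
  simp

theorem distinctSum_one {f : E → ℂ} {T : ℝ} (hT : ∀ x : E, T < |(x : ℝ)| → f x = 0)
    (X : Conf E) : distinctSum 1 (fun t => ∏ i, f (t i)) X = ∑ x ∈ X.window T, f x := by
  let e : (Fin 1 ↪ X.window T) ≃ X.window T :=
    { toFun := fun t => t 0
      invFun := fun y => ⟨fun _ => y, fun _ _ _ => Subsingleton.elim _ _⟩
      left_inv := fun t => by ext i; rw [Subsingleton.elim i 0]; rfl
      right_inv := fun y => rfl }
  rw [distinctSum_eq_sum_embedding X (prod_eq_zero_of_window hT), ← sum_coe_sort (X.window T)]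
  refine Fintype.sum_equiv e _ _ fun t => ?_
  rw [univ_unique, prod_singleton]
  rfl

theorem hasCompactSupport_prod {n : ℕ} {h : E → ℂ} (hc : HasCompactSupport h) :
    HasCompactSupport fun t : Fin n → E => ∏ i, h (t i) := by
  refine HasCompactSupport.intro (K := Set.univ.pi fun _ => tsupport h)
    (isCompact_univ_pi fun _ => hc) fun t ht => ?_
  simp only [Set.mem_univ_pi, not_forall] at ht
  obtain ⟨i, hi⟩ := ht
  exact prod_eq_zero (mem_univ i) (image_eq_zero_of_notMem_tsupport hi)

theorem integrable_tsum_of_summable_integral_norm {α ι : Type*} [MeasurableSpace α] {μ : Measure α}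
    [Countable ι] {F : ι → α → ℂ} (hF : ∀ i, Integrable (F i) μ)
    (hs : Summable fun i => ∫ a, ‖F i a‖ ∂μ) : Integrable (fun a => ∑' i, F i a) μ := by
  refine ⟨(AEMeasurable.tsum fun i => (hF i).aemeasurable).aestronglyMeasurable, ?_⟩
  have h1 : ∑' i, ∫⁻ a, ‖F i a‖ₑ ∂μ < ∞ := by
    have : ∀ i, ∫⁻ a, ‖F i a‖ₑ ∂μ = ENNReal.ofReal (∫ a, ‖F i a‖ ∂μ) := fun i => by
      rw [ofReal_integral_norm_eq_lintegral_enorm (hF i)]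
    simp_rw [this]
    exact hs.tsum_ofReal_lt_top
  refine lt_of_le_of_lt (lintegral_mono fun a => enorm_tsum_le_tsum_enorm) ?_
  rwa [lintegral_tsum fun i => (hF i).aestronglyMeasurable.enorm]

end LinearStatistics

/-! ### Multiplicative functionals of the determinantal process. -/

section MultiplicativeFunctionals

open scoped ENNReal
open Finset

variable {E : Set ℝ} {μ : Measure E} [SigmaFinite μ] {K : E → E → ℂ} {P : Measure (Conf E)}
  {ι : Type} [Countable ι] {φ : ι → E → ℂ}

omit [SigmaFinite μ] [Countable ι] in
theorem IsDeterminantal.prod (hP : IsDeterminantal μ K P) {h : E → ℂ} (hm : Measurable h)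
    {C : ℝ} (hC : ∀ x, ‖h x‖ ≤ C) (hc : HasCompactSupport h) (n : ℕ) :
    Integrable (distinctSum n fun t => ∏ i, h (t i)) P ∧
    ∫ X, distinctSum n (fun t => ∏ i, h (t i)) X ∂P =
      ∫ x : Fin n → E, (∏ i, h (x i)) * kernelDet K x ∂(Measure.pi fun _ => μ) := by
  have h1 := hP n (fun t => ∏ i, h (t i))
    (Finset.measurable_prod _ fun i _ => hm.comp (measurable_pi_apply i))
    ⟨C ^ n, fun t => by
      rw [norm_prod]
      exact (prod_le_prod (fun i _ => norm_nonneg _) fun i _ => hC _).trans (by simp)⟩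
    (hasCompactSupport_prod hc)
  exact ⟨h1.1, h1.2.2⟩

/-- Expand the product into sums over distinct points and take expectations termwise: the result is
the Fredholm series of `hK`. The same expansion for `|h|` and the geometric bound justify the
exchange. -/
theorem IsDeterminantal.lintegral_prod_le (hP : IsDeterminantal μ K P)
    (H : IsBesselExpansion μ φ K) {h : E → ℝ} (hm : Measurable h) {C : ℝ} (hC : ∀ x, |h x| ≤ C)
    (hc : HasCompactSupport h) {T : ℝ} (hT : ∀ x : E, T < |(x : ℝ)| → h x = 0)
    (h0 : ∀ x, -1 ≤ h x) (hint : Integrable (fun x => |h x| * ∑' i, ‖φ i x‖ ^ 2) μ) :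
    ∫⁻ X, ENNReal.ofReal (∏ x ∈ X.window T, (1 + h x)) ∂P ≤
      ENNReal.ofReal (Real.exp (∫ x, h x * ∑' i, ‖φ i x‖ ^ 2 ∂μ)) := by
  have hmc : Measurable fun x => (h x : ℂ) := Complex.measurable_ofReal.comp hm
  have hma : Measurable fun x => ((|h x| : ℝ) : ℂ) := Complex.measurable_ofReal.comp hm.norm
  have hcc : HasCompactSupport fun x => (h x : ℂ) :=
    hc.comp_left (g := fun r : ℝ => (r : ℂ)) Complex.ofReal_zero
  have hca : HasCompactSupport fun x => ((|h x| : ℝ) : ℂ) :=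
    hc.comp_left (g := fun r : ℝ => ((|r| : ℝ) : ℂ)) (by simp)
  have hC1 : ∀ x, ‖(h x : ℂ)‖ ≤ C := fun x => by simpa using hC x
  have hC2 : ∀ x, ‖((|h x| : ℝ) : ℂ)‖ ≤ C := fun x => by simpa using hC x
  have D1 := fun n => hP.prod (h := fun x => (h x : ℂ)) hmc hC1 hcc n
  have D2 := fun n => hP.prod (h := fun x => ((|h x| : ℝ) : ℂ)) hma hC2 hca n
  have hterm : ∀ n : ℕ, ∫ X, (n.factorial : ℂ)⁻¹ * distinctSum n (fun t => ∏ i, (h (t i) : ℂ)) X ∂P =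
      (n.factorial : ℂ)⁻¹ * fredholmTerm μ h K n := fun n => by
    rw [integral_const_mul, (D1 n).2, fredholmTerm]
  have hnorm : ∀ n : ℕ,
      ∫ X, ‖(n.factorial : ℂ)⁻¹ * distinctSum n (fun t => ∏ i, (h (t i) : ℂ)) X‖ ∂P ≤
      (1 / 2) ^ n * Real.exp (2 * ∫ x, |h x| * ∑' i, ‖φ i x‖ ^ 2 ∂μ) := fun n => by
    refine le_trans ?_ (H.fredholmTerm_bound hm hC hint n)
    simp_rw [norm_mul, norm_inv, Complex.norm_natCast]
    rw [integral_const_mul]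
    refine mul_le_mul_of_nonneg_left ?_ (by positivity)
    calc _ ≤ ∫ X, (distinctSum n (fun t => ∏ i, ((|h (t i)| : ℝ) : ℂ)) X).re ∂P :=
          integral_mono (D1 n).1.norm (D2 n).1.re fun X => norm_distinctSum_le hT X n
      _ = (∫ X, distinctSum n (fun t => ∏ i, ((|h (t i)| : ℝ) : ℂ)) X ∂P).re :=
          integral_re (D2 n).1
      _ ≤ _ := by
          rw [(D2 n).2]
          refine (Complex.re_le_norm _).trans ((norm_integral_le_integral_norm _).trans (le_of_eq ?_))
          congr 1
          ext x
          simp only [norm_mul, norm_prod]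
          simp
  have hsum : Summable fun n : ℕ =>
      ∫ X, ‖(n.factorial : ℂ)⁻¹ * distinctSum n (fun t => ∏ i, (h (t i) : ℂ)) X‖ ∂P :=
    Summable.of_nonneg_of_le (fun n => integral_nonneg fun X => norm_nonneg _) hnorm
      ((summable_geometric_of_lt_one (by norm_num) (by norm_num)).mul_right _)
  have hI := fun n : ℕ => (D1 n).1.const_mul (n.factorial : ℂ)⁻¹
  have h1 := integrable_tsum_of_summable_integral_norm hI hsum
  have h2 := hasSum_integral_of_summable_integral_norm hI hsum
  have e : ∀ X : Conf E, ∑' n : ℕ, (n.factorial : ℂ)⁻¹ *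
      distinctSum n (fun t => ∏ i, (h (t i) : ℂ)) X = ((∏ x ∈ X.window T, (1 + h x) : ℝ) : ℂ) :=
    fun X => by
      rw [(hasSum_distinctSum (h := fun x => (h x : ℂ)) (fun x hx => by simp [hT x hx]) X).tsum_eq]
      push_cast; rfl
  simp_rw [e] at h1 h2
  rw [integral_complex_ofReal] at h2
  simp_rw [hterm] at h2
  have h3 : Integrable (fun X : Conf E => ∏ x ∈ X.window T, (1 + h x)) P :=
    h1.re.congr (Eventually.of_forall fun X => Complex.ofReal_re _)
  rw [← ofReal_integral_eq_lintegral_ofReal h3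
    (Eventually.of_forall fun X => prod_nonneg fun x _ => by linarith [h0 x])]
  refine ENNReal.ofReal_le_ofReal ?_
  rw [← Complex.ofReal_re (∫ X, ∏ x ∈ X.window T, (1 + h x) ∂P), ← h2.tsum_eq]
  exact H.fredholmSeries_le hm hC hint h0

end MultiplicativeFunctionals
end RegProd

namespace RegProd

/-! ### From compact supports to whole windows. -/

section Windows

open scoped ENNReal
open Finset

variable {E : Set ℝ}

/-- The restriction of a function to the `n`-th set of a compact exhaustion of `E`, intersected
with the window `[-T, T]`. -/
noncomputable def truncCompact [LocallyCompactSpace E] {A : Type*} [Zero A] (T : ℝ) (f : E → A)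
    (n : ℕ) : E → A :=
  (compactCovering E n ∩ {x : E | |(x : ℝ)| ≤ T}).indicator f

section truncCompact

variable [LocallyCompactSpace E] {A : Type*} [Zero A] (T : ℝ) (f : E → A)

theorem isCompact_truncSet (n : ℕ) :
    IsCompact (compactCovering E n ∩ {x : E | |(x : ℝ)| ≤ T}) :=
  (isCompact_compactCovering E n).inter_right
    (isClosed_le (continuous_abs.comp continuous_subtype_val) continuous_const)

theorem measurable_truncCompact [MeasurableSpace A] (hf : Measurable f) (n : ℕ) :
    Measurable (truncCompact T f n) :=
  hf.indicator (isCompact_truncSet T n).measurableSet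

theorem hasCompactSupport_truncCompact (n : ℕ) : HasCompactSupport (truncCompact T f n) :=
  HasCompactSupport.intro (isCompact_truncSet T n) fun _ hx => Set.indicator_of_notMem hx f

theorem truncCompact_of_lt (n : ℕ) {x : E} (hx : T < |(x : ℝ)|) : truncCompact T f n x = 0 :=
  Set.indicator_of_notMem (fun h => not_le.2 hx h.2) f

theorem eventually_truncCompact_eq {x : E} (hx : |(x : ℝ)| ≤ T) :
    ∀ᶠ n in atTop, truncCompact T f n x = f x := by
  obtain ⟨N, hN⟩ := exists_mem_compactCovering x
  filter_upwards [eventually_ge_atTop N] with n hn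
  exact Set.indicator_of_mem (s := compactCovering E n ∩ {x : E | |(x : ℝ)| ≤ T})
    ⟨compactCovering_subset E hn hN, hx⟩ f

theorem eventually_forall_window (X : Conf E) :
    ∀ᶠ n in atTop, ∀ x ∈ X.window T, truncCompact T f n x = f x :=
  (Filter.eventually_all_finset (X.window T)).2 fun _ hx =>
    eventually_truncCompact_eq T f (Conf.mem_window.1 hx).2

end truncCompact

variable [LocallyCompactSpace E] {μ : Measure E} {K : E → E → ℂ} {P : Measure (Conf E)}

/-- Measurability is read off from the determinantal identity with `n = 1`, whose integrability
clause contains it. For each `X` the truncated sums are eventually constant, the window having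
finitely many points of `X`. -/
theorem IsDeterminantal.aestronglyMeasurable_sum (hP : IsDeterminantal μ K P) {f : E → ℂ}
    (hf : Measurable f) {C : ℝ} (hC : ∀ x, ‖f x‖ ≤ C) (T : ℝ) :
    AEStronglyMeasurable (fun X => ∑ x ∈ X.window T, f x) P := by
  refine aestronglyMeasurable_of_tendsto_ae atTop
    (f := fun n X => ∑ x ∈ X.window T, truncCompact T f n x) (fun n => ?_)
    (Eventually.of_forall fun X => ?_)
  · have h1 : ∀ x, ‖truncCompact T f n x‖ ≤ C := fun x =>
      (norm_indicator_le_norm_self _ _).trans (hC x)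
    have := (hP.prod (measurable_truncCompact T f hf n) h1
      (hasCompactSupport_truncCompact T f n) 1).1.aestronglyMeasurable
    refine this.congr (Eventually.of_forall fun X => ?_)
    exact distinctSum_one (fun x hx => truncCompact_of_lt T f n hx) X
  · refine tendsto_const_nhds.congr' ?_
    filter_upwards [eventually_forall_window T f X] with n hn
    exact sum_congr rfl fun x hx => (hn x hx).symm

theorem IsDeterminantal.aestronglyMeasurable_sum_real (hP : IsDeterminantal μ K P) {f : E → ℝ}
    (hf : Measurable f) {C : ℝ} (hC : ∀ x, |f x| ≤ C) (T : ℝ) :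
    AEStronglyMeasurable (fun X => ∑ x ∈ X.window T, f x) P := by
  have := (hP.aestronglyMeasurable_sum (f := fun x => (f x : ℂ))
    (Complex.measurable_ofReal.comp hf) (C := C) (fun x => by simpa using hC x) T)
  have h2 := Complex.continuous_re.comp_aestronglyMeasurable this
  refine h2.congr (Eventually.of_forall fun X => ?_)
  simp

variable [SigmaFinite μ] {ι : Type} [Countable ι] {φ : ι → E → ℂ}

/-- A window need not be compact in an open `E`, whereas the correlation identity requires compact
support. Cut `f` to a compact exhaustion, then use Fatou on the left and dominated convergence on
the right. -/
theorem IsDeterminantal.lintegral_exp_sum_le (hP : IsDeterminantal μ K P)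
    (H : IsBesselExpansion μ φ K)
    (hκ : ∀ T : ℝ, IntegrableOn (fun x => ∑' i, ‖φ i x‖ ^ 2) {x : E | |(x : ℝ)| ≤ T} μ)
    {f : E → ℝ} (hf : Measurable f) {M : ℝ} (hM : ∀ x, |f x| ≤ M) (T : ℝ) :
    ∫⁻ X, ENNReal.ofReal (Real.exp (∑ x ∈ X.window T, f x)) ∂P ≤
      ENNReal.ofReal (Real.exp
        (∫ x in {x : E | |(x : ℝ)| ≤ T}, (Real.exp (f x) - 1) * ∑' i, ‖φ i x‖ ^ 2 ∂μ)) := by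
  set h : E → ℝ := fun x => Real.exp (f x) - 1 with hdef
  have hm : Measurable h := hf.exp.sub_const 1
  have h0 : ∀ x, -1 ≤ h x := fun x => by linarith [Real.exp_pos (f x)]
  obtain ⟨C, hC⟩ : ∃ C, ∀ x, |h x| ≤ C := ⟨Real.exp M + 1, fun x => by
    have h1 := Real.exp_le_exp.2 ((le_abs_self _).trans (hM x))
    have h2 := Real.exp_pos (f x)
    rw [abs_le]
    constructor <;> linarith⟩
  -- Off the cut set both truncations vanish, in agreement with `1 + 0 = exp 0`.
  have hexp : ∀ (X : Conf E) (n : ℕ), ∏ x ∈ X.window T, (1 + truncCompact T h n x) =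
      Real.exp (∑ x ∈ X.window T, truncCompact T f n x) := fun X n => by
    rw [Real.exp_sum]
    refine prod_congr rfl fun x _ => ?_
    by_cases hx : x ∈ compactCovering E n ∩ {x : E | |(x : ℝ)| ≤ T}
    · simp [truncCompact, Set.indicator_of_mem hx, hdef]
    · simp [truncCompact, Set.indicator_of_notMem hx]
  set κ : E → ℝ := fun x => ∑' i, ‖φ i x‖ ^ 2
  set B : Set E := {x : E | |(x : ℝ)| ≤ T}
  have hB : MeasurableSet B := measurableSet_window T
  have hκ0 : ∀ x, 0 ≤ κ x := fun x => tsum_nonneg fun i => sq_nonneg _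
  have hdom : Integrable (fun x => C * B.indicator κ x) μ :=
    ((integrable_indicator_iff hB).2 (hκ T)).const_mul C
  have hC0 : ∀ x : E, 0 ≤ C := fun x => (abs_nonneg _).trans (hC x)
  have hle : ∀ n x, |truncCompact T h n x| * κ x ≤ C * B.indicator κ x := fun n x => by
    by_cases hx : x ∈ compactCovering E n ∩ B
    · rw [truncCompact, Set.indicator_of_mem hx, Set.indicator_of_mem hx.2]
      exact mul_le_mul_of_nonneg_right (hC x) (hκ0 x)
    · rw [truncCompact, Set.indicator_of_notMem hx]
      simpa using mul_nonneg (hC0 x) (Set.indicator_nonneg (fun x _ => hκ0 x) x)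
  have hκm : AEStronglyMeasurable κ μ := by
    refine aestronglyMeasurable_of_tendsto_ae (u := atTop)
      (f := fun (s : Finset ι) x => ∑ i ∈ s, ‖φ i x‖ ^ 2) (fun s => ?_) ?_
    · exact Finset.aestronglyMeasurable_fun_sum s fun i _ =>
        (H.memLp i).aestronglyMeasurable.norm.pow 2
    · filter_upwards [H.diag] with x hx using hx.1.hasSum
  have hmn := measurable_truncCompact T h hm
  have hintn : ∀ n, Integrable (fun x => |truncCompact T h n x| * κ x) μ := fun n =>
    hdom.mono' ((hmn n).norm.aestronglyMeasurable.mul hκm) (Eventually.of_forall fun x => by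
      rw [Real.norm_of_nonneg (mul_nonneg (abs_nonneg _) (hκ0 x))]; exact hle n x)
  have hn : ∀ n, ∫⁻ X, ENNReal.ofReal (∏ x ∈ X.window T, (1 + truncCompact T h n x)) ∂P ≤
      ENNReal.ofReal (Real.exp (∫ x, truncCompact T h n x * κ x ∂μ)) := fun n =>
    hP.lintegral_prod_le H (hmn n) (C := C)
      (fun x => le_trans (norm_indicator_le_norm_self h x) (hC x))
      (hasCompactSupport_truncCompact T h n) (fun x hx => truncCompact_of_lt T h n hx)
      (fun x => by
        by_cases hx : x ∈ compactCovering E n ∩ B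
        · rw [truncCompact, Set.indicator_of_mem hx]; exact h0 x
        · rw [truncCompact, Set.indicator_of_notMem hx]; norm_num) (hintn n)
  have hlim : Tendsto (fun n => ∫ x, truncCompact T h n x * κ x ∂μ) atTop
      (𝓝 (∫ x in B, h x * κ x ∂μ)) := by
    rw [← integral_indicator hB]
    refine tendsto_integral_of_dominated_convergence _
      (fun n => (hmn n).aestronglyMeasurable.mul hκm) hdom
      (fun n => Eventually.of_forall fun x => ?_) (Eventually.of_forall fun x => ?_)
    · rw [norm_mul, Real.norm_of_nonneg (hκ0 x)]; exact hle n x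
    · refine tendsto_const_nhds.congr' ?_
      by_cases hx : x ∈ B
      · filter_upwards [eventually_truncCompact_eq T h hx] with n hn
        rw [hn, Set.indicator_of_mem hx]
      · refine Eventually.of_forall fun n => ?_
        simp only
        rw [Set.indicator_of_notMem hx, truncCompact_of_lt T h n (not_le.1 hx), zero_mul]
  have hlim2 := ENNReal.tendsto_ofReal ((Real.continuous_exp.tendsto _).comp hlim)
  simp_rw [hexp] at hn
  calc ∫⁻ X, ENNReal.ofReal (Real.exp (∑ x ∈ X.window T, f x)) ∂P
      = ∫⁻ X, liminf (fun n => ENNReal.ofReal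
          (Real.exp (∑ x ∈ X.window T, truncCompact T f n x))) atTop ∂P := by
        refine lintegral_congr fun X => ?_
        refine (Tendsto.liminf_eq (tendsto_const_nhds.congr' ?_)).symm
        filter_upwards [eventually_forall_window T f X] with n hn
        rw [sum_congr rfl hn]
    _ ≤ liminf (fun n => ∫⁻ X, ENNReal.ofReal
          (Real.exp (∑ x ∈ X.window T, truncCompact T f n x)) ∂P) atTop := by
        refine lintegral_liminf_le' fun n => ?_
        exact (hP.aestronglyMeasurable_sum_real (measurable_truncCompact T f hf n) (C := M)
          (fun x => le_trans (norm_indicator_le_norm_self f x) (hM x)) T).aemeasurable.exp.ennreal_ofReal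
    _ ≤ liminf (fun n => ENNReal.ofReal (Real.exp (∫ x, truncCompact T h n x * κ x ∂μ))) atTop :=
        liminf_le_liminf (Eventually.of_forall hn)
    _ = _ := hlim2.liminf_eq

end Windows
end RegProd

namespace RegProd

/-! ### First-order expansion of the logarithms at infinity. -/

section Logarithms

open Complex

theorem one_add_sq_le {R : ℝ} (hR : 0 < R) (x : ℝ) :
    1 + x ^ 2 ≤ (1 + 1 / R ^ 2) * (x ^ 2 + R ^ 2) := by
  have h : (1 + 1 / R ^ 2) * (x ^ 2 + R ^ 2) = x ^ 2 + R ^ 2 + x ^ 2 / R ^ 2 + 1 := by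
    field_simp
    ring
  rw [h]
  have := div_nonneg (sq_nonneg x) (sq_nonneg R)
  nlinarith [sq_nonneg R]

theorem inv_sq_add_sq_le {R : ℝ} (hR : 0 < R) (x : ℝ) :
    1 / (x ^ 2 + R ^ 2) ≤ (1 + 1 / R ^ 2) / (1 + x ^ 2) := by
  rw [div_le_div_iff₀ (by positivity) (by positivity), one_mul]
  exact one_add_sq_le hR x

theorem norm_sq_add_mul_I (x R : ℝ) : ‖(x : ℂ) + I * R‖ ^ 2 = x ^ 2 + R ^ 2 := by
  rw [← normSq_eq_norm_sq, mul_comm, normSq_add_mul_I]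

theorem norm_sq_sub_mul_I (x R : ℝ) : ‖(x : ℂ) - I * R‖ ^ 2 = x ^ 2 + R ^ 2 := by
  have := norm_sq_add_mul_I x (-R)
  rw [ofReal_neg, mul_neg, ← sub_eq_add_neg, neg_sq] at this
  exact this

theorem add_mul_I_ne_zero {R : ℝ} (hR : 0 < R) (x : ℝ) : (x : ℂ) + I * R ≠ 0 := fun h => by
  have := norm_sq_add_mul_I x R
  rw [h, norm_zero] at this
  nlinarith [sq_nonneg x]

theorem sub_mul_I_ne_zero {R : ℝ} (hR : 0 < R) (x : ℝ) : (x : ℂ) - I * R ≠ 0 := fun h => by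
  have := norm_sq_sub_mul_I x R
  rw [h, norm_zero] at this
  nlinarith [sq_nonneg x]

theorem abs_im_le_norm_sub (u : ℂ) (x : ℝ) : |u.im| ≤ ‖(x : ℂ) - u‖ := by
  have := abs_im_le_norm ((x : ℂ) - u)
  simpa using this

theorem ofReal_sub_ne_zero {u : ℂ} (hu : u.im ≠ 0) (x : ℝ) : (x : ℂ) - u ≠ 0 := fun h => by
  have := abs_im_le_norm_sub u x
  rw [h, norm_zero] at this
  exact hu (abs_nonpos_iff.1 this)

/-- For `‖p‖ ≥ 2D` use the quadratic Taylor remainder of the logarithm. Otherwise `x` is bounded and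
so is the logarithm, as `‖p + w‖ ≥ ε` keeps its argument away from zero. A general `p` covers both
`x + iR` and `x - iR`. -/
theorem exists_norm_log_sub_le {R D ε : ℝ} (hR : 0 < R) (hD : 0 < D) (hε : 0 < ε) :
    ∃ M : ℝ, 0 ≤ M ∧ ∀ (x : ℝ) (p w : ℂ), ‖p‖ ^ 2 = x ^ 2 + R ^ 2 → ‖w‖ ≤ D → ε ≤ ‖p + w‖ →
      ‖log (1 + w / p) - w / p‖ ≤ M / (1 + x ^ 2) := by
  set c : ℝ := 1 + 1 / R ^ 2 with hc
  have hc0 : 0 < c := by positivity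
  -- In order: the upper and lower bounds of `log ‖1 + w/p‖`, the argument, and the subtracted term
  -- `w/p`.
  set M1 : ℝ := 1 + D / R + 2 * D / ε + Real.pi + D / R
  have hM1 : 0 < M1 := by positivity
  refine ⟨D ^ 2 * c + M1 * (c * (2 * D) ^ 2), by positivity, fun x p w hp hw hpw => ?_⟩
  have hx : 0 < 1 + x ^ 2 := by positivity
  have hpp : R ≤ ‖p‖ := by
    refine (sq_le_sq₀ hR.le (norm_nonneg _)).1 ?_
    rw [hp]; nlinarith [sq_nonneg x]
  have hp0 : 0 < ‖p‖ := hR.trans_le hpp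
  have hpne : p ≠ 0 := norm_pos_iff.1 hp0
  have hxp : 1 + x ^ 2 ≤ c * ‖p‖ ^ 2 := by rw [hp]; exact one_add_sq_le hR x
  rw [le_div_iff₀ hx]
  rcases le_total (2 * D) ‖p‖ with h | h
  · have hz : ‖w / p‖ ≤ D / ‖p‖ := by
      rw [norm_div]; gcongr
    have hz2 : ‖w / p‖ ≤ 1 / 2 := hz.trans (by rw [div_le_div_iff₀ hp0 two_pos]; linarith)
    have h1 : ‖log (1 + w / p) - w / p‖ ≤ (D / ‖p‖) ^ 2 := by
      refine (norm_log_one_add_sub_self_le (by linarith)).trans ?_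
      have : (1 - ‖w / p‖)⁻¹ ≤ 2 := by
        rw [inv_le_comm₀ (by linarith) two_pos]; linarith
      calc ‖w / p‖ ^ 2 * (1 - ‖w / p‖)⁻¹ / 2 ≤ ‖w / p‖ ^ 2 * 2 / 2 := by gcongr
        _ = ‖w / p‖ ^ 2 := by ring
        _ ≤ _ := by gcongr
    calc _ ≤ (D / ‖p‖) ^ 2 * (c * ‖p‖ ^ 2) := mul_le_mul h1 hxp hx.le (by positivity)
      _ = D ^ 2 * c := by field_simp
      _ ≤ _ := by linarith [mul_pos hM1 (by positivity : 0 < c * (2 * D) ^ 2)]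
  · have hq : 1 + w / p = (p + w) / p := by field_simp
    have hz : ‖w / p‖ ≤ D / R := by rw [norm_div]; gcongr
    have hq1 : ‖1 + w / p‖ ≤ 1 + D / R := (norm_add_le _ _).trans (by rw [norm_one]; linarith)
    have hq2 : ε / (2 * D) ≤ ‖1 + w / p‖ := by rw [hq, norm_div]; gcongr
    have hq0 : 0 < ‖1 + w / p‖ := (by positivity : 0 < ε / (2 * D)).trans_le hq2
    have hl1 : Real.log ‖1 + w / p‖ ≤ 1 + D / R := by
      linarith [Real.log_le_sub_one_of_pos hq0]
    have hl2 : -Real.log ‖1 + w / p‖ ≤ 2 * D / ε := by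
      rw [← Real.log_inv]
      have h1 := Real.log_le_sub_one_of_pos (inv_pos.2 hq0)
      have h2 : ‖1 + w / p‖⁻¹ ≤ 2 * D / ε := by
        rw [inv_le_comm₀ hq0 (by positivity), inv_div]; exact hq2
      linarith
    have hlog : ‖log (1 + w / p)‖ ≤ 1 + D / R + 2 * D / ε + Real.pi := by
      refine (norm_le_abs_re_add_abs_im _).trans ?_
      rw [log_re, log_im]
      have h1 := abs_arg_le_pi (1 + w / p)
      have h2 : |Real.log ‖1 + w / p‖| ≤ 1 + D / R + 2 * D / ε := by
        have : 0 ≤ D / R := by positivity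
        have : 0 ≤ 2 * D / ε := by positivity
        rw [abs_le]; constructor <;> linarith
      linarith
    have h1 : ‖log (1 + w / p) - w / p‖ ≤ M1 := (norm_sub_le _ _).trans (by linarith)
    calc _ ≤ M1 * (c * (2 * D) ^ 2) := by
          refine mul_le_mul h1 (hxp.trans ?_) hx.le hM1.le
          gcongr
      _ ≤ _ := by linarith [(by positivity : 0 < D ^ 2 * c)]

theorem g_eq_one_add (R : ℝ) (u : ℂ) (x : ℝ) :
    g R (u + I * R) x = 1 + (-(u + I * R)) / (x + I * R) := by
  rw [g, neg_div, sub_eq_add_neg]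

theorem g_eq_div {R : ℝ} (hR : 0 < R) (u : ℂ) (x : ℝ) :
    g R (u + I * R) x = (x - u) / (x + I * R) := by
  have := add_mul_I_ne_zero hR x
  rw [g]
  field_simp
  ring

theorem g_ne_zero {R : ℝ} (hR : 0 < R) {u : ℂ} (hu : u.im ≠ 0) (x : ℝ) : g R (u + I * R) x ≠ 0 := by
  rw [g_eq_div hR]
  exact div_ne_zero (ofReal_sub_ne_zero hu x) (add_mul_I_ne_zero hR x)

theorem exp_principalLog {R : ℝ} (hR : 0 < R) {u : ℂ} (hu : u.im ≠ 0) (x : ℝ) :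
    exp (principalLog R u x) = g R (u + I * R) x := exp_log (g_ne_zero hR hu x)

theorem exp_holomorphicLog {R : ℝ} (hR : 0 < R) {u : ℂ} (hu : u.im ≠ 0) (x : ℝ) :
    exp (holomorphicLog R u x) = g R (u + I * R) x := by
  rw [holomorphicLog]
  split_ifs with h
  · exact exp_log (g_ne_zero hR hu x)
  · have h1 := ofReal_sub_ne_zero hu x
    have h2 := add_mul_I_ne_zero hR x
    have h3 := sub_mul_I_ne_zero hR x
    rw [exp_add, exp_log (div_ne_zero h1 h3), exp_log (div_ne_zero h3 h2), g_eq_div hR]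
    field_simp

theorem measurable_principalLog (R : ℝ) (u : ℂ) : Measurable (principalLog R u) := by
  unfold principalLog g
  fun_prop

theorem measurable_holomorphicLog (R : ℝ) (u : ℂ) : Measurable (holomorphicLog R u) := by
  unfold holomorphicLog g
  split_ifs <;> fun_prop

/-- A determination of the logarithm whose first-order expansion at infinity has a remainder of
order `1 / (1 + x²)`, locally uniformly in `u`. -/
structure IsLogDetermination (R : ℝ) (L : ℂ → ℝ → ℂ) : Prop where
  exp_eq : ∀ u : ℂ, u.im ≠ 0 → ∀ x : ℝ, exp (L u x) = g R (u + I * R) x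
  measurable : ∀ u, Measurable (L u)
  bound : ∀ D ε : ℝ, 0 < D → 0 < ε → ∃ M : ℝ, 0 ≤ M ∧ ∀ u : ℂ, ‖u‖ ≤ D → ε ≤ |u.im| → ∀ x : ℝ,
    ‖L u x + (u + I * R) / (x + I * R)‖ ≤ M / (1 + x ^ 2)

theorem isLogDetermination_principalLog {R : ℝ} (hR : 0 < R) :
    IsLogDetermination R (principalLog R) where
  exp_eq _ hu x := exp_principalLog hR hu x
  measurable := measurable_principalLog R
  bound D ε hD hε := by
    obtain ⟨M, hM, h⟩ := exists_norm_log_sub_le hR (add_pos hD hR) hε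
    refine ⟨M, hM, fun u hu hu' x => ?_⟩
    have := h x (x + I * R) (-(u + I * R)) (norm_sq_add_mul_I x R) ?_ ?_
    · rw [principalLog, g_eq_one_add]
      convert this using 2
      ring
    · rw [norm_neg]
      refine (norm_add_le _ _).trans (add_le_add hu (le_of_eq ?_))
      simp [abs_of_pos hR]
    · have e : (x : ℂ) + I * R + -(u + I * R) = x - u := by ring
      rw [e]
      exact hu'.trans (abs_im_le_norm_sub u x)

/-- In the upper half-plane write the two quotients as `1+A` and `1+B`. From `(1+A)(1+B) = g` one
gets `(u+iR)/(x+iR) = -A-B-AB`, so the remainder is that of the two logarithms minus `AB`, which is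
`O(1/(1+x²))`. -/
theorem isLogDetermination_holomorphicLog {R : ℝ} (hR : 0 < R) :
    IsLogDetermination R (holomorphicLog R) where
  exp_eq _ hu x := exp_holomorphicLog hR hu x
  measurable := measurable_holomorphicLog R
  bound D ε hD hε := by
    obtain ⟨M0, hM0, h0⟩ := (isLogDetermination_principalLog hR).bound D ε hD hε
    obtain ⟨M1, hM1, h1⟩ := exists_norm_log_sub_le hR (add_pos hD hR) hε
    obtain ⟨M2, hM2, h2⟩ := exists_norm_log_sub_le hR (by positivity : 0 < 2 * R) hR
    set c : ℝ := 1 + 1 / R ^ 2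
    refine ⟨M0 + (M1 + M2 + (D + R) * (2 * R) * c), by positivity, fun u hu hu' x => ?_⟩
    have hx : 0 < 1 + x ^ 2 := by positivity
    by_cases him : u.im < 0
    · have := h0 u hu hu' x
      rw [principalLog] at this
      rw [holomorphicLog, if_pos him]
      refine this.trans ?_
      gcongr
      linarith [(by positivity : 0 ≤ M1 + M2 + (D + R) * (2 * R) * c)]
    · have hp := add_mul_I_ne_zero hR x
      have hm := sub_mul_I_ne_zero hR x
      have hIR : ‖I * (R : ℂ)‖ = R := by simp [abs_of_pos hR]
      have hw1 : ‖I * R - u‖ ≤ D + R := (norm_sub_le _ _).trans (by rw [hIR]; linarith)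
      have hw2 : ‖-(2 * (I * R))‖ = 2 * R := by rw [norm_neg, norm_mul, hIR]; simp
      have b1 := h1 x (x - I * R) (I * R - u) (norm_sq_sub_mul_I x R) hw1 (by
        have e : (x : ℂ) - I * R + (I * R - u) = x - u := by ring
        rw [e]; exact hu'.trans (abs_im_le_norm_sub u x))
      have b2 := h2 x (x + I * R) (-(2 * (I * R))) (norm_sq_add_mul_I x R) hw2.le (by
        have e : (x : ℂ) + I * R + -(2 * (I * R)) = x - I * R := by ring
        rw [e]
        refine (sq_le_sq₀ hR.le (norm_nonneg _)).1 ?_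
        rw [norm_sq_sub_mul_I]; nlinarith [sq_nonneg x])
      have b3 : ‖(I * R - u) / (x - I * R) * (-(2 * (I * R)) / (x + I * R))‖ ≤
          (D + R) * (2 * R) * c / (1 + x ^ 2) := by
        rw [div_mul_div_comm, norm_div, norm_mul, norm_mul, hw2]
        have e : ‖(x : ℂ) - I * R‖ * ‖(x : ℂ) + I * R‖ = x ^ 2 + R ^ 2 := by
          refine (pow_left_inj₀ (by positivity) (by positivity) two_ne_zero).1 ?_
          rw [mul_pow, norm_sq_sub_mul_I, norm_sq_add_mul_I]; ring
        rw [e, div_eq_mul_one_div, mul_div_assoc]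
        exact mul_le_mul (mul_le_mul_of_nonneg_right hw1 (by positivity)) (inv_sq_add_sq_le hR x)
          (by positivity) (by positivity)
      rw [holomorphicLog, if_neg him]
      have e1 : ((x : ℂ) - u) / (x - I * R) = 1 + (I * R - u) / (x - I * R) := by
        field_simp; ring
      have e2 : ((x : ℂ) - I * R) / (x + I * R) = 1 + -(2 * (I * R)) / (x + I * R) := by
        field_simp; ring
      have e3 : (u + I * R) / (x + I * R) = -((I * R - u) / (x - I * R)) -
          -(2 * (I * R)) / (x + I * R) -
          (I * R - u) / (x - I * R) * (-(2 * (I * R)) / (x + I * R)) := by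
        field_simp; ring
      rw [e1, e2, e3]
      set A := (I * R - u) / (x - I * R)
      set B := -(2 * (I * R)) / ((x : ℂ) + I * R)
      have e4 : log (1 + A) + log (1 + B) + (-A - B - A * B) =
          (log (1 + A) - A) + (log (1 + B) - B) - A * B := by ring
      rw [e4]
      calc _ ≤ M1 / (1 + x ^ 2) + M2 / (1 + x ^ 2) + (D + R) * (2 * R) * c / (1 + x ^ 2) :=
            (norm_sub_le _ _).trans (add_le_add ((norm_add_le _ _).trans (add_le_add b1 b2)) b3)
        _ = (M1 + M2 + (D + R) * (2 * R) * c) / (1 + x ^ 2) := by ring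
        _ ≤ _ := div_le_div_of_nonneg_right (by linarith) hx.le

/-- A ratio that is real and nonpositive would give `a` and `b` imaginary parts of opposite signs,
or a zero one. This is why the denominator is `x + iR` below the real line and `x - iR` above it. -/
theorem div_mem_slitPlane {a b : ℂ} (h : 0 < a.im * b.im) : a / b ∈ slitPlane := by
  rw [mem_slitPlane_iff]
  by_contra! hc
  have hb : b ≠ 0 := by rintro rfl; simp at h
  have h1 : a = ((a / b).re : ℂ) * b := by
    have : ((a / b).re : ℂ) = a / b := Complex.ext (by simp) (by simp [hc.2])
    rw [this, div_mul_cancel₀ _ hb]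
  have h2 : a.im = (a / b).re * b.im := by
    conv_lhs => rw [h1]
    simp
  rw [h2] at h
  nlinarith [sq_nonneg b.im, hc.1]

theorem hasDerivAt_holomorphicLog {R : ℝ} (hR : 0 < R) {u : ℂ} (hu : u.im ≠ 0) (x : ℝ) :
    HasDerivAt (fun u => holomorphicLog R u x) (-1 / (x - u)) u := by
  have hp := add_mul_I_ne_zero hR x
  have hm := sub_mul_I_ne_zero hR x
  have hxu := ofReal_sub_ne_zero hu x
  rcases lt_or_gt_of_ne hu with h | h
  · have he : (fun u => holomorphicLog R u x) =ᶠ[𝓝 u] fun u => log ((x - u) / (x + I * R)) := by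
      filter_upwards [(isOpen_lt continuous_im continuous_const).mem_nhds h] with v hv
      rw [holomorphicLog, if_pos hv, g_eq_div hR]
    refine HasDerivAt.congr_of_eventuallyEq ?_ he
    have h1 : HasDerivAt (fun u : ℂ => (x - u) / (x + I * R)) (-1 / (x + I * R)) u :=
      ((hasDerivAt_id u).const_sub _).div_const _
    have hs : ((x : ℂ) - u) / (x + I * R) ∈ slitPlane := div_mem_slitPlane (by
      simp; nlinarith)
    have e : -1 / ((x : ℂ) - u) = -1 / (x + I * R) / ((x - u) / (x + I * R)) := by field_simp
    rw [e]
    exact h1.clog hs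
  · have he : (fun u => holomorphicLog R u x) =ᶠ[𝓝 u] fun u => log ((x - u) / (x - I * R)) +
        log ((x - I * R) / (x + I * R)) := by
      filter_upwards [(isOpen_lt continuous_const continuous_im).mem_nhds h] with v hv
      rw [holomorphicLog, if_neg (not_lt.2 (le_of_lt hv))]
    refine HasDerivAt.congr_of_eventuallyEq ?_ he
    have h1 : HasDerivAt (fun u : ℂ => (x - u) / (x - I * R)) (-1 / (x - I * R)) u :=
      ((hasDerivAt_id u).const_sub _).div_const _
    refine HasDerivAt.add_const _ ?_
    have hs : ((x : ℂ) - u) / (x - I * R) ∈ slitPlane := div_mem_slitPlane (by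
      simp; nlinarith)
    have e : -1 / ((x : ℂ) - u) = -1 / (x - I * R) / ((x - u) / (x - I * R)) := by field_simp
    rw [e]
    exact h1.clog hs

/-- `1 + x²` is controlled by `|x - u|²` away from the real line. -/
theorem one_add_sq_le_norm_sub {D ε : ℝ} (hD : 0 < D) (hε : 0 < ε) {u : ℂ} (hu : ‖u‖ ≤ D)
    (hu' : ε ≤ |u.im|) (x : ℝ) : 1 + x ^ 2 ≤ ((1 + 1 / ε + D / ε) * ‖(x : ℂ) - u‖) ^ 2 := by
  have h1 : ε ≤ ‖(x : ℂ) - u‖ := hu'.trans (abs_im_le_norm_sub u x)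
  have h2 : |x| ≤ ‖(x : ℂ) - u‖ + D := by
    have := norm_add_le ((x : ℂ) - u) u
    rw [sub_add_cancel, norm_real, Real.norm_eq_abs] at this
    linarith
  have h3 : 1 + |x| ≤ (1 + 1 / ε + D / ε) * ‖(x : ℂ) - u‖ := by
    have h4 : 1 + D ≤ (1 + D) * (‖(x : ℂ) - u‖ / ε) :=
      le_mul_of_one_le_right (by positivity) ((one_le_div hε).2 h1)
    calc 1 + |x| ≤ (1 + D) * (‖(x : ℂ) - u‖ / ε) + ‖(x : ℂ) - u‖ := by linarith
      _ = _ := by ring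
  calc 1 + x ^ 2 ≤ (1 + |x|) ^ 2 := by nlinarith [abs_nonneg x, sq_abs x]
    _ ≤ _ := pow_le_pow_left₀ (by positivity) h3 2

/-- The two fractions combine to `-(u+iR)/((x-u)(x+iR))`, and each factor of the denominator is at
least a constant times `√(1+x²)`. -/
theorem exists_norm_deriv_le {R D ε : ℝ} (hR : 0 < R) (hD : 0 < D) (hε : 0 < ε) :
    ∃ M : ℝ, 0 ≤ M ∧ ∀ u : ℂ, ‖u‖ ≤ D → ε ≤ |u.im| → ∀ x : ℝ,
      ‖-1 / ((x : ℂ) - u) + 1 / (x + I * R)‖ ≤ M / (1 + x ^ 2) := by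
  set c : ℝ := 1 + 1 / R ^ 2
  set k : ℝ := 1 + 1 / ε + D / ε
  refine ⟨(D + R) * k * c, by positivity, fun u hu hu' x => ?_⟩
  have hp := add_mul_I_ne_zero hR x
  have him : u.im ≠ 0 := by
    intro h; rw [h, abs_zero] at hu'; linarith
  have hxu := ofReal_sub_ne_zero him x
  have hx : 0 < 1 + x ^ 2 := by positivity
  have e : -1 / ((x : ℂ) - u) + 1 / (x + I * R) = -(u + I * R) / ((x - u) * (x + I * R)) := by
    field_simp; ring
  have hn : ‖u + I * R‖ ≤ D + R :=
    (norm_add_le _ _).trans (add_le_add hu (by simp [abs_of_pos hR]))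
  have h1 := one_add_sq_le_norm_sub hD hε hu hu' x
  have h2 : 1 + x ^ 2 ≤ c * ‖(x : ℂ) + I * R‖ ^ 2 := by
    rw [norm_sq_add_mul_I]; exact one_add_sq_le hR x
  have hc1 : 1 ≤ c := by simp only [c]; linarith [(by positivity : 0 ≤ 1 / R ^ 2)]
  have h3 : 1 + x ^ 2 ≤ k * c * (‖(x : ℂ) - u‖ * ‖(x : ℂ) + I * R‖) := by
    refine (sq_le_sq₀ hx.le (by positivity)).1 ?_
    calc (1 + x ^ 2) ^ 2 = (1 + x ^ 2) * (1 + x ^ 2) := by ring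
      _ ≤ (k * ‖(x : ℂ) - u‖) ^ 2 * (c * ‖(x : ℂ) + I * R‖ ^ 2) :=
          mul_le_mul h1 h2 hx.le (by positivity)
      -- Since `c ≥ 1`, replacing `c` by `c²` makes the right side a perfect square.
      _ ≤ (k * ‖(x : ℂ) - u‖) ^ 2 * (c ^ 2 * ‖(x : ℂ) + I * R‖ ^ 2) := by
          gcongr; nlinarith
      _ = _ := by ring
  rw [e, norm_div, norm_neg, norm_mul, div_le_div_iff₀
    (mul_pos (norm_pos_iff.2 hxu) (norm_pos_iff.2 hp)) hx]
  calc ‖u + I * R‖ * (1 + x ^ 2) ≤ (D + R) * (k * c * (‖(x : ℂ) - u‖ * ‖(x : ℂ) + I * R‖)) :=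
        mul_le_mul hn h3 hx.le (by positivity)
    _ = _ := by ring

theorem exists_bounds_of_isCompact {C : Set ℂ} (hC : IsCompact C) (hC' : C ⊆ nonreal) :
    ∃ D ε : ℝ, 0 < D ∧ 0 < ε ∧ ∀ u ∈ C, ‖u‖ ≤ D ∧ ε ≤ |u.im| := by
  obtain ⟨D, hD⟩ := hC.isBounded.exists_norm_le
  rcases C.eq_empty_or_nonempty with rfl | hne
  · exact ⟨1, 1, one_pos, one_pos, by simp⟩
  · obtain ⟨v, hv, hmin⟩ := hC.exists_isMinOn hne (continuous_im.abs.continuousOn)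
    exact ⟨max D 1, |v.im|, by positivity, abs_pos.2 (hC' hv), fun u hu =>
      ⟨(hD u hu).trans (le_max_left _ _), hmin hu⟩⟩

end Logarithms
end RegProd

/-! ### Moment bounds for sub-Poisson processes. -/

namespace RegProd

open scoped ENNReal

variable {E : Set ℝ}

/-- A point process with first intensity `κ` whose window sums are measurable and have exponential
moments dominated by those of the Poisson process of the same intensity, the latter being
integrable against `1 / (1 + x²)`. -/
structure IsSubPoisson (μ : Measure E) (κ : E → ℝ) (P : Measure (Conf E)) : Prop where
  measurable : Measurable κ
  nonneg : ∀ x, 0 ≤ κ x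
  integrable : Integrable (fun x : E => κ x / (1 + (x : ℝ) ^ 2)) μ
  aestronglyMeasurable_sum : ∀ {f : E → ℂ}, Measurable f → ∀ {C : ℝ}, (∀ x, ‖f x‖ ≤ C) → ∀ T : ℝ,
    AEStronglyMeasurable (fun X : Conf E => ∑ x ∈ X.window T, f x) P
  lintegral_exp_sum_le : ∀ {f : E → ℝ}, Measurable f → ∀ {M : ℝ}, (∀ x, |f x| ≤ M) → ∀ T : ℝ,
    ∫⁻ X : Conf E, ENNReal.ofReal (Real.exp (∑ x ∈ X.window T, f x)) ∂P ≤
      ENNReal.ofReal (Real.exp (∫ x in {x : E | |(x : ℝ)| ≤ T}, (Real.exp (f x) - 1) * κ x ∂μ))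

/-- The window sum of `F` minus its expectation. -/
noncomputable def centeredSum (μ : Measure E) (κ : E → ℝ) (F : E → ℂ) (T : ℝ) (X : Conf E) : ℂ :=
  ∑ x ∈ X.window T, F x - ∫ x in {x : E | |(x : ℝ)| ≤ T}, F x * κ x ∂μ

namespace IsSubPoisson

variable {μ : Measure E} {κ : E → ℝ} {P : Measure (Conf E)} (h : IsSubPoisson μ κ P)
include h

theorem integrable_mul {𝕜 : Type*} [RCLike 𝕜] {F : E → 𝕜} (hF : Measurable F) {M : ℝ}
    (hM : ∀ x : E, ‖F x‖ ≤ M / (1 + (x : ℝ) ^ 2)) : Integrable (fun x => F x * (κ x : 𝕜)) μ := by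
  refine (h.integrable.const_mul M).mono' ?_ (Eventually.of_forall fun x => ?_)
  · exact (hF.mul (RCLike.measurable_ofReal.comp h.measurable)).aestronglyMeasurable
  · rw [norm_mul, RCLike.norm_ofReal, abs_of_nonneg (h.nonneg x), ← mul_div_assoc, mul_div_right_comm]
    exact mul_le_mul_of_nonneg_right (hM x) (h.nonneg x)

theorem norm_setIntegral_le {F : E → ℂ} {M : ℝ}
    (hM : ∀ x : E, ‖F x‖ ≤ M / (1 + (x : ℝ) ^ 2)) (s : Set E) :
    ‖∫ x in s, F x * κ x ∂μ‖ ≤ M * ∫ x in s, κ x / (1 + (x : ℝ) ^ 2) ∂μ := by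
  rw [← integral_const_mul]
  refine norm_integral_le_of_norm_le (h.integrable.restrict.const_mul M)
    (Eventually.of_forall fun x => ?_)
  rw [norm_mul, Complex.norm_real, Real.norm_of_nonneg (h.nonneg x), ← mul_div_assoc,
    mul_div_right_comm]
  exact mul_le_mul_of_nonneg_right (hM x) (h.nonneg x)

theorem integrableOn_window (T : ℝ) : IntegrableOn κ {x : E | |(x : ℝ)| ≤ T} μ := by
  refine (h.integrable.restrict.const_mul (1 + T ^ 2)).mono' h.measurable.aestronglyMeasurable ?_
  filter_upwards [ae_restrict_mem (measurableSet_window T)] with x hx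
  have : (x : ℝ) ^ 2 ≤ T ^ 2 := sq_le_sq' (abs_le.1 hx).1 (abs_le.1 hx).2
  rw [Real.norm_of_nonneg (h.nonneg x), ← mul_div_assoc, le_div_iff₀ (by positivity), mul_comm]
  exact mul_le_mul_of_nonneg_right (by linarith) (h.nonneg x)

theorem integrableOn_window_mul {𝕜 : Type*} [RCLike 𝕜] {F : E → 𝕜} (hF : Measurable F) {C : ℝ}
    (hC : ∀ x, ‖F x‖ ≤ C) (T : ℝ) :
    IntegrableOn (fun x => F x * (κ x : 𝕜)) {x : E | |(x : ℝ)| ≤ T} μ :=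
  (h.integrableOn_window T).ofReal.bdd_mul hF.aestronglyMeasurable (Eventually.of_forall hC)

theorem tendsto_tail :
    Tendsto (fun T : ℝ => ∫ x in {x : E | T < |(x : ℝ)|}, κ x / (1 + (x : ℝ) ^ 2) ∂μ)
      atTop (𝓝 0) := by
  have := tendsto_setIntegral_of_antitone (μ := μ) (ι := ℝ)
    (s := fun T => {x : E | T < |(x : ℝ)|})
    (f := fun x => κ x / (1 + (x : ℝ) ^ 2))
    (fun T => measurableSet_lt measurable_const (by fun_prop))
    (fun S T hST x (hx : T < _) => lt_of_le_of_lt hST hx) ⟨0, h.integrable.integrableOn⟩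
  have h0 : ⋂ T : ℝ, {x : E | T < |(x : ℝ)|} = ∅ := by
    ext x
    simp only [Set.mem_iInter, Set.mem_ofPred_eq, Set.mem_empty_iff_false, iff_false, not_forall]
    exact ⟨_, lt_irrefl _⟩
  rwa [h0, Measure.restrict_empty, integral_zero_measure] at this

/-- After subtraction of the expectation of `e`, the exponent contains only `exp f - 1 - e`, which
`q` dominates, so the bound is uniform in the window. Allowing `e ≠ f` lets a logarithm be
compensated by its first-order part alone. -/
theorem lintegral_exp_sub_le {f e q : E → ℝ} (hf : Measurable f) (he : Measurable e) {M M' : ℝ}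
    (hM : ∀ x, |f x| ≤ M) (hM' : ∀ x, |e x| ≤ M') (hq0 : ∀ x, 0 ≤ q x)
    (hq : Integrable (fun x => q x * κ x) μ) (hfe : ∀ x, Real.exp (f x) - 1 - e x ≤ q x) (T : ℝ) :
    ∫⁻ X : Conf E, ENNReal.ofReal (Real.exp
        (∑ x ∈ X.window T, f x - ∫ x in {x : E | |(x : ℝ)| ≤ T}, e x * κ x ∂μ)) ∂P ≤
      ENNReal.ofReal (Real.exp (∫ x, q x * κ x ∂μ)) := by
  simp_rw [sub_eq_add_neg, Real.exp_add, ENNReal.ofReal_mul (Real.exp_pos _).le]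
  rw [lintegral_mul_const' _ _ ENNReal.ofReal_ne_top]
  refine (mul_le_mul_left (h.lintegral_exp_sum_le hf hM T) _).trans ?_
  rw [← ENNReal.ofReal_mul (Real.exp_pos _).le, ← Real.exp_add]
  refine ENNReal.ofReal_le_ofReal (Real.exp_le_exp.2 ?_)
  have h1 : IntegrableOn (fun x => (Real.exp (f x) - 1) * κ x) {x : E | |(x : ℝ)| ≤ T} μ := by
    refine h.integrableOn_window_mul (𝕜 := ℝ) (C := Real.exp M + 1) (by fun_prop) (fun x => ?_) T
    refine (norm_sub_le _ _).trans ?_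
    rw [norm_one, Real.norm_of_nonneg (Real.exp_pos _).le]
    gcongr
    exact (le_abs_self _).trans (hM x)
  have h2 : IntegrableOn (fun x => e x * κ x) {x : E | |(x : ℝ)| ≤ T} μ :=
    h.integrableOn_window_mul (𝕜 := ℝ) he hM' T
  rw [← sub_eq_add_neg, ← integral_sub h1 h2]
  refine (integral_mono (h1.sub h2) hq.restrict fun x => ?_).trans
    (setIntegral_le_integral hq (Eventually.of_forall fun x => mul_nonneg (hq0 x) (h.nonneg x)))
  have := mul_le_mul_of_nonneg_right (hfe x) (h.nonneg x)
  simp only [Pi.sub_apply]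
  linarith

omit h in
-- `2 cosh y = 2 + 4 sinh²(y/2)`, and `sinh z ≥ z` for `z ≥ 0`.
theorem sq_add_two_le_exp_add_exp_neg (y : ℝ) : y ^ 2 + 2 ≤ Real.exp y + Real.exp (-y) := by
  have h0 : ∀ z : ℝ, 0 ≤ z → z ^ 2 + 2 ≤ Real.exp z + Real.exp (-z) := fun z hz => by
    have h1 : z / 2 ≤ Real.sinh (z / 2) := Real.self_le_sinh_iff.2 (by linarith)
    have h2 := Real.cosh_two_mul (z / 2)
    rw [mul_div_cancel₀ _ two_ne_zero, Real.cosh_sq, Real.cosh_eq] at h2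
    nlinarith
  rcases le_total 0 y with hy | hy
  · exact h0 y hy
  · have := h0 (-y) (by linarith)
    rw [neg_neg, neg_sq] at this
    linarith

/-- Integrate the preceding inequality at the centered sum. The constant `2` integrates to `2`
because `P` has mass one, so the bound tends to zero with `∫ qκ`; no variance formula is needed. -/
theorem lintegral_sq_centered_le [IsProbabilityMeasure P] {f q : E → ℝ} (hf : Measurable f) {M : ℝ}
    (hM : ∀ x, |f x| ≤ M) (hq0 : ∀ x, 0 ≤ q x) (hq : Integrable (fun x => q x * κ x) μ)
    (hfe : ∀ x, Real.exp (f x) - 1 - f x ≤ q x) (hfe' : ∀ x, Real.exp (-f x) - 1 + f x ≤ q x)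
    (T : ℝ) :
    ∫⁻ X : Conf E, ENNReal.ofReal
        ((∑ x ∈ X.window T, f x - ∫ x in {x : E | |(x : ℝ)| ≤ T}, f x * κ x ∂μ) ^ 2) ∂P ≤
      ENNReal.ofReal (2 * (Real.exp (∫ x, q x * κ x ∂μ) - 1)) := by
  have h1 := h.lintegral_exp_sub_le hf hf hM hM hq0 hq hfe T
  have h2 := h.lintegral_exp_sub_le hf.neg hf.neg (fun x => (abs_neg (f x)).trans_le (hM x))
    (fun x => (abs_neg (f x)).trans_le (hM x)) hq0 hq
    (fun x => (sub_neg_eq_add _ _).trans_le (hfe' x)) T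
  set A := Real.exp (∫ x, q x * κ x ∂μ) with hA
  have hA1 : 1 ≤ A := Real.one_le_exp (integral_nonneg fun x => mul_nonneg (hq0 x) (h.nonneg x))
  set Y : Conf E → ℝ := fun X =>
    ∑ x ∈ X.window T, f x - ∫ x in {x : E | |(x : ℝ)| ≤ T}, f x * κ x ∂μ with hY
  have hYn : ∀ X : Conf E, ∑ x ∈ X.window T, (-f) x -
      ∫ x in {x : E | |(x : ℝ)| ≤ T}, (-f) x * κ x ∂μ = -Y X := fun X => by
    simp only [Pi.neg_apply, Finset.sum_neg_distrib, neg_mul, integral_neg, hY]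
    ring
  simp_rw [hYn] at h2
  have hm : AEMeasurable Y P := by
    have := (h.aestronglyMeasurable_sum (f := fun x => (f x : ℂ)) (by fun_prop) (C := M)
      (fun x => by rw [Complex.norm_real]; exact hM x) T).aemeasurable
    have h3 : AEMeasurable (fun X : Conf E => ∑ x ∈ X.window T, f x) P := by
      refine (Complex.measurable_re.comp_aemeasurable this).congr (Eventually.of_forall fun X => ?_)
      simp
    exact h3.sub_const _
  have hkey : ∫⁻ X, ENNReal.ofReal (Y X ^ 2) ∂P + 2 ≤ ENNReal.ofReal A + ENNReal.ofReal A := by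
    calc _ = ∫⁻ X, (ENNReal.ofReal (Y X ^ 2) + 2) ∂P := by
          rw [lintegral_add_right _ measurable_const, lintegral_const, measure_univ, mul_one]
      _ ≤ ∫⁻ X, (ENNReal.ofReal (Real.exp (Y X)) + ENNReal.ofReal (Real.exp (-Y X))) ∂P := by
          refine lintegral_mono fun X => ?_
          rw [← ENNReal.ofReal_ofNat 2, ← ENNReal.ofReal_add (sq_nonneg _) zero_le_two,
            ← ENNReal.ofReal_add (Real.exp_pos _).le (Real.exp_pos _).le]
          exact ENNReal.ofReal_le_ofReal (sq_add_two_le_exp_add_exp_neg _)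
      _ ≤ _ := by
          rw [lintegral_add_left' (by fun_prop)]
          exact add_le_add h1 h2
  rw [← ENNReal.ofReal_add (by linarith) (by linarith)] at hkey
  rw [show 2 * (A - 1) = A + A - 2 by ring, ENNReal.ofReal_sub _ zero_le_two, ENNReal.ofReal_ofNat]
  exact ENNReal.le_sub_of_add_le_right (by simp) hkey

end IsSubPoisson

end RegProd

/-! ### Convergence of centered sums in `L²`. -/

namespace RegProd

open scoped ENNReal

theorem exists_eLpNorm_limit {Ω : Type*} [MeasurableSpace Ω] {P : Measure Ω} {X : ℝ → Ω → ℂ}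
    (hX : ∀ T, MemLp (X T) 2 P) {b : ℝ → ℝ≥0∞} (hb : Tendsto b atTop (𝓝 0))
    (hXb : ∀ S T, S ≤ T → eLpNorm (X T - X S) 2 P ≤ b S) :
    ∃ A : Ω → ℂ, StronglyMeasurable A ∧ MemLp A 2 P ∧
      Tendsto (fun T => eLpNorm (X T - A) 2 P) atTop (𝓝 0) := by
  have hle : ∀ S T, S ≤ T → edist ((hX T).toLp) ((hX S).toLp) ≤ b S := fun S T hST => by
    rw [Lp.edist_toLp_toLp]; exact hXb S T hST
  have hc : CauchySeq fun T => (hX T).toLp := by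
    refine EMetric.cauchySeq_iff.2 fun ε hε => ?_
    obtain ⟨N, hN⟩ := eventually_atTop.1 (hb.eventually (gt_mem_nhds hε))
    refine ⟨N, fun m hm n hn => ?_⟩
    rcases le_total m n with hmn | hmn
    · rw [edist_comm]; exact (hle m n hmn).trans_lt (hN m hm)
    · exact (hle n m hmn).trans_lt (hN n hn)
  obtain ⟨A, hA⟩ := cauchySeq_tendsto_of_complete hc
  refine ⟨A, Lp.stronglyMeasurable A, Lp.memLp A, ?_⟩
  have h1 := (tendsto_iff_edist_tendsto_0.1 hA)
  refine h1.congr fun T => ?_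
  rw [Lp.edist_def]
  exact eLpNorm_congr_ae ((hX T).coeFn_toLp.sub EventuallyEq.rfl)

theorem exists_seq_ae_tendsto_of_eLpNorm {Ω : Type*} [MeasurableSpace Ω] {P : Measure Ω}
    {X : ℝ → Ω → ℂ} {A : Ω → ℂ} (hX : ∀ T, AEStronglyMeasurable (X T) P)
    (hA : AEStronglyMeasurable A P)
    (hXA : Tendsto (fun T => eLpNorm (X T - A) 2 P) atTop (𝓝 0)) {t : ℕ → ℝ}
    (ht : Tendsto t atTop atTop) :
    ∃ ns : ℕ → ℕ, StrictMono ns ∧ ∀ᵐ ω ∂P, Tendsto (fun n => X (t (ns n)) ω) atTop (𝓝 (A ω)) :=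
  (tendstoInMeasure_of_tendsto_eLpNorm two_ne_zero (fun n => hX (t n)) hA
    (hXA.comp ht)).exists_seq_tendsto_ae

theorem Real.exp_sub_one_sub_self_le {f C : ℝ} (hf : |f| ≤ C) :
    Real.exp f - 1 - f ≤ Real.exp C * f ^ 2 := by
  have h1 := Complex.norm_exp_sub_sum_le_norm_mul_exp (f : ℂ) 2
  have h2 : Complex.exp f - ∑ m ∈ Finset.range 2, (f : ℂ) ^ m / (m.factorial : ℂ) =
      ((Real.exp f - 1 - f : ℝ) : ℂ) := by
    simp [Finset.sum_range_succ]
    ring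
  rw [h2, Complex.norm_real, Complex.norm_real, Real.norm_eq_abs, Real.norm_eq_abs, sq_abs] at h1
  refine (le_abs_self _).trans (h1.trans ?_)
  rw [mul_comm]
  gcongr

variable {E : Set ℝ} {μ : Measure E} {κ : E → ℝ} {P : Measure (Conf E)}

theorem sum_window_sub (F : E → ℂ) {S T : ℝ} (hST : S ≤ T) (X : Conf E) :
    ∑ x ∈ X.window T, F x - ∑ x ∈ X.window S, F x =
      ∑ x ∈ X.window T, {x : E | S < |(x : ℝ)|}.indicator F x := by
  classical
  rw [← Finset.sum_sdiff (X.window_mono hST), add_sub_cancel_right]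
  refine (Finset.sum_subset_zero_on_sdiff Finset.sdiff_subset (fun x hx => ?_) fun x hx => ?_)
  · refine Set.indicator_of_notMem (fun hxS => ?_) _
    rw [Finset.sdiff_sdiff_eq_self (X.window_mono hST), Conf.mem_window] at hx
    exact absurd hx.2 (not_le.2 hxS)
  · rw [Finset.mem_sdiff, Conf.mem_window, Conf.mem_window] at hx
    exact (Set.indicator_of_mem (s := {x : E | S < |(x : ℝ)|})
      (not_le.1 fun hS => hx.2 ⟨hx.1.1, hS⟩) F).symm

namespace IsSubPoisson

variable (h : IsSubPoisson μ κ P)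
include h

theorem centeredSum_sub {F : E → ℂ} (hF : Measurable F) {C : ℝ} (hC : ∀ x, ‖F x‖ ≤ C) {S T : ℝ}
    (hST : S ≤ T) (X : Conf E) : centeredSum μ κ F T X - centeredSum μ κ F S X =
      centeredSum μ κ ({x : E | S < |(x : ℝ)|}.indicator F) T X := by
  have hsub : {x : E | |(x : ℝ)| ≤ S} ⊆ {x : E | |(x : ℝ)| ≤ T} := fun x hx => le_trans hx hST
  have h1 : ∫ x in {x : E | |(x : ℝ)| ≤ T}, F x * κ x ∂μ -
      ∫ x in {x : E | |(x : ℝ)| ≤ S}, F x * κ x ∂μ =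
      ∫ x in {x : E | |(x : ℝ)| ≤ T}, {x : E | S < |(x : ℝ)|}.indicator F x * κ x ∂μ := by
    have hint : IntegrableOn (fun x => F x * (κ x : ℂ)) {x : E | |(x : ℝ)| ≤ T} μ :=
      h.integrableOn_window_mul hF hC T
    rw [← setIntegral_sdiff (measurableSet_window S) hint hsub]
    have : ∀ x : E, {x : E | S < |(x : ℝ)|}.indicator F x * (κ x : ℂ) =
        {x : E | S < |(x : ℝ)|}.indicator (fun x => F x * κ x) x := fun x => by
      by_cases hx : x ∈ {x : E | S < |(x : ℝ)|} <;> simp [hx]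
    simp_rw [this]
    rw [setIntegral_indicator (measurableSet_lt measurable_const (by fun_prop))]
    congr 2
    ext x
    simp
  rw [centeredSum, centeredSum, centeredSum, ← h1, ← sum_window_sub F hST X]
  ring

theorem aestronglyMeasurable_centeredSum {F : E → ℂ} (hF : Measurable F) {C : ℝ}
    (hC : ∀ x, ‖F x‖ ≤ C) (T : ℝ) : AEStronglyMeasurable (centeredSum μ κ F T) P :=
  (h.aestronglyMeasurable_sum hF hC T).sub aestronglyMeasurable_const

/-- Apply the second moment bound to the real and imaginary parts, with `q` a multiple of `1/(1+x²)`
on `|x| > S`. The result involves only the tail of the intensity beyond `S`, not `T`. -/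
theorem lintegral_centeredSum_sq_le [IsProbabilityMeasure P] {F : E → ℂ} (hF : Measurable F) {c : ℝ}
    (hc : ∀ x : E, ‖F x‖ ^ 2 ≤ c / (1 + (x : ℝ) ^ 2)) (S T : ℝ) :
    ∫⁻ X, ‖centeredSum μ κ ({x : E | S < |(x : ℝ)|}.indicator F) T X‖ₑ ^ (2 : ℝ) ∂P ≤
      ENNReal.ofReal (4 * (Real.exp (Real.exp √c * c *
        ∫ x in {x : E | S < |(x : ℝ)|}, κ x / (1 + (x : ℝ) ^ 2) ∂μ) - 1)) := by
  set B : Set E := {x : E | S < |(x : ℝ)|}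
  have hB : MeasurableSet B := measurableSet_lt measurable_const (by fun_prop)
  set G : E → ℂ := B.indicator F
  have hG : Measurable G := hF.indicator hB
  have hc0 : ∀ _ : E, 0 ≤ c := fun x => by
    have := (sq_nonneg _).trans (hc x)
    rwa [le_div_iff₀ (by positivity), zero_mul] at this
  set q : E → ℝ := B.indicator fun x => Real.exp √c * (c / (1 + (x : ℝ) ^ 2)) with hq
  have hq0 : ∀ x, 0 ≤ q x := fun x => Set.indicator_nonneg
    (fun y _ => mul_nonneg (Real.exp_pos _).le (div_nonneg (hc0 y) (by positivity))) x
  have hqeq : (fun x => q x * κ x) =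
      B.indicator fun x => Real.exp √c * c * (κ x / (1 + (x : ℝ) ^ 2)) := by
    ext x
    by_cases hx : x ∈ B <;> simp [hq, hx]
    ring
  have hqi : Integrable (fun x => q x * κ x) μ := by
    rw [hqeq]
    exact (h.integrable.const_mul _).indicator hB
  have hqv : ∫ x, q x * κ x ∂μ = Real.exp √c * c * ∫ x in B, κ x / (1 + (x : ℝ) ^ 2) ∂μ := by
    rw [hqeq, integral_indicator hB, integral_const_mul]
  have hFc : ∀ x, ‖F x‖ ≤ √c := fun x => by
    refine Real.le_sqrt_of_sq_le ((hc x).trans (div_le_self (hc0 x) ?_))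
    nlinarith [sq_nonneg (x : ℝ)]
  have hGc : ∀ x, ‖G x‖ ≤ √c := fun x => (norm_indicator_le_norm_self F x).trans (hFc x)
  have key : ∀ (f : E → ℝ), Measurable f → (∀ x, |f x| ≤ ‖G x‖) →
      ∫⁻ X : Conf E, ENNReal.ofReal
        ((∑ x ∈ X.window T, f x - ∫ x in {x : E | |(x : ℝ)| ≤ T}, f x * κ x ∂μ) ^ 2) ∂P ≤
      ENNReal.ofReal (2 * (Real.exp (∫ x, q x * κ x ∂μ) - 1)) := fun f hf hfG => by
    have hfq : ∀ x, Real.exp √c * (f x) ^ 2 ≤ q x := fun x => by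
      have h1 : (f x) ^ 2 ≤ ‖G x‖ ^ 2 := by
        rw [← sq_abs]; exact pow_le_pow_left₀ (abs_nonneg _) (hfG x) 2
      by_cases hx : x ∈ B
      · rw [hq, Set.indicator_of_mem hx]
        gcongr
        refine h1.trans ?_
        rw [show G x = F x from Set.indicator_of_mem hx F]
        exact hc x
      · rw [show G x = 0 from Set.indicator_of_notMem hx F] at h1
        rw [hq, Set.indicator_of_notMem hx]
        have : f x ^ 2 = 0 := le_antisymm (by simpa using h1) (sq_nonneg _)
        simp [this]
    refine h.lintegral_sq_centered_le hf (fun x => (hfG x).trans (hGc x)) hq0 hqi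
      (fun x => (Real.exp_sub_one_sub_self_le ((hfG x).trans (hGc x))).trans (hfq x)) (fun x => ?_) T
    have := (Real.exp_sub_one_sub_self_le (f := -f x) (C := √c)
      (by rw [abs_neg]; exact (hfG x).trans (hGc x)))
    rw [sub_neg_eq_add, neg_sq] at this
    exact this.trans (hfq x)
  have hint := h.integrableOn_window_mul hG hGc T
  have hre : ∀ X, (centeredSum μ κ G T X).re =
      ∑ x ∈ X.window T, (G x).re - ∫ x in {x : E | |(x : ℝ)| ≤ T}, (G x).re * κ x ∂μ := fun X => by
    rw [centeredSum, Complex.sub_re, Complex.re_sum]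
    congr 1
    refine (integral_re hint).symm.trans (integral_congr_ae (Eventually.of_forall fun x => ?_))
    simp
  have him : ∀ X, (centeredSum μ κ G T X).im =
      ∑ x ∈ X.window T, (G x).im - ∫ x in {x : E | |(x : ℝ)| ≤ T}, (G x).im * κ x ∂μ := fun X => by
    rw [centeredSum, Complex.sub_im, Complex.im_sum]
    congr 1
    refine (integral_im hint).symm.trans (integral_congr_ae (Eventually.of_forall fun x => ?_))
    simp
  have h1 := key (fun x => (G x).re) (Complex.measurable_re.comp hG)
    fun x => Complex.abs_re_le_norm _
  have h2 := key (fun x => (G x).im) (Complex.measurable_im.comp hG)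
    fun x => Complex.abs_im_le_norm _
  simp_rw [← hre] at h1
  simp_rw [← him] at h2
  have hm := (h.aestronglyMeasurable_centeredSum hG hGc T).aemeasurable
  have hm1 : AEMeasurable (fun X => ENNReal.ofReal ((centeredSum μ κ G T X).re ^ 2)) P :=
    ((Complex.measurable_re.comp_aemeasurable hm).pow_const 2).ennreal_ofReal
  calc _ = ∫⁻ X, (ENNReal.ofReal ((centeredSum μ κ G T X).re ^ 2) +
        ENNReal.ofReal ((centeredSum μ κ G T X).im ^ 2)) ∂P := by
        refine lintegral_congr fun X => ?_
        rw [← ENNReal.ofReal_add (sq_nonneg _) (sq_nonneg _), ENNReal.rpow_ofNat,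
          ← ofReal_norm, ← ENNReal.ofReal_pow (norm_nonneg _), ← Complex.normSq_eq_norm_sq,
          Complex.normSq_apply]
        ring_nf
    _ = _ := lintegral_add_left' hm1 _
    _ ≤ _ := add_le_add h1 h2
    _ = _ := by
        have : 0 ≤ 2 * (Real.exp (∫ x, q x * κ x ∂μ) - 1) := by
          have := Real.one_le_exp (integral_nonneg (μ := μ)
            fun x => mul_nonneg (hq0 x) (h.nonneg x))
          linarith
        rw [← ENNReal.ofReal_add this this, hqv]
        ring_nf

theorem exists_limit_centeredSum [IsProbabilityMeasure P] {F : E → ℂ} (hF : Measurable F) {c C : ℝ}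
    (hC : ∀ x, ‖F x‖ ≤ C) (hc : ∀ x : E, ‖F x‖ ^ 2 ≤ c / (1 + (x : ℝ) ^ 2)) :
    ∃ A : Conf E → ℂ, StronglyMeasurable A ∧
      Tendsto (fun T => eLpNorm (centeredSum μ κ F T - A) 2 P) atTop (𝓝 0) := by
  set b : ℝ → ℝ≥0∞ := fun S => ENNReal.ofReal (4 * (Real.exp (Real.exp √c * c *
        ∫ x in {x : E | S < |(x : ℝ)|}, κ x / (1 + (x : ℝ) ^ 2) ∂μ) - 1)) ^ ((1 : ℝ) / 2) with hb
  have hle : ∀ S T, eLpNorm (centeredSum μ κ ({x : E | S < |(x : ℝ)|}.indicator F) T) 2 P ≤ b S :=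
    fun S T => by
    rw [eLpNorm_eq_lintegral_rpow_enorm_toReal two_ne_zero ENNReal.ofNat_ne_top,
      ENNReal.toReal_ofNat]
    exact ENNReal.rpow_le_rpow (h.lintegral_centeredSum_sq_le hF hc S T) (by norm_num)
  have hbt : Tendsto b atTop (𝓝 0) := by
    have h1 := (((h.tendsto_tail.const_mul (Real.exp √c * c)).rexp.sub_const 1).const_mul 4)
    have h2 := (ENNReal.tendsto_ofReal h1).ennrpow_const ((1 : ℝ) / 2)
    simpa only [hb, mul_zero, Real.exp_zero, sub_self, ENNReal.ofReal_zero,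
      ENNReal.zero_rpow_of_pos one_half_pos] using h2
  have hmem : ∀ T, MemLp (centeredSum μ κ F T) 2 P := fun T => by
    refine ⟨h.aestronglyMeasurable_centeredSum hF hC T, ?_⟩
    -- With `S = -1` nothing is cut off, so the tail estimate also gives square integrability of the
    -- full sum.
    have h1 : {x : E | (-1 : ℝ) < |(x : ℝ)|}.indicator F = F := by
      ext x
      exact Set.indicator_of_mem (by
        have := abs_nonneg (x : ℝ)
        change (-1 : ℝ) < _
        linarith) F
    have h2 := hle (-1) T
    rw [h1] at h2
    exact h2.trans_lt (ENNReal.rpow_lt_top_of_nonneg (by norm_num) ENNReal.ofReal_ne_top)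
  have hsub : ∀ S T, S ≤ T →
      eLpNorm (centeredSum μ κ F T - centeredSum μ κ F S) 2 P ≤ b S := fun S T hST => by
    have : centeredSum μ κ F T - centeredSum μ κ F S =
        centeredSum μ κ ({x : E | S < |(x : ℝ)|}.indicator F) T :=
      funext fun X => h.centeredSum_sub hF hC hST X
    rw [this]
    exact hle S T
  obtain ⟨A, hA, -, hAt⟩ := exists_eLpNorm_limit hmem hbt hsub
  exact ⟨A, hA, hAt⟩

end IsSubPoisson

end RegProd

/-! ### Absolutely convergent sums over a configuration. -/

namespace RegProd

open scoped ENNReal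

variable {E : Set ℝ}

namespace Conf

theorem tendsto_sum_window (X : Conf E) {𝕜 : Type*} [NormedAddCommGroup 𝕜] {F : E → 𝕜}
    (hF : Summable fun x : X.carrier => F x) :
    Tendsto (fun T : ℝ => ∑ x ∈ X.window T, F x) atTop (𝓝 (∑' x : X.carrier, F x)) := by
  classical
  have h1 : Tendsto (fun T : ℝ => (X.window T).subtype (· ∈ X.carrier)) atTop atTop := by
    refine tendsto_atTop_finset_of_monotone (fun S T hST x hx => ?_) fun x => ⟨|((x : E) : ℝ)|, ?_⟩
    · rw [Finset.mem_subtype] at hx ⊢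
      exact X.window_mono hST hx
    · rw [Finset.mem_subtype, mem_window]
      exact ⟨x.2, le_rfl⟩
  refine (hF.hasSum.comp h1).congr fun T => ?_
  exact Finset.sum_subtype_of_mem F fun x hx => (mem_window.1 hx).1

/-- The configuration is square-summable at infinity. -/
def IsSummable (X : Conf E) : Prop :=
  Summable fun x : X.carrier => 1 / (1 + (((x : E) : ℝ)) ^ 2)

variable {X : Conf E} {F : E → ℂ} {M : ℝ}

theorem IsSummable.summable (hX : X.IsSummable) (hM : ∀ x : E, ‖F x‖ ≤ M / (1 + (x : ℝ) ^ 2)) :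
    Summable fun x : X.carrier => F x := by
  refine Summable.of_norm_bounded (Summable.mul_left M hX) fun x => (hM x).trans_eq ?_
  rw [mul_one_div]

theorem norm_sum_window_le (hM : ∀ x : E, ‖F x‖ ≤ M / (1 + (x : ℝ) ^ 2)) (T : ℝ) :
    ‖∑ x ∈ X.window T, F x‖ ≤ M * ∑ x ∈ X.window T, 1 / (1 + (x : ℝ) ^ 2) := by
  rw [Finset.mul_sum]
  refine norm_sum_le_of_le _ fun x _ => (hM x).trans_eq ?_
  rw [mul_one_div]

theorem IsSummable.norm_tsum_le (hX : X.IsSummable)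
    (hM : ∀ x : E, ‖F x‖ ≤ M / (1 + (x : ℝ) ^ 2)) :
    ‖∑' x : X.carrier, F x‖ ≤ M * ∑' x : X.carrier, 1 / (1 + (((x : E) : ℝ)) ^ 2) :=
  le_of_tendsto_of_tendsto (X.tendsto_sum_window (hX.summable hM)).norm
    ((X.tendsto_sum_window (F := fun x => 1 / (1 + (x : ℝ) ^ 2)) hX).const_mul M)
    (Eventually.of_forall fun T => norm_sum_window_le hM T)

/-- The tail is compared with that of one fixed series; with `M` uniform in `u`, this gives uniform
convergence. -/
theorem IsSummable.norm_tsum_sub_le (hX : X.IsSummable)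
    (hM : ∀ x : E, ‖F x‖ ≤ M / (1 + (x : ℝ) ^ 2)) (T : ℝ) :
    ‖∑' x : X.carrier, F x - ∑ x ∈ X.window T, F x‖ ≤
      M * (∑' x : X.carrier, 1 / (1 + (((x : E) : ℝ)) ^ 2) -
        ∑ x ∈ X.window T, 1 / (1 + (x : ℝ) ^ 2)) := by
  classical
  refine le_of_tendsto_of_tendsto
    ((X.tendsto_sum_window (hX.summable hM)).sub_const _).norm
    (((X.tendsto_sum_window (F := fun x => 1 / (1 + (x : ℝ) ^ 2)) hX).sub_const _).const_mul M) ?_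
  filter_upwards [eventually_ge_atTop T] with T' hT'
  rw [← Finset.sum_sdiff (X.window_mono hT'), ← Finset.sum_sdiff (X.window_mono hT'),
    add_sub_cancel_right, add_sub_cancel_right, Finset.mul_sum]
  refine norm_sum_le_of_le _ fun x _ => (hM x).trans_eq ?_
  rw [mul_one_div]

end Conf

/-- The exponential moments of the window sums of `w` are bounded, since `exp w - 1 ≤ 2w` on `[0,1]`
and `wκ` is integrable. By monotone convergence the supremum over windows is almost surely finite.
-/
theorem IsSubPoisson.ae_isSummable {μ : Measure E} {κ : E → ℝ} {P : Measure (Conf E)}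
    (h : IsSubPoisson μ κ P) : ∀ᵐ X ∂P, X.IsSummable := by
  set w : E → ℝ := fun x => 1 / (1 + (x : ℝ) ^ 2) with hw
  have hwm : Measurable w := by fun_prop
  have hw0 : ∀ x, 0 ≤ w x := fun x => by positivity
  have hw1 : ∀ x, |w x| ≤ 1 := fun x => by
    rw [abs_of_nonneg (hw0 x)]
    exact div_le_one_of_le₀ (by nlinarith [sq_nonneg (x : ℝ)]) (by positivity)
  have hbound : ∀ T : ℝ, ∫⁻ X : Conf E, ENNReal.ofReal (Real.exp (∑ x ∈ X.window T, w x)) ∂P ≤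
      ENNReal.ofReal (Real.exp (∫ x, (2 * w x) * κ x ∂μ)) := fun T => by
    have := h.lintegral_exp_sub_le (e := fun _ => 0) (q := fun x => 2 * w x) hwm measurable_const
      hw1 (M' := 0) (by simp) (fun x => mul_nonneg zero_le_two (hw0 x)) ?_ (fun x => ?_) T
    · simpa using this
    · refine h.integrable_mul (𝕜 := ℝ) (M := 2) (by fun_prop) fun x => le_of_eq ?_
      rw [Real.norm_of_nonneg (mul_nonneg zero_le_two (hw0 x)), hw, mul_one_div]
    · have := Real.abs_exp_sub_one_le (hw1 x)
      rw [abs_of_nonneg (hw0 x)] at this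
      linarith [le_abs_self (Real.exp (w x) - 1)]
  have hmono : ∀ X : Conf E, Monotone fun n : ℕ =>
      ENNReal.ofReal (Real.exp (∑ x ∈ X.window n, w x)) := fun X m n hmn =>
    ENNReal.ofReal_le_ofReal (Real.exp_le_exp.2 (Finset.sum_le_sum_of_subset_of_nonneg
      (X.window_mono (Nat.cast_le.2 hmn)) fun x _ _ => hw0 x))
  have hmeas : ∀ n : ℕ, AEMeasurable
      (fun X : Conf E => ENNReal.ofReal (Real.exp (∑ x ∈ X.window n, w x))) P := fun n => by
    have h1 := (h.aestronglyMeasurable_sum (f := fun x => (w x : ℂ)) (by fun_prop) (C := 1)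
      (fun x => by rw [Complex.norm_real]; exact hw1 x) n).aemeasurable
    have h2 := (Complex.measurable_re.comp_aemeasurable h1).exp.ennreal_ofReal
    refine h2.congr (Eventually.of_forall fun X => ?_)
    simp
  have hfin : ∫⁻ X : Conf E, ⨆ n : ℕ, ENNReal.ofReal (Real.exp (∑ x ∈ X.window n, w x)) ∂P ≠ ∞ := by
    rw [lintegral_iSup' hmeas (Eventually.of_forall hmono)]
    exact ((iSup_le fun n : ℕ => hbound n).trans_lt ENNReal.ofReal_lt_top).ne
  filter_upwards [ae_lt_top' (AEMeasurable.iSup hmeas) hfin] with X hX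
  refine summable_of_sum_le (c := (⨆ n : ℕ, ENNReal.ofReal
    (Real.exp (∑ x ∈ X.window n, w x))).toReal) (fun x => hw0 x) fun u => ?_
  classical
  obtain ⟨n, hn⟩ : ∃ n : ℕ, ∀ x ∈ u, |((x : E) : ℝ)| ≤ n := by
    obtain ⟨B, hB⟩ := (u.finite_toSet.image fun x : X.carrier => |((x : E) : ℝ)|).bddAbove
    obtain ⟨n, hn⟩ := exists_nat_ge B
    exact ⟨n, fun x hx => (hB ⟨x, hx, rfl⟩).trans hn⟩
  have h1 : ∑ x ∈ u, w x ≤ ∑ x ∈ X.window n, w x := by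
    rw [← Finset.sum_subtype_of_mem (p := (· ∈ X.carrier)) w
      fun x hx => (Conf.mem_window.1 hx).1]
    refine Finset.sum_le_sum_of_subset_of_nonneg (fun x hx => ?_) fun x _ _ => hw0 x
    rw [Finset.mem_subtype, Conf.mem_window]
    exact ⟨x.2, hn x hx⟩
  refine h1.trans ?_
  have h2 := ENNReal.toReal_mono hX.ne
    (le_iSup (fun n : ℕ => ENNReal.ofReal (Real.exp (∑ x ∈ X.window n, w x))) n)
  rw [ENNReal.toReal_ofReal (Real.exp_pos _).le] at h2
  linarith [Real.add_one_le_exp (∑ x ∈ X.window n, w x)]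

end RegProd

/-! ### Regularized logarithms and their limits. -/

namespace RegProd

open scoped ENNReal
open Complex (I)

variable {E : Set ℝ} {μ : Measure E} {κ : E → ℝ} {P : Measure (Conf E)} {R : ℝ} {L : ℂ → ℝ → ℂ}

/-- The window sums of `log g_{u+iR}`, with their divergent part compensated to first order. -/
noncomputable def logTrunc (μ : Measure E) (κ : E → ℝ) (R T : ℝ) (X : Conf E) (u : ℂ) : ℂ :=
  -(u + I * R) * centeredSum μ κ (fun x => 1 / (((x : ℝ) : ℂ) + I * R)) T X +
    ∑ x ∈ X.window T, (principalLog R u x + (u + I * R) / ((x : ℝ) + I * R))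

/-- The limit of `logTrunc` when the centered sums tend to `A`. -/
noncomputable def logLimit (A : Conf E → ℂ) (R : ℝ) (X : Conf E) (u : ℂ) : ℂ :=
  -(u + I * R) * A X +
    ∑' x : X.carrier, (principalLog R u (x : E) + (u + I * R) / (((x : E) : ℝ) + I * R))

/-- The convergent part of the expectation of the sum of `L u` over the points in `s`. -/
noncomputable def compensator (μ : Measure E) (κ : E → ℝ) (R : ℝ) (L : ℂ → ℝ → ℂ) (s : Set E)
    (u : ℂ) : ℂ :=
  ∫ x in s, (L u x + (u + I * R) / ((x : ℝ) + I * R)) * κ x ∂μ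

/-- The points of norm at most `D` whose distance to the real line is at least `ε`. -/
def strip (D ε : ℝ) : Set ℂ := {u | ‖u‖ ≤ D ∧ ε ≤ |u.im|}

theorem exists_mem_strip {u : ℂ} (hu : u.im ≠ 0) : ∃ D ε : ℝ, 0 < D ∧ 0 < ε ∧ u ∈ strip D ε :=
  ⟨‖u‖ + 1, |u.im|, by positivity, abs_pos.2 hu, by linarith, le_rfl⟩

theorem norm_add_mul_I_le (hR : 0 < R) (u : ℂ) : ‖u + I * R‖ ≤ ‖u‖ + R := by
  refine (norm_add_le _ _).trans_eq ?_
  rw [norm_mul, Complex.norm_I, one_mul, Complex.norm_real, Real.norm_of_nonneg hR.le]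

theorem norm_one_div_add_mul_I_sq_le (hR : 0 < R) (x : ℝ) :
    ‖1 / ((x : ℂ) + I * R)‖ ^ 2 ≤ (1 + 1 / R ^ 2) / (1 + x ^ 2) := by
  rw [norm_div, norm_one, div_pow, one_pow, norm_sq_add_mul_I]
  exact inv_sq_add_sq_le hR x

theorem norm_one_div_add_mul_I_le (hR : 0 < R) (x : ℝ) : ‖1 / ((x : ℂ) + I * R)‖ ≤ 1 / R := by
  rw [norm_div, norm_one]
  refine one_div_le_one_div_of_le hR ?_
  refine (sq_le_sq₀ hR.le (norm_nonneg _)).1 ?_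
  rw [norm_sq_add_mul_I]
  linarith [sq_nonneg x]

theorem tendstoUniformlyOn_of_norm_sub_le {ι α : Type*} {l : Filter ι} {f : ι → α → ℂ} {g : α → ℂ}
    {b : ι → ℝ} {s : Set α} (hb : Tendsto b l (𝓝 0)) (hfg : ∀ n, ∀ u ∈ s, ‖f n u - g u‖ ≤ b n) :
    TendstoUniformlyOn f g l s := by
  refine Metric.tendstoUniformlyOn_iff.2 fun ε hε => ?_
  filter_upwards [hb.eventually (gt_mem_nhds hε)] with n hn u hu
  rw [dist_comm, dist_eq_norm]
  exact (hfg n u hu).trans_lt hn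

theorem TendstoUniformlyOn.exp_of_norm_le {ι α : Type*} {l : Filter ι} {f : ι → α → ℂ} {g : α → ℂ}
    {B : ℝ} {s : Set α} (hfg : TendstoUniformlyOn f g l s) (hB : ∀ u ∈ s, ‖g u‖ ≤ B) :
    TendstoUniformlyOn (fun n u => Complex.exp (f n u)) (fun u => Complex.exp (g u)) l s :=
  hfg.comp_cexp ⟨B, by
    rintro _ ⟨u, hu, rfl⟩
    exact (Complex.re_le_norm _).trans (hB u hu)⟩

theorem norm_logLimit_le (hR : 0 < R) {X : Conf E} (hX : X.IsSummable) (A : Conf E → ℂ) {D ε : ℝ}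
    (hD : 0 < D) (hε : 0 < ε) : ∃ B, ∀ u ∈ strip D ε, ‖logLimit A R X u‖ ≤ B := by
  obtain ⟨M, -, hMb⟩ := (isLogDetermination_principalLog hR).bound D ε hD hε
  refine ⟨(D + R) * ‖A X‖ + M * ∑' x : X.carrier, 1 / (1 + (((x : E) : ℝ)) ^ 2), fun u hu => ?_⟩
  refine (norm_add_le _ _).trans (add_le_add ?_ ?_)
  · rw [norm_mul, norm_neg]
    gcongr
    exact (norm_add_mul_I_le hR u).trans (by linarith [hu.1])
  · exact hX.norm_tsum_le (F := fun x => principalLog R u x + (u + I * R) / ((x : ℝ) + I * R))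
      fun x => hMb u hu.1 hu.2 x

/-- In the first summand `u` appears only as the coefficient of a scalar that converges by
assumption; the second converges uniformly by summability. -/
theorem tendstoUniformlyOn_logTrunc (hR : 0 < R) {X : Conf E} (hX : X.IsSummable)
    {A : Conf E → ℂ} {ι : Type*} {l : Filter ι} {T : ι → ℝ} (hT : Tendsto T l atTop)
    (hA : Tendsto (fun n => centeredSum μ κ (fun x => 1 / (((x : ℝ) : ℂ) + I * R)) (T n) X) l
      (𝓝 (A X))) {D ε : ℝ} (hD : 0 < D) (hε : 0 < ε) :
    TendstoUniformlyOn (fun n u => logTrunc μ κ R (T n) X u) (logLimit A R X) l (strip D ε) := by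
  obtain ⟨M, -, hMb⟩ := (isLogDetermination_principalLog hR).bound D ε hD hε
  refine tendstoUniformlyOn_of_norm_sub_le (b := fun n => (D + R) *
    ‖centeredSum μ κ (fun x => 1 / (((x : ℝ) : ℂ) + I * R)) (T n) X - A X‖ +
      M * (∑' x : X.carrier, 1 / (1 + (((x : E) : ℝ)) ^ 2) -
        ∑ x ∈ X.window (T n), 1 / (1 + (x : ℝ) ^ 2))) ?_ fun n u hu => ?_
  · have h1 := ((hA.sub_const (A X)).norm).const_mul (D + R)
    have h2 := ((((X.tendsto_sum_window (F := fun x => 1 / (1 + (x : ℝ) ^ 2)) hX).comp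
      hT).const_sub (∑' x : X.carrier, 1 / (1 + (((x : E) : ℝ)) ^ 2))).const_mul M)
    simpa using h1.add h2
  · have h1 := hX.norm_tsum_sub_le
      (F := fun x => principalLog R u x + (u + I * R) / ((x : ℝ) + I * R))
      (fun x => hMb u hu.1 hu.2 x) (T n)
    have h2 : logTrunc μ κ R (T n) X u - logLimit A R X u =
        -(u + I * R) * (centeredSum μ κ (fun x => 1 / (((x : ℝ) : ℂ) + I * R)) (T n) X - A X) -
        (∑' x : X.carrier, (principalLog R u (x : E) + (u + I * R) / (((x : E) : ℝ) + I * R)) -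
          ∑ x ∈ X.window (T n), (principalLog R u x + (u + I * R) / ((x : ℝ) + I * R))) := by
      rw [logTrunc, logLimit]
      ring
    rw [h2]
    refine (norm_sub_le _ _).trans (add_le_add ?_ h1)
    rw [norm_mul, norm_neg]
    gcongr
    exact (norm_add_mul_I_le hR u).trans (by linarith [hu.1])

theorem measurable_remainder (hL : IsLogDetermination R L) (u : ℂ) :
    Measurable fun x : E => L u x + (u + I * R) / (((x : ℝ) : ℂ) + I * R) := by
  have h1 : Measurable fun x : E => L u x := (hL.measurable u).comp measurable_subtype_coe
  exact h1.add (by fun_prop)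

/-- The sums of `(u+iR)/(x+iR)` over the points cancel, and the exponential of a sum of logarithms
does not see the branch. -/
theorem exp_logTrunc (hR : 0 < R) {K : E → E → ℂ} (hK : ∀ᵐ x ∂μ, K x x = κ x) {u : ℂ}
    (hu : u.im ≠ 0) (T : ℝ) (X : Conf E) :
    truncPsiTilde μ K R T X u = Complex.exp (logTrunc μ κ R T X u) := by
  have h1 : ∫ x in {x : E | |(x : ℝ)| ≤ T}, K x x / ((x : ℝ) + I * R) ∂μ =
      ∫ x in {x : E | |(x : ℝ)| ≤ T}, 1 / ((x : ℝ) + I * R) * κ x ∂μ := by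
    refine integral_congr_ae (ae_restrict_of_ae ?_)
    filter_upwards [hK] with x hx
    rw [hx, one_div_mul_eq_div]
  have h2 : windowProd R T X u = Complex.exp (∑ x ∈ X.window T, principalLog R u x) := by
    rw [windowProd, Complex.exp_sum]
    exact Finset.prod_congr rfl fun x _ => (exp_principalLog hR hu x).symm
  have h3 : ∑ x ∈ X.window T, (u + I * R) / (((x : ℝ) : ℂ) + I * R) =
      (u + I * R) * ∑ x ∈ X.window T, 1 / (((x : ℝ) : ℂ) + I * R) := by
    rw [Finset.mul_sum]
    exact Finset.sum_congr rfl fun x _ => (mul_one_div _ _).symm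
  rw [truncPsiTilde, h1, h2, ← Complex.exp_add, logTrunc, centeredSum, Finset.sum_add_distrib, h3]
  congr 1
  ring

namespace IsSubPoisson

variable (h : IsSubPoisson μ κ P)
include h

theorem norm_compensator_le (hL : IsLogDetermination R L) {D ε : ℝ} (hD : 0 < D) (hε : 0 < ε) :
    ∃ B, ∀ s : Set E, ∀ u ∈ strip D ε, ‖compensator μ κ R L s u‖ ≤ B := by
  obtain ⟨M, hM, hMb⟩ := hL.bound D ε hD hε
  refine ⟨M * ∫ x, κ x / (1 + (x : ℝ) ^ 2) ∂μ, fun s u hu => ?_⟩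
  refine (h.norm_setIntegral_le (fun x => hMb u hu.1 hu.2 x) s).trans ?_
  gcongr
  · exact Eventually.of_forall fun x => div_nonneg (h.nonneg x) (by positivity)
  · exact h.integrable
  · exact Measure.restrict_le_self

theorem tendstoUniformlyOn_compensator (hL : IsLogDetermination R L) {ι : Type*} {l : Filter ι}
    {T : ι → ℝ} (hT : Tendsto T l atTop) {D ε : ℝ} (hD : 0 < D) (hε : 0 < ε) :
    TendstoUniformlyOn (fun n u => compensator μ κ R L {x : E | |(x : ℝ)| ≤ T n} u)
      (compensator μ κ R L Set.univ) l (strip D ε) := by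
  obtain ⟨M, -, hMb⟩ := hL.bound D ε hD hε
  have hlim := (h.tendsto_tail.comp hT).const_mul M
  rw [mul_zero] at hlim
  refine tendstoUniformlyOn_of_norm_sub_le hlim fun n u hu => ?_
  have hint : Integrable (fun x : E => (L u x + (u + I * R) / (((x : ℝ) : ℂ) + I * R)) * (κ x : ℂ)) μ :=
    h.integrable_mul (measurable_remainder hL u) (fun x => hMb u hu.1 hu.2 x)
  have h1 : compensator μ κ R L {x : E | |(x : ℝ)| ≤ T n} u - compensator μ κ R L Set.univ u =
      -compensator μ κ R L {x : E | T n < |(x : ℝ)|} u := by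
    have h2 := integral_add_compl (measurableSet_window (T n)) hint
    have h3 : {x : E | |(x : ℝ)| ≤ T n}ᶜ = {x : E | T n < |(x : ℝ)|} := by
      ext x; simp
    rw [h3] at h2
    rw [compensator, compensator, compensator, setIntegral_univ, ← h2]
    ring
  rw [h1, norm_neg]
  exact h.norm_setIntegral_le (fun x => hMb u hu.1 hu.2 x) _

/-- The random part is the same for every determination: `L` enters only through the deterministic
compensator. -/
theorem exp_logTrunc_sub (hR : 0 < R) (hL : IsLogDetermination R L) {K : E → E → ℂ}
    (hK : ∀ᵐ x ∂μ, K x x = κ x) {u : ℂ} (hu : u.im ≠ 0) (T : ℝ) (X : Conf E) :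
    truncPsi μ K R L T X u = Complex.exp (logTrunc μ κ R T X u -
      compensator μ κ R L {x : E | |(x : ℝ)| ≤ T} u) := by
  obtain ⟨D, ε, hD, hε, hu'⟩ := exists_mem_strip hu
  obtain ⟨M, -, hMb⟩ := hL.bound D ε hD hε
  have hint : Integrable (fun x : E => (L u x + (u + I * R) / (((x : ℝ) : ℂ) + I * R)) * (κ x : ℂ)) μ :=
    h.integrable_mul (measurable_remainder hL u) (fun x => hMb u hu'.1 hu'.2 x)
  have hint' : IntegrableOn (fun x : E => 1 / (((x : ℝ) : ℂ) + I * R) * (κ x : ℂ))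
      {x : E | |(x : ℝ)| ≤ T} μ :=
    h.integrableOn_window_mul (by fun_prop) (fun x => norm_one_div_add_mul_I_le hR x) T
  have h1 : ∫ x in {x : E | |(x : ℝ)| ≤ T}, L u x * K x x ∂μ =
      compensator μ κ R L {x : E | |(x : ℝ)| ≤ T} u -
        (u + I * R) * ∫ x in {x : E | |(x : ℝ)| ≤ T}, 1 / ((x : ℝ) + I * R) * κ x ∂μ := by
    rw [compensator, ← integral_const_mul, ← integral_sub hint.restrict (hint'.const_mul _)]
    refine integral_congr_ae (ae_restrict_of_ae ?_)
    filter_upwards [hK] with x hx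
    rw [hx]
    ring
  rw [Complex.exp_sub, ← exp_logTrunc hR hK hu, truncPsi, truncPsiTilde, h1, neg_sub,
    Complex.exp_sub]
  have h2 : ∫ x in {x : E | |(x : ℝ)| ≤ T}, K x x / ((x : ℝ) + I * R) ∂μ =
      ∫ x in {x : E | |(x : ℝ)| ≤ T}, 1 / ((x : ℝ) + I * R) * κ x ∂μ := by
    refine integral_congr_ae (ae_restrict_of_ae ?_)
    filter_upwards [hK] with x hx
    rw [hx, one_div_mul_eq_div]
  rw [h2]
  ring

end IsSubPoisson

end RegProd

/-! ### Exponential moments and uniform integrability. -/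

namespace RegProd

open scoped ENNReal NNReal
open Complex (I)

section ExpMoments

variable {Ω : Type*} [MeasurableSpace Ω] {P : Measure Ω}

/-- The real part of `w` has exponential moments of all orders. -/
structure HasExpMoments (P : Measure Ω) (w : Ω → ℂ) : Prop where
  aestronglyMeasurable : AEStronglyMeasurable w P
  lintegral_ne_top : ∀ s : ℝ, ∫⁻ ω, ENNReal.ofReal (Real.exp (s * (w ω).re)) ∂P ≠ ∞

theorem enorm_cexp_rpow (z : ℂ) {p : ℝ} (hp : 0 ≤ p) :
    ‖Complex.exp z‖ₑ ^ p = ENNReal.ofReal (Real.exp (p * z.re)) := by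
  rw [← ofReal_norm, Complex.norm_exp, ENNReal.ofReal_rpow_of_nonneg (Real.exp_pos _).le hp,
    ← Real.exp_mul, mul_comm]

namespace HasExpMoments

variable {w : Ω → ℂ} (hw : HasExpMoments P w)
include hw

theorem neg : HasExpMoments P (-w) where
  aestronglyMeasurable := hw.1.neg
  lintegral_ne_top s := by
    simpa using hw.2 (-s)

theorem sub_const (c : ℂ) : HasExpMoments P (fun ω => w ω - c) where
  aestronglyMeasurable := hw.1.sub aestronglyMeasurable_const
  lintegral_ne_top s := by
    simp_rw [Complex.sub_re, mul_sub, sub_eq_add_neg, Real.exp_add,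
      ENNReal.ofReal_mul (Real.exp_pos _).le]
    rw [lintegral_mul_const' _ _ ENNReal.ofReal_ne_top]
    exact ENNReal.mul_ne_top (hw.2 s) ENNReal.ofReal_ne_top

theorem memLp_exp {p : ℝ≥0∞} (hp : p ≠ ∞) : MemLp (fun ω => Complex.exp (w ω)) p P := by
  refine ⟨Complex.continuous_exp.comp_aestronglyMeasurable hw.1, ?_⟩
  rcases eq_or_ne p 0 with rfl | hp0
  · simp
  rw [eLpNorm_lt_top_iff_lintegral_rpow_enorm_lt_top hp0 hp]
  simp_rw [enorm_cexp_rpow _ ENNReal.toReal_nonneg]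
  exact (hw.2 _).lt_top

end HasExpMoments

/-- Vitali's theorem along subsequences: boundedness in `L²` gives uniform integrability of the
exponentials, and almost sure convergence along a further subsequence suffices. -/
theorem tendsto_eLpNorm_exp_sub [IsFiniteMeasure P] {W : ℝ → Ω → ℂ} {V : Ω → ℂ} {C : ℝ≥0∞}
    (hW : ∀ T, AEStronglyMeasurable (W T) P) (hV : MemLp (fun ω => Complex.exp (V ω)) 1 P)
    (hC : C ≠ ∞) (hWC : ∀ T, ∫⁻ ω, ENNReal.ofReal (Real.exp (2 * (W T ω).re)) ∂P ≤ C)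
    (hWV : ∀ t : ℕ → ℝ, Tendsto t atTop atTop → ∃ ns : ℕ → ℕ,
      ∀ᵐ ω ∂P, Tendsto (fun n => W (t (ns n)) ω) atTop (𝓝 (V ω))) :
    Tendsto (fun T => eLpNorm (fun ω => Complex.exp (W T ω) - Complex.exp (V ω)) 1 P)
      atTop (𝓝 0) := by
  refine tendsto_of_subseq_tendsto fun t ht => ?_
  obtain ⟨ns, hns⟩ := hWV t ht
  refine ⟨ns, ?_⟩
  have hm : ∀ n, AEStronglyMeasurable (fun ω => Complex.exp (W (t (ns n)) ω)) P := fun n =>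
    Complex.continuous_exp.comp_aestronglyMeasurable (hW _)
  refine tendsto_Lp_finite_of_tendsto_ae (f := fun n ω => Complex.exp (W (t (ns n)) ω))
    le_rfl ENNReal.one_ne_top hm hV (unifIntegrable_of le_rfl ENNReal.one_ne_top hm fun ε hε => ?_) ?_
  -- Where `|e^W| ≥ c` one has `|e^W| ≤ |e^W|²/c`, of integral at most `C/c ≤ ε`. The `+1` keeps `c`
  -- positive when `C = 0`.
  · set c : ℝ≥0 := (C.toNNReal + 1) / ε.toNNReal with hc
    have hε' : 0 < ε.toNNReal := Real.toNNReal_pos.2 hε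
    have hc0 : 0 < c := div_pos (by positivity) hε'
    refine ⟨c, fun n => ?_⟩
    rw [eLpNorm_one_eq_lintegral_enorm]
    have hpt : ∀ ω, ‖{ω | c ≤ ‖Complex.exp (W (t (ns n)) ω)‖₊}.indicator
        (fun ω => Complex.exp (W (t (ns n)) ω)) ω‖ₑ ≤
        (c : ℝ≥0∞)⁻¹ * ENNReal.ofReal (Real.exp (2 * (W (t (ns n)) ω).re)) := fun ω => by
      by_cases hω : c ≤ ‖Complex.exp (W (t (ns n)) ω)‖₊
      · rw [Set.indicator_of_mem (by exact hω), ← enorm_cexp_rpow _ zero_le_two,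
          ENNReal.rpow_ofNat, sq, ← mul_assoc]
        refine le_mul_of_one_le_left zero_le ?_
        rw [mul_comm, ← div_eq_mul_inv, ENNReal.le_div_iff_mul_le (by simp [hc0.ne']) (by simp),
          one_mul, enorm_eq_nnnorm]
        exact_mod_cast hω
      · rw [Set.indicator_of_notMem (by exact hω), enorm_zero]
        exact zero_le
    refine (lintegral_mono hpt).trans ?_
    rw [lintegral_const_mul' _ _ (by simp [hc0.ne'])]
    refine (mul_le_mul_right (hWC _) _).trans ?_
    rw [← ENNReal.coe_toNNReal hC, ← ENNReal.coe_inv hc0.ne', ← ENNReal.coe_mul, ENNReal.ofReal]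
    refine ENNReal.coe_le_coe.2 ?_
    rw [hc, inv_div, div_mul_eq_mul_div, div_le_iff₀ (by positivity)]
    gcongr
    exact le_self_add
  · filter_upwards [hns] with ω hω
    exact (Complex.continuous_exp.tendsto _).comp hω

end ExpMoments

variable {E : Set ℝ} {μ : Measure E} {κ : E → ℝ} {P : Measure (Conf E)} {R : ℝ} {L : ℂ → ℝ → ℂ}

namespace IsSubPoisson

variable (h : IsSubPoisson μ κ P)
include h

theorem aestronglyMeasurable_logTrunc (hR : 0 < R) {u : ℂ} (hu : u.im ≠ 0) (T : ℝ) :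
    AEStronglyMeasurable (fun X => logTrunc μ κ R T X u) P := by
  obtain ⟨D, ε, hD, hε, hu'⟩ := exists_mem_strip hu
  have hL := isLogDetermination_principalLog hR
  obtain ⟨M, hM, hMb⟩ := hL.bound D ε hD hε
  refine ((h.aestronglyMeasurable_centeredSum (by fun_prop)
    (fun x => norm_one_div_add_mul_I_le hR x) T).const_mul _).add
    (h.aestronglyMeasurable_sum (measurable_remainder hL u) (C := M) (fun x => ?_) T)
  refine (hMb u hu'.1 hu'.2 x).trans (div_le_self hM ?_)
  nlinarith [sq_nonneg (x : ℝ)]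

/-- The exponent is a window sum of `f = s Re Log g` compensated by `e`, its first-order part. Both
`f - e` and `f²` are `O(1/(1+x²))`, hence so is the upper bound for `exp f - 1 - e`. -/
theorem exists_lintegral_exp_logTrunc_le (hR : 0 < R) {u : ℂ} (hu : u.im ≠ 0) (s : ℝ) :
    ∃ C : ℝ, ∀ T, ∫⁻ X, ENNReal.ofReal (Real.exp (s * (logTrunc μ κ R T X u).re)) ∂P ≤
      ENNReal.ofReal C := by
  obtain ⟨D, ε, hD, hε, hu'⟩ := exists_mem_strip hu
  have hL := isLogDetermination_principalLog hR
  obtain ⟨M, hM, hMb⟩ := hL.bound D ε hD hε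
  set a : E → ℂ := fun x => 1 / (((x : ℝ) : ℂ) + I * R) with ha
  have ham : Measurable a := by fun_prop
  set v := u + I * R with hv
  set f : E → ℝ := fun x => s * (principalLog R u x).re with hf
  set e : E → ℝ := fun x => -s * (v * a x).re with he
  have hfm : Measurable f := (Complex.measurable_re.comp
    ((hL.measurable u).comp measurable_subtype_coe)).const_mul s
  have hem : Measurable e := (Complex.measurable_re.comp (ham.const_mul v)).const_mul _
  have hw : ∀ x : E, 0 < 1 + (x : ℝ) ^ 2 := fun x => by positivity
  have hMx : ∀ x : E, M / (1 + (x : ℝ) ^ 2) ≤ M := fun x =>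
    div_le_self hM (by nlinarith [sq_nonneg (x : ℝ)])
  have hfe : ∀ x, |f x - e x| ≤ |s| * M / (1 + (x : ℝ) ^ 2) := fun x => by
    have h1 : f x - e x = s * (principalLog R u x + v / ((x : ℝ) + I * R)).re := by
      simp only [hf, he, ha, mul_one_div, Complex.add_re]
      ring
    rw [h1, abs_mul, mul_div_assoc]
    exact mul_le_mul_of_nonneg_left ((Complex.abs_re_le_norm _).trans (hMb u hu'.1 hu'.2 x))
      (abs_nonneg _)
  have heb : ∀ x, |e x| ≤ |s| * (‖v‖ * ‖a x‖) := fun x => by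
    rw [he, abs_mul, abs_neg, ← norm_mul]
    exact mul_le_mul_of_nonneg_left (Complex.abs_re_le_norm _) (abs_nonneg _)
  have heb' : ∀ x, |e x| ≤ |s| * (‖v‖ * (1 / R)) := fun x =>
    (heb x).trans (by gcongr; exact norm_one_div_add_mul_I_le hR x)
  have hfb : ∀ x, |f x| ≤ |s| * M + |s| * (‖v‖ * (1 / R)) := fun x => by
    have h1 := hfe x
    have h2 := mul_le_mul_of_nonneg_left (hMx x) (abs_nonneg s)
    rw [← mul_div_assoc] at h2
    have h3 := abs_sub_abs_le_abs_sub (f x) (e x)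
    linarith [heb' x]
  set C0 := |s| * M + |s| * (‖v‖ * (1 / R)) with hC0
  set c1 := 2 * ((|s| * M) * (|s| * M) + |s| ^ 2 * ‖v‖ ^ 2 * (1 + 1 / R ^ 2)) with hc1
  have hf2 : ∀ x : E, f x ^ 2 ≤ c1 / (1 + (x : ℝ) ^ 2) := fun x => by
    have h1 : f x ^ 2 ≤ 2 * ((f x - e x) ^ 2 + e x ^ 2) := by nlinarith [sq_nonneg (f x - 2 * e x)]
    have h2 : (f x - e x) ^ 2 ≤ (|s| * M) * (|s| * M) / (1 + (x : ℝ) ^ 2) := by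
      rw [← sq_abs, sq, mul_div_assoc]
      have h4 : |f x - e x| ≤ |s| * M := (hfe x).trans (by
        rw [mul_div_assoc]; exact mul_le_mul_of_nonneg_left (hMx x) (abs_nonneg s))
      exact mul_le_mul h4 (hfe x) (abs_nonneg _) (by positivity)
    have h3 : e x ^ 2 ≤ |s| ^ 2 * ‖v‖ ^ 2 * (1 + 1 / R ^ 2) / (1 + (x : ℝ) ^ 2) := by
      rw [← sq_abs]
      refine (pow_le_pow_left₀ (abs_nonneg _) (heb x) 2).trans ?_
      rw [mul_pow, mul_pow, ← mul_assoc, mul_div_assoc]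
      exact mul_le_mul_of_nonneg_left (norm_one_div_add_mul_I_sq_le hR x) (by positivity)
    refine (h1.trans (mul_le_mul_of_nonneg_left (add_le_add h2 h3) zero_le_two)).trans_eq ?_
    rw [hc1, ← add_div, mul_div_assoc]
  set c2 := Real.exp C0 * c1 + |s| * M with hc2
  have hc20 : 0 ≤ c2 := by positivity
  have hle : ∀ x : E, Real.exp (f x) - 1 - e x ≤ c2 / (1 + (x : ℝ) ^ 2) := fun x => by
    have h1 := Real.exp_sub_one_sub_self_le (hfb x)
    have h2 := mul_le_mul_of_nonneg_left (hf2 x) (Real.exp_pos C0).le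
    have h3 := (le_abs_self _).trans (hfe x)
    rw [hc2, add_div, mul_div_assoc]
    linarith
  refine ⟨_, fun T => le_trans (le_of_eq (lintegral_congr fun X => ?_))
    (h.lintegral_exp_sub_le (q := fun x => c2 / (1 + (x : ℝ) ^ 2)) hfm hem hfb heb'
      (fun x => div_nonneg hc20 (hw x).le) (h.integrable_mul (𝕜 := ℝ) (M := c2) (by fun_prop)
      fun x => (Real.norm_of_nonneg (div_nonneg hc20 (hw x).le)).le) hle T)⟩
  congr 2
  have hint : IntegrableOn (fun x : E => a x * (κ x : ℂ)) {x : E | |(x : ℝ)| ≤ T} μ :=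
    h.integrableOn_window_mul ham (fun x => norm_one_div_add_mul_I_le hR x) T
  have h1 : logTrunc μ κ R T X u = ∑ x ∈ X.window T, principalLog R u x +
      ∫ x in {x : E | |(x : ℝ)| ≤ T}, v * (a x * κ x) ∂μ := by
    have h3 : ∑ x ∈ X.window T, v / (((x : ℝ) : ℂ) + I * R) = v * ∑ x ∈ X.window T, a x := by
      rw [Finset.mul_sum]
      exact Finset.sum_congr rfl fun x _ => (mul_one_div _ _).symm
    rw [logTrunc, centeredSum, Finset.sum_add_distrib, h3, integral_const_mul]
    ring
  have h2 : (∫ x in {x : E | |(x : ℝ)| ≤ T}, v * (a x * κ x) ∂μ).re =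
      ∫ x in {x : E | |(x : ℝ)| ≤ T}, (v * (a x * κ x)).re ∂μ :=
    (integral_re (hint.const_mul v)).symm
  rw [h1, Complex.add_re, h2, Complex.re_sum, mul_add, Finset.mul_sum, sub_eq_add_neg,
    ← integral_neg, ← integral_const_mul]
  congr 1
  refine integral_congr_ae (Eventually.of_forall fun x => ?_)
  simp only [he]
  rw [← mul_assoc, Complex.re_mul_ofReal]
  ring

theorem hasExpMoments_logTrunc (hR : 0 < R) {u : ℂ} (hu : u.im ≠ 0) (T : ℝ) :
    HasExpMoments P fun X => logTrunc μ κ R T X u :=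
  ⟨h.aestronglyMeasurable_logTrunc hR hu T, fun s => by
    obtain ⟨C, hC⟩ := h.exists_lintegral_exp_logTrunc_le hR hu s
    exact ne_top_of_le_ne_top ENNReal.ofReal_ne_top (hC T)⟩

end IsSubPoisson

end RegProd

/-! ### Algebras, convergence in `L¹` and analyticity. -/

namespace RegProd

open scoped ENNReal NNReal
open Complex (I)

section Algebra

variable {Ω : Type*} [MeasurableSpace Ω] {P : Measure Ω}

/-- The algebra of the functions that belong to `Lᵖ` for all finite `p`. -/
def finiteMomentsSubalgebra (P : Measure Ω) [IsFiniteMeasure P] : Subalgebra ℂ (Ω → ℂ) where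
  carrier := {G | ∀ p : ℝ≥0∞, p ≠ ∞ → MemLp G p P}
  mul_mem' {F G} hF hG p hp := by
    have h2 : (2 * p)⁻¹ = 2⁻¹ * p⁻¹ :=
      ENNReal.mul_inv (Or.inl two_ne_zero) (Or.inl ENNReal.ofNat_ne_top)
    have : ENNReal.HolderTriple (2 * p) (2 * p) p :=
      ⟨by rw [h2, ← add_mul, ENNReal.inv_two_add_inv_two, one_mul]⟩
    have h3 : 2 * p ≠ ∞ := ENNReal.mul_ne_top ENNReal.ofNat_ne_top hp
    exact (hG _ h3).mul (hF _ h3)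
  add_mem' hF hG p hp := (hF p hp).add (hG p hp)
  algebraMap_mem' c p _ := memLp_const c

end Algebra

variable {E : Set ℝ} {μ : Measure E} {κ : E → ℝ} {P : Measure (Conf E)} {R : ℝ} {L : ℂ → ℝ → ℂ}

/-- The generators are exponentials of `w` or `-w`, so they have finite moments of every order; by
Hölder such functions form an algebra. -/
theorem algebrasInL1_exp [IsFiniteMeasure P] {w : Conf E → ℂ → ℂ}
    (hw : ∀ u ∈ nonreal, HasExpMoments P fun X => w X u) :
    AlgebrasInL1 P fun X u => Complex.exp (w X u) := by
  refine ⟨fun u _ => Eventually.of_forall fun X => Complex.exp_ne_zero _,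
    fun n z z' hz hz' G hG => ?_⟩
  have h1 : ∀ u ∈ nonreal, (fun X => Complex.exp (w X u)) ∈ finiteMomentsSubalgebra P :=
    fun u hu p hp => (hw u hu).memLp_exp hp
  have h2 : ∀ u ∈ nonreal, (fun X => (Complex.exp (w X u))⁻¹) ∈ finiteMomentsSubalgebra P :=
    fun u hu p hp => by
      have := (hw u hu).neg.memLp_exp hp
      simpa only [Pi.neg_apply, Complex.exp_neg] using this
  have h3 : Algebra.adjoin ℂ ((Set.range fun j => fun X => Complex.exp (w X (z j))) ∪
      (Set.range fun j => fun X => (Complex.exp (w X (z j)))⁻¹) ∪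
      (Set.range fun j => fun X => Complex.exp (w X (z' j))) ∪
      (Set.range fun j => fun X => (Complex.exp (w X (z' j)))⁻¹)) ≤ finiteMomentsSubalgebra P := by
    refine Algebra.adjoin_le ?_
    rintro _ (((⟨j, rfl⟩ | ⟨j, rfl⟩) | ⟨j, rfl⟩) | ⟨j, rfl⟩)
    · exact h1 _ (hz j)
    · exact h2 _ (hz j)
    · exact h1 _ (hz' j)
    · exact h2 _ (hz' j)
  exact memLp_one_iff_integrable.1 (h3 hG 1 ENNReal.one_ne_top)

namespace IsSubPoisson

variable (h : IsSubPoisson μ κ P) {A : Conf E → ℂ} (hA : StronglyMeasurable A)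
  (hAt : Tendsto (fun T => eLpNorm
    (centeredSum μ κ (fun x => 1 / (((x : ℝ) : ℂ) + I * R)) T - A) 2 P) atTop (𝓝 0))
include h hA hAt

theorem exists_seq_ae_tendsto (hR : 0 < R) {t : ℕ → ℝ} (ht : Tendsto t atTop atTop) :
    ∃ ns : ℕ → ℕ, StrictMono ns ∧ ∀ᵐ X ∂P, X.IsSummable ∧
      Tendsto (fun n => centeredSum μ κ (fun x => 1 / (((x : ℝ) : ℂ) + I * R)) (t (ns n)) X) atTop
        (𝓝 (A X)) := by
  obtain ⟨ns, hns, hlim⟩ := exists_seq_ae_tendsto_of_eLpNorm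
    (fun T => h.aestronglyMeasurable_centeredSum (by fun_prop)
      (fun x => norm_one_div_add_mul_I_le hR x) T) hA.aestronglyMeasurable hAt ht
  exact ⟨ns, hns, h.ae_isSummable.and hlim⟩

theorem exists_seq_ae_tendsto_logTrunc (hR : 0 < R) {u : ℂ} (hu : u.im ≠ 0) {t : ℕ → ℝ}
    (ht : Tendsto t atTop atTop) :
    ∃ ns : ℕ → ℕ, StrictMono ns ∧ ∀ᵐ X ∂P, Tendsto (fun n => logTrunc μ κ R (t (ns n)) X u) atTop
      (𝓝 (logLimit A R X u)) := by
  obtain ⟨ns, hns, hlim⟩ := h.exists_seq_ae_tendsto hA hAt hR ht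
  obtain ⟨D, ε, hD, hε, hu'⟩ := exists_mem_strip hu
  refine ⟨ns, hns, ?_⟩
  filter_upwards [hlim] with X hX
  exact (tendstoUniformlyOn_logTrunc hR hX.1 (ht.comp hns.tendsto_atTop) hX.2 hD hε).tendsto_at hu'

/-- Fatou along an almost surely convergent subsequence, from bounds uniform in the window. -/
theorem hasExpMoments_logLimit (hR : 0 < R) {u : ℂ} (hu : u.im ≠ 0) :
    HasExpMoments P fun X => logLimit A R X u := by
  obtain ⟨ns, -, hlim⟩ := h.exists_seq_ae_tendsto_logTrunc hA hAt hR hu tendsto_natCast_atTop_atTop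
  refine ⟨aestronglyMeasurable_of_tendsto_ae atTop
    (fun n => h.aestronglyMeasurable_logTrunc hR hu _) hlim, fun s => ?_⟩
  obtain ⟨C, hC⟩ := h.exists_lintegral_exp_logTrunc_le hR hu s
  refine ne_top_of_le_ne_top (b := ENNReal.ofReal C) ENNReal.ofReal_ne_top ?_
  calc _ = ∫⁻ X, liminf (fun n => ENNReal.ofReal
        (Real.exp (s * (logTrunc μ κ R (ns n : ℕ) X u).re))) atTop ∂P := by
        refine lintegral_congr_ae ?_
        filter_upwards [hlim] with X hX
        have h1 := ((Complex.continuous_re.tendsto _).comp hX).const_mul s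
        exact (ENNReal.tendsto_ofReal h1.rexp).liminf_eq.symm
    _ ≤ liminf (fun n => ∫⁻ X, ENNReal.ofReal
        (Real.exp (s * (logTrunc μ κ R (ns n : ℕ) X u).re)) ∂P) atTop :=
        lintegral_liminf_le' fun n => (((Complex.measurable_re.comp_aemeasurable
          (h.aestronglyMeasurable_logTrunc hR hu _).aemeasurable).const_mul s).exp).ennreal_ofReal
    _ ≤ _ := liminf_le_of_frequently_le' (Frequently.of_forall fun n => hC _)

theorem convergesInL1_exp [IsFiniteMeasure P] (hR : 0 < R) {δT : ℝ → ℂ → ℂ} {δ : ℂ → ℂ}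
    (hδ : ∀ u ∈ nonreal, Tendsto (fun T => δT T u) atTop (𝓝 (δ u)))
    (hδB : ∀ u ∈ nonreal, ∃ B, ∀ T, ‖δT T u‖ ≤ B) :
    ConvergesInL1 P (fun T X u => Complex.exp (logTrunc μ κ R T X u - δT T u))
      (fun X u => Complex.exp (logLimit A R X u - δ u)) := fun u hu => by
  have hT : ∀ T, HasExpMoments P fun X => logTrunc μ κ R T X u - δT T u := fun T =>
    (h.hasExpMoments_logTrunc hR hu T).sub_const _
  have hV : HasExpMoments P fun X => logLimit A R X u - δ u :=
    (h.hasExpMoments_logLimit hA hAt hR hu).sub_const _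
  obtain ⟨C, hC⟩ := h.exists_lintegral_exp_logTrunc_le hR hu 2
  obtain ⟨B, hB⟩ := hδB u hu
  refine ⟨fun T => memLp_one_iff_integrable.1 ((hT T).memLp_exp ENNReal.one_ne_top),
    memLp_one_iff_integrable.1 (hV.memLp_exp ENNReal.one_ne_top),
    tendsto_eLpNorm_exp_sub (fun T => (hT T).1) (hV.memLp_exp ENNReal.one_ne_top)
      (C := ENNReal.ofReal (Real.exp (2 * B)) * ENNReal.ofReal C)
      (ENNReal.mul_ne_top ENNReal.ofReal_ne_top ENNReal.ofReal_ne_top) (fun T => ?_)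
      fun t ht => ?_⟩
  · refine (lintegral_mono fun X => ?_).trans ((lintegral_const_mul' _ _
      ENNReal.ofReal_ne_top).trans_le (mul_le_mul_right (hC T) _))
    rw [← ENNReal.ofReal_mul (Real.exp_pos _).le, ← Real.exp_add]
    refine ENNReal.ofReal_le_ofReal (Real.exp_le_exp.2 ?_)
    have := (neg_le_abs _).trans ((Complex.abs_re_le_norm (δT T u)).trans (hB T))
    rw [Complex.sub_re]
    linarith
  · obtain ⟨ns, hns, hlim⟩ := h.exists_seq_ae_tendsto_logTrunc hA hAt hR hu ht
    refine ⟨ns, ?_⟩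
    filter_upwards [hlim] with X hX
    exact hX.sub ((hδ u hu).comp (ht.comp hns.tendsto_atTop))

end IsSubPoisson

theorem ConvergesInL1.congr {F F' : ℝ → Conf E → ℂ → ℂ} {Φ : Conf E → ℂ → ℂ}
    (hF : ConvergesInL1 P F Φ) (hFF' : ∀ u ∈ nonreal, ∀ T X, F' T X u = F T X u) :
    ConvergesInL1 P F' Φ := fun u hu => by
  simpa only [hFF' u hu] using hF u hu

theorem isOpen_nonreal : IsOpen nonreal :=
  isOpen_ne_fun Complex.continuous_im continuous_const

theorem tendstoUniformlyOn_of_strip {f : ℕ → ℂ → ℂ} {g : ℂ → ℂ}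
    (hfg : ∀ D ε : ℝ, 0 < D → 0 < ε → TendstoUniformlyOn f g atTop (strip D ε)) {C : Set ℂ}
    (hC : IsCompact C) (hC' : C ⊆ nonreal) : TendstoUniformlyOn f g atTop C := by
  obtain ⟨D, ε, hD, hε, hb⟩ := exists_bounds_of_isCompact hC hC'
  exact (hfg D ε hD hε).mono hb

theorem tendstoUniformlyOn_exp_sub (hR : 0 < R) {X : Conf E} (hX : X.IsSummable)
    {A : Conf E → ℂ} {T : ℕ → ℝ} (hT : Tendsto T atTop atTop)
    (hA : Tendsto (fun n => centeredSum μ κ (fun x => 1 / (((x : ℝ) : ℂ) + I * R)) (T n) X) atTop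
      (𝓝 (A X))) {δT : ℕ → ℂ → ℂ} {δ : ℂ → ℂ}
    (hδ : ∀ D ε : ℝ, 0 < D → 0 < ε → TendstoUniformlyOn δT δ atTop (strip D ε))
    (hδB : ∀ D ε : ℝ, 0 < D → 0 < ε → ∃ B, ∀ u ∈ strip D ε, ‖δ u‖ ≤ B) {C : Set ℂ}
    (hC : IsCompact C) (hC' : C ⊆ nonreal) :
    TendstoUniformlyOn (fun n u => Complex.exp (logTrunc μ κ R (T n) X u - δT n u))
      (fun u => Complex.exp (logLimit A R X u - δ u)) atTop C := by
  refine tendstoUniformlyOn_of_strip (fun D ε hD hε => ?_) hC hC'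
  obtain ⟨B, hB⟩ := hδB D ε hD hε
  obtain ⟨B', hB'⟩ := norm_logLimit_le hR hX A hD hε
  exact TendstoUniformlyOn.exp_of_norm_le
    ((tendstoUniformlyOn_logTrunc hR hX hT hA hD hε).sub (hδ D ε hD hε))
    fun u hu => (norm_sub_le _ _).trans (add_le_add (hB' u hu) (hB u hu))

theorem differentiableOn_truncPsiTilde (K : E → E → ℂ) (T : ℝ) (X : Conf E) :
    DifferentiableOn ℂ (truncPsiTilde μ K R T X) nonreal := by
  unfold truncPsiTilde windowProd g
  fun_prop

/-- Differentiate under the integral on the disc of radius `|Im u|/2`. It stays away from the real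
line, so the derivative of the integrand is dominated by a multiple of `κ/(1+x²)`. -/
theorem differentiableOn_compensator_holomorphicLog (h : IsSubPoisson μ κ P) (hR : 0 < R) :
    DifferentiableOn ℂ (compensator μ κ R (holomorphicLog R) Set.univ) nonreal := fun u hu => by
  have hL := isLogDetermination_holomorphicLog hR
  have hε : 0 < |u.im| / 2 := half_pos (abs_pos.2 hu)
  have hD : 0 < ‖u‖ + |u.im| / 2 := by positivity
  obtain ⟨M, -, hMb⟩ := hL.bound _ _ hD hε
  obtain ⟨M', -, hMb'⟩ := exists_norm_deriv_le hR hD hε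
  have hball : ∀ v ∈ Metric.ball u (|u.im| / 2),
      ‖v‖ ≤ ‖u‖ + |u.im| / 2 ∧ |u.im| / 2 ≤ |v.im| := fun v hv => by
    rw [Metric.mem_ball, dist_eq_norm] at hv
    have h1 := norm_sub_norm_le v u
    have h2 := (Complex.abs_im_le_norm (v - u)).trans hv.le
    rw [Complex.sub_im] at h2
    have h3 := abs_sub_abs_le_abs_sub u.im v.im
    rw [abs_sub_comm] at h3
    constructor <;> linarith
  have hmeas : ∀ v, Measurable fun x : E =>
      (holomorphicLog R v x + (v + I * R) / (((x : ℝ) : ℂ) + I * R)) * (κ x : ℂ) := fun v =>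
    (measurable_remainder hL v).mul (Complex.measurable_ofReal.comp h.measurable)
  have hu0 : u ∈ Metric.ball u (|u.im| / 2) := Metric.mem_ball_self hε
  have key := hasDerivAt_integral_of_dominated_loc_of_deriv_le (μ := μ) (𝕜 := ℂ)
    (F := fun v x => (holomorphicLog R v x + (v + I * R) / (((x : ℝ) : ℂ) + I * R)) * (κ x : ℂ))
    (F' := fun v x => (-1 / (((x : ℝ) : ℂ) - v) + 1 / (((x : ℝ) : ℂ) + I * R)) * (κ x : ℂ))
    (bound := fun x => M' * (κ x / (1 + (x : ℝ) ^ 2)))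
    (Metric.ball_mem_nhds u hε)
    (Eventually.of_forall fun v => (hmeas v).aestronglyMeasurable)
    (h.integrable_mul (measurable_remainder hL u) fun x => hMb u (hball u hu0).1 (hball u hu0).2 x)
    ?_ (Eventually.of_forall fun x v hv => ?_) (h.integrable.const_mul M')
    (Eventually.of_forall fun x v hv => ?_)
  · have h1 : compensator μ κ R (holomorphicLog R) Set.univ = fun v => ∫ x,
        (holomorphicLog R v (x : E) + (v + I * R) / (((x : ℝ) : ℂ) + I * R)) * (κ x : ℂ) ∂μ := by
      ext v
      rw [compensator, setIntegral_univ]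
    rw [h1]
    exact key.2.differentiableAt.differentiableWithinAt
  · refine Measurable.aestronglyMeasurable (Measurable.mul (by fun_prop) ?_)
    exact Complex.measurable_ofReal.comp h.measurable
  · rw [norm_mul, Complex.norm_real, Real.norm_of_nonneg (h.nonneg x), ← mul_div_assoc,
      mul_div_right_comm]
    exact mul_le_mul_of_nonneg_right (hMb' v (hball v hv).1 (hball v hv).2 x) (h.nonneg x)
  · have hv0 : v.im ≠ 0 := abs_pos.1 (hε.trans_le (hball v hv).2)
    exact ((hasDerivAt_holomorphicLog hR hv0 x).add
      (((hasDerivAt_id v).add_const (I * (R : ℂ))).div_const _)).mul_const _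

end RegProd

/-! ### Assembly of the theorem. -/

namespace RegProd

open scoped ENNReal NNReal
open Complex (I)

variable {E : Set ℝ} {μ : Measure E} {P : Measure (Conf E)} {R : ℝ} {K : E → E → ℂ}

theorem locallyCompactSpace_of_isOpen_or_discrete
    (hE : IsOpen E ∨ (E.Countable ∧ ∀ a : ℝ, ¬ AccPt a (𝓟 E))) : LocallyCompactSpace E := by
  rcases hE with hE | ⟨-, hE⟩
  · exact hE.locallyCompactSpace
  · have : IsClosed E := isClosed_iff_accPt.2 fun a ha => (hE a ha).elim
    exact this.isClosedEmbedding_subtypeVal.locallyCompactSpace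

theorem IsDeterminantal.exists_isSubPoisson [LocallyCompactSpace E] [SigmaFinite μ]
    [IsFiniteMeasureOnCompacts μ] [IsFiniteMeasure P]
    (hP : IsDeterminantal μ K P) (hK : IsProjectionKernel μ K)
    (hK1 : Integrable (fun x : E => K x x / (1 + ((x : ℝ) : ℂ) ^ 2)) μ) :
    ∃ κ : E → ℝ, IsSubPoisson μ κ P ∧ ∀ᵐ x ∂μ, K x x = κ x := by
  obtain ⟨ι, _, φ, H⟩ := hK.exists_isBesselExpansion
  have hφ : ∀ᵐ x ∂μ, ∑' i, ‖φ i x‖ ^ 2 = |(K x x).re| := by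
    filter_upwards [H.diag] with x hx
    rw [hx.2, Complex.ofReal_re, abs_of_nonneg (tsum_nonneg fun i => sq_nonneg _)]
  have hKm : Measurable fun x => K x x :=
    hK.measurable.comp (measurable_id.prodMk measurable_id)
  have hKκ : ∀ᵐ x ∂μ, K x x = ((|(K x x).re| : ℝ) : ℂ) := by
    filter_upwards [H.diag, hφ] with x hx hx'
    rw [← hx']
    exact hx.2
  -- This version of the diagonal is measurable and nonnegative everywhere, and equals `K x x`
  -- almost everywhere.
  refine ⟨fun x => |(K x x).re|, ⟨?_, fun x => abs_nonneg _, ?_, fun hf _ hC T =>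
    hP.aestronglyMeasurable_sum hf hC T, fun {f} hf {M} hM T => ?_⟩, hKκ⟩
  · exact (Complex.measurable_re.comp hKm).abs
  · refine hK1.norm.congr ?_
    filter_upwards [hKκ] with x hx
    have h1 : (1 + ((x : ℝ) : ℂ) ^ 2) = ((1 + (x : ℝ) ^ 2 : ℝ) : ℂ) := by push_cast; ring
    rw [h1, norm_div, Complex.norm_real, Real.norm_of_nonneg (by positivity)]
    congr 1
    nth_rewrite 1 [hx]
    rw [Complex.norm_real, Real.norm_eq_abs, abs_abs]
  · refine (hP.lintegral_exp_sum_le H (fun T => ?_) hf hM T).trans_eq ?_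
    · obtain ⟨Q, -, -, hQ⟩ := hK.exists_projection
      refine ((hQ _ (measurableSet_window T) (isBounded_window T)).1.re.abs).congr ?_
      filter_upwards [ae_restrict_of_ae hφ] with x hx
      exact hx.symm
    · congr 2
      refine integral_congr_ae (ae_restrict_of_ae ?_)
      filter_upwards [hφ] with x hx
      rw [hx]

/-- Both determinations exponentiate to the same number, so their real parts are the logarithm of
its modulus. -/
theorem holomorphicLog_re {u : ℂ} (hR : 0 < R) (hu : u.im ≠ 0) (x : ℝ) :
    (holomorphicLog R u x).re = (principalLog R u x).re := by
  have h1 := (exp_holomorphicLog hR hu x).trans (exp_principalLog hR hu x).symm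
  have h2 := congrArg norm h1
  rw [Complex.norm_exp, Complex.norm_exp] at h2
  exact Real.exp_injective h2

/-- The ratio of the principal and the holomorphic regularization. -/
noncomputable def branchFactor (μ : Measure E) (κ : E → ℝ) (R : ℝ) (u : ℂ) : ℂ :=
  Complex.exp (compensator μ κ R (holomorphicLog R) Set.univ u -
    compensator μ κ R (principalLog R) Set.univ u)

theorem IsSubPoisson.norm_branchFactor {κ : E → ℝ} (h : IsSubPoisson μ κ P) (hR : 0 < R) {u : ℂ}
    (hu : u.im ≠ 0) : ‖branchFactor μ κ R u‖ = 1 := by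
  obtain ⟨D, ε, hD, hε, hu'⟩ := exists_mem_strip hu
  have hint : ∀ {L : ℂ → ℝ → ℂ}, IsLogDetermination R L → Integrable (fun x : E =>
      (L u x + (u + I * R) / (((x : ℝ) : ℂ) + I * R)) * (κ x : ℂ)) μ := fun {L} hL => by
    obtain ⟨M, -, hMb⟩ := hL.bound D ε hD hε
    exact h.integrable_mul (measurable_remainder hL u) fun x => hMb u hu'.1 hu'.2 x
  have hre : ∀ {L : ℂ → ℝ → ℂ}, IsLogDetermination R L →
      (compensator μ κ R L Set.univ u).re = ∫ x : E,
        ((L u x).re + ((u + I * R) / (((x : ℝ) : ℂ) + I * R)).re) * κ x ∂μ := fun {L} hL => by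
    rw [compensator, setIntegral_univ]
    refine (integral_re (hint hL)).symm.trans (integral_congr_ae (Eventually.of_forall fun x => ?_))
    change ((L u x + (u + I * R) / (((x : ℝ) : ℂ) + I * R)) * (κ x : ℂ)).re = _
    rw [Complex.re_mul_ofReal, Complex.add_re]
  rw [branchFactor, Complex.norm_exp, Complex.sub_re, hre (isLogDetermination_holomorphicLog hR),
    hre (isLogDetermination_principalLog hR)]
  simp_rw [holomorphicLog_re hR hu, sub_self, Real.exp_zero]

theorem branchFactor_of_im_neg (μ : Measure E) (κ : E → ℝ) {u : ℂ} (hu : u.im < 0) :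
    branchFactor μ κ R u = 1 := by
  have h1 : ∀ x, holomorphicLog R u x = principalLog R u x := fun x => if_pos hu
  simp_rw [branchFactor, compensator, h1, sub_self, Complex.exp_zero]

end RegProd

open RegProd in
theorem proposition1 (E : Set ℝ)
    (hE : IsOpen E ∨ (E.Countable ∧ ∀ a : ℝ, ¬ AccPt a (𝓟 E)))
    (μ : Measure E) [IsFiniteMeasureOnCompacts μ]
    (K : E → E → ℂ) (hK : RegProd.IsProjectionKernel μ K)
    (hK1 : Integrable (fun x : E => K x x / (1 + ((x : ℝ) : ℂ) ^ 2)) μ)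
    (P : Measure (RegProd.Conf E)) [IsProbabilityMeasure P]
    (hP : RegProd.IsDeterminantal μ K P)
    (R : ℝ) (hR : 0 < R) :
    ∃ Ψ Ψh Ψt : RegProd.Conf E → ℂ → ℂ,
      -- (i) the limits exist in `L¹`: for the principal branch, for the holomorphic branch,
      -- and for the first-order compensator
      RegProd.ConvergesInL1 P (RegProd.truncPsi μ K R (RegProd.principalLog R)) Ψ ∧
      RegProd.ConvergesInL1 P (RegProd.truncPsi μ K R (RegProd.holomorphicLog R)) Ψh ∧
      RegProd.ConvergesInL1 P (RegProd.truncPsiTilde μ K R) Ψt ∧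
      -- (ii) the generated algebras are contained in `L¹`
      RegProd.AlgebrasInL1 P Ψ ∧ RegProd.AlgebrasInL1 P Ψh ∧ RegProd.AlgebrasInL1 P Ψt ∧
      -- (iii) locally uniform convergence along a subsequence, and analyticity
      ∃ W : Set (RegProd.Conf E), MeasurableSet W ∧ P W = 1 ∧
        (∀ C : Set ℂ, IsCompact C → C ⊆ RegProd.nonreal →
          ∃ T : ℕ → ℝ, StrictMono T ∧ Tendsto T atTop atTop ∧ ∀ X ∈ W,
            TendstoUniformlyOn
              (fun N => RegProd.truncPsi μ K R (RegProd.principalLog R) (T N) X) (Ψ X) atTop C ∧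
            TendstoUniformlyOn
              (fun N => RegProd.truncPsi μ K R (RegProd.holomorphicLog R) (T N) X) (Ψh X) atTop C ∧
            TendstoUniformlyOn
              (fun N => RegProd.truncPsiTilde μ K R (T N) X) (Ψt X) atTop C) ∧
        (∀ X ∈ W, AnalyticOnNhd ℂ (Ψh X) RegProd.nonreal ∧
          AnalyticOnNhd ℂ (Ψt X) RegProd.nonreal) ∧
        -- with the principal branch: the same function for `Im u < 0`, and the same function up
        -- to a deterministic factor of modulus one for `Im u > 0`
        ∃ c : ℂ → ℂ, (∀ u ∈ RegProd.nonreal, ‖c u‖ = 1) ∧ (∀ u : ℂ, u.im < 0 → c u = 1) ∧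
          ∀ X ∈ W, ∀ u ∈ RegProd.nonreal, Ψ X u = c u * Ψh X u := by
  have := locallyCompactSpace_of_isOpen_or_discrete hE
  obtain ⟨κ, h, hκ⟩ := hP.exists_isSubPoisson hK hK1
  obtain ⟨A, hA, hAt⟩ := h.exists_limit_centeredSum
    (F := fun x => 1 / (((x : ℝ) : ℂ) + Complex.I * R)) (by fun_prop)
    (fun x => norm_one_div_add_mul_I_le hR x) (fun x => norm_one_div_add_mul_I_sq_le hR x)
  -- The sequence depends on neither `u` nor the compact, so `W` can be fixed once for all.
  obtain ⟨ns, hns, hae⟩ := h.exists_seq_ae_tendsto hA hAt hR tendsto_natCast_atTop_atTop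
  obtain ⟨W, hWP, hWm, hW⟩ := hae.exists_measurable_mem
  have hT : StrictMono fun N => (ns N : ℝ) := Nat.strictMono_cast.comp hns
  have hT' : Tendsto (fun N => (ns N : ℝ)) atTop atTop :=
    tendsto_natCast_atTop_atTop.comp hns.tendsto_atTop
  have hLp := isLogDetermination_principalLog hR
  have hLh := isLogDetermination_holomorphicLog hR
  have hconv : ∀ {L : ℂ → ℝ → ℂ}, IsLogDetermination R L → ConvergesInL1 P (truncPsi μ K R L)
      fun X u => Complex.exp (logLimit A R X u - compensator μ κ R L Set.univ u) := fun {L} hL => by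
    refine (h.convergesInL1_exp hA hAt hR
      (δT := fun T => compensator μ κ R L {x : E | |(x : ℝ)| ≤ T}) (fun u hu => ?_)
      fun u hu => ?_).congr fun u hu T X => h.exp_logTrunc_sub hR hL hκ hu T X
    · obtain ⟨D, ε, hD, hε, hu'⟩ := exists_mem_strip hu
      exact (h.tendstoUniformlyOn_compensator hL tendsto_id hD hε).tendsto_at hu'
    · obtain ⟨D, ε, hD, hε, hu'⟩ := exists_mem_strip hu
      obtain ⟨B, hB⟩ := h.norm_compensator_le hL hD hε
      exact ⟨B, fun T => hB _ u hu'⟩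
  have halg : ∀ δ : ℂ → ℂ, AlgebrasInL1 P fun X u => Complex.exp (logLimit A R X u - δ u) :=
    fun δ => algebrasInL1_exp fun u hu => (h.hasExpMoments_logLimit hA hAt hR hu).sub_const _
  have hunif : ∀ {L : ℂ → ℝ → ℂ}, IsLogDetermination R L → ∀ C : Set ℂ, IsCompact C →
      C ⊆ nonreal → ∀ X ∈ W, TendstoUniformlyOn (fun N => truncPsi μ K R L (ns N) X)
        (fun u => Complex.exp (logLimit A R X u - compensator μ κ R L Set.univ u)) atTop C :=
    fun {L} hL C hC hC' X hX => by
    refine (tendstoUniformlyOn_exp_sub hR (hW X hX).1 hT' (hW X hX).2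
      (δT := fun N => compensator μ κ R L {x : E | |(x : ℝ)| ≤ ns N})
      (fun D ε hD hε => h.tendstoUniformlyOn_compensator hL hT' hD hε)
      (fun D ε hD hε => ?_) hC hC').congr (Eventually.of_forall fun N u hu =>
        (h.exp_logTrunc_sub hR hL hκ (hC' hu) (ns N) X).symm)
    obtain ⟨B, hB⟩ := h.norm_compensator_le hL hD hε
    exact ⟨B, fun u hu => hB _ u hu⟩
  have hunif' : ∀ C : Set ℂ, IsCompact C → C ⊆ nonreal → ∀ X ∈ W,
      TendstoUniformlyOn (fun N => truncPsiTilde μ K R (ns N) X)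
        (fun u => Complex.exp (logLimit A R X u)) atTop C := fun C hC hC' X hX => by
    have := tendstoUniformlyOn_exp_sub hR (hW X hX).1 hT' (hW X hX).2
      (δT := fun _ _ => 0) (δ := fun _ => 0)
      (fun D ε _ _ => tendstoUniformlyOn_of_norm_sub_le (b := fun _ => 0) tendsto_const_nhds
        (by simp)) (fun D ε _ _ => ⟨0, by simp⟩) hC hC'
    simp_rw [sub_zero] at this
    exact this.congr (Eventually.of_forall fun N u hu =>
      (exp_logTrunc hR hκ (hC' hu) (ns N) X).symm)
  -- Analyticity is obtained for the exponential, as a locally uniform limit of holomorphic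
  -- functions: `logLimit` itself is built from the principal branch and may jump in the upper
  -- half-plane.
  have hanal : ∀ X ∈ W, DifferentiableOn ℂ (fun u => Complex.exp (logLimit A R X u)) nonreal :=
    fun X hX => ((tendstoLocallyUniformlyOn_iff_forall_isCompact isOpen_nonreal).2
      fun C hC hC' => hunif' C hC' hC X hX).differentiableOn
        (Eventually.of_forall fun N => differentiableOn_truncPsiTilde K (ns N) X) isOpen_nonreal
  refine ⟨_, _, fun X u => Complex.exp (logLimit A R X u), hconv hLp, hconv hLh, ?_,
    halg _, halg _, by simpa using halg 0, W, hWm, (mem_ae_iff_prob_eq_one hWm).1 hWP,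
    fun C hC hC' => ⟨_, hT, hT', fun X hX => ⟨hunif hLp C hC hC' X hX, hunif hLh C hC hC' X hX,
      hunif' C hC hC' X hX⟩⟩, fun X hX => ⟨?_, (hanal X hX).analyticOnNhd isOpen_nonreal⟩,
    branchFactor μ κ R, fun u hu => h.norm_branchFactor hR hu,
    fun u hu => branchFactor_of_im_neg μ κ hu, fun X _ u _ => ?_⟩
  · have := h.convergesInL1_exp hA hAt hR (δT := fun _ _ => 0) (δ := fun _ => 0)
      (fun _ _ => tendsto_const_nhds) (fun _ _ => ⟨0, by simp⟩)
    simp_rw [sub_zero] at this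
    exact this.congr fun u hu T X => exp_logTrunc hR hκ hu T X
  -- The holomorphic regularization is the linear one divided by the exponential of an analytic
  -- compensator.
  · refine DifferentiableOn.analyticOnNhd ?_ isOpen_nonreal
    simp_rw [Complex.exp_sub]
    exact (hanal X hX).div (differentiableOn_compensator_holomorphicLog h hR).cexp
      fun u _ => Complex.exp_ne_zero _
  · rw [branchFactor, ← Complex.exp_add]
    ring_nf
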